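/- **Setting.** Let $\mathcal X,\mathcal A$ be measurable spaces (prompts, responses), $d\ge 1$, $d_0$ a probability distribution on $\mathcal X$, $\pi_0(\cdot|x)$ a reference policy (Markov kernel), $\eta>0$, $B>0$, and $\phi:\mathcal X\times\mathcal A\to\mathbb R^d$ a measurable feature map with $\|\phi(x,a)\|\le 1$. For $\theta\in\mathbb R^d$ put $r_\theta(x,a)=\langle\theta,\phi(x,a)\rangle$. The true reward is $r^*=r_{\theta^*}$ with $\|\theta^*\|\le B$ and $r^*(x,a)\in[0,1]$ for all $(x,a)$. Put $\gamma=1/(2+e^{-B}+e^{B})$. Preferences follow the Bradley–Terry model: given $(x,a^1,a^2)$, the label $y$ equals $1$ with probability $\sigma(r^*(x,a^1)-r^*(x,a^2))$ and $0$ otherwise, $\sigma(z)=1/(1+e^{-z})$. The policy class is $\Pi=\{\pi_\theta:\|\theta\|\le B\}$, $\pi_\theta(\cdot|x)\propto\pi_0(\cdot|x)\exp(r_\theta(x,\cdot)/\eta)$. The target is $J(\pi)=\mathbb E_{x\sim d_0}\big[\mathbb E_{a\sim\pi(\cdot|x)}r^*(x,a)-\eta D_{\rm KL}(\pi(\cdot|x)\|\pi_0(\cdot|x))\big]$,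 and $\pi^*\in\arg\max_{\pi\in\Pi}J(\pi)$. Write $\phi(x,\pi)=\mathbb E_{a\sim\pi(\cdot|x)}\phi(x,a)$ and $\|z\|_S=\sqrt{z^\top Sz}$. **Algorithm (Online Iterative GSHF, Option II)** with batch size $m$, number of iterations $T$ and parameters $\lambda,\beta>0$. It starts from an offline data set $\mathcal D_{\rm off}$ (possibly empty) whose prompts and response pairs have an arbitrary joint law and whose labels are conditionally independent Bradley–Terry labels; no coverage of any kind is assumed. In iteration $t=1,\dots,T$: 1. $\theta_t$ maximizes over $\{\|\theta\|\le B\}$ the Bradley–Terry log-likelihood of $\mathcal D_{\rm off}$ and all earlier batches, and $\pi_t^1\in\arg\max_{\pi\in\Pi}\mathbb E_{x\sim d_0}\big[\mathbb E_{a\sim\pi(\cdot|x)}r_{\theta_t}(x,a)-\eta D_{\rm KL}(\pi(\cdot|x)\|\pi_0(\cdot|x))\big]$. 2. Prompts $x_{t,1},\dots,x_{t,m}\sim d_0$ are drawn independently. With $\Sigma_{t,m}=\lambda I+\frac1m\sum_{i<t}\sum_{j\le m}z_{i,j}z_{i,j}^\top$, $z_{i,j}=\phi(x_{i,j},a^1_{i,j})-\phi(x_{i,j},a^2_{i,j})$,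 and $\Gamma_t(\pi)=\beta\sum_{j=1}^m\|\phi(x_{t,j},\pi)-\phi(x_{t,j},\pi_t^1)\|_{\Sigma_{t,m}^{-1}}$, the enhancer $\pi_t^2$ maximizes $\Gamma_t$ over $\Pi_t=\{\pi\in\Pi:\eta\,\mathbb E_{x\sim d_0}D_{\rm KL}(\pi(\cdot|x)\|\pi_t^1(\cdot|x))\le\Gamma_t(\pi)\}$. 3. For $j\le m$, independently, $a^1_{t,j}\sim\pi_t^1(\cdot|x_{t,j})$, $a^2_{t,j}\sim\pi_t^2(\cdot|x_{t,j})$, and the label $y_{t,j}$ is drawn from the Bradley–Terry model. All maximizers may be any measurable selections. **Theorem.** Let $c_\beta,c_\lambda>0$. There is a constant $C>0$, depending only on $c_\beta$ and $c_\lambda$, such that the following holds in every such setting and for all $\epsilon>0$ and $\delta\in(0,1)$. Put $m=\lceil d/(\gamma^2\epsilon^2)\rceil$ and, for $n\ge1$, $\lambda_n=c_\lambda\,\dfrac{d\log(n/\delta)}{m\gamma^2B^2}$ and $\beta_n=c_\beta\sqrt{\dfrac{d\log(n/\delta)}{\gamma^2m}}$; let $T=\min\{n\in\mathbb N^+:\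 n\ge d\log(1+\tfrac{4n}{d\lambda_n})\}$, $\lambda=\lambda_T$, $\beta=\beta_T$ and $\mathcal L=\log\big(2+\tfrac{d}{\gamma\epsilon\delta}\big)$. (i) For every $\mathcal D_{\rm off}$ as above, with probability at least $1-3\delta$ the algorithm with these parameters has an iterate $t_0\in\{1,\dots,T\}$ with $$J(\pi^*)-J(\pi^1_{t_0})\le C\,\epsilon\,\sqrt{\mathcal L}-\eta\,\mathbb E_{x\sim d_0}\big[D_{\rm KL}(\pi^*(\cdot|x)\,\|\,\pi^1_{t_0}(\cdot|x))\big].$$ (ii) If $\gamma^2\epsilon^2\le d$ (that is, $d/(\gamma^2\epsilon^2)\ge1$), the number of collected samples satisfies $$mT\le C\,\frac{d^2}{\gamma^2\epsilon^2}\,\mathcal L .$$ -/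

import Mathlib

open MeasureTheory ProbabilityTheory InformationTheory

noncomputable section

/-- A KL-regularized contextual bandit with linear reward: prompts `X`, responses `A`, prompt
distribution `d0`, reference policy `pi0`, feature map `φ` into `ℝ^d` with `‖φ‖ ≤ 1`, KL
coefficient `η > 0`, and true reward `r*(x, a) = ⟪θstar, φ x a⟫ ∈ [0, 1]` with `‖θstar‖ ≤ B`. -/
structure KLBandit (X A : Type*) [MeasurableSpace X] [MeasurableSpace A] (d : ℕ) where
  d0 : Measure X
  d0_prob : IsProbabilityMeasure d0
  pi0 : Kernel X A
  pi0_markov : IsMarkovKernel pi0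
  φ : X → A → EuclideanSpace ℝ (Fin d)
  φ_measurable : Measurable (Function.uncurry φ)
  φ_norm_le : ∀ x a, ‖φ x a‖ ≤ 1
  η : ℝ
  η_pos : 0 < η
  B : ℝ
  B_pos : 0 < B
  θstar : EuclideanSpace ℝ (Fin d)
  θstar_norm_le : ‖θstar‖ ≤ B
  reward_mem : ∀ x a, inner ℝ θstar (φ x a) ∈ Set.Icc (0 : ℝ) 1

/-- A labelled comparison `(x, a¹, a², y)`; `y = true` means that `a¹` is preferred to `a²`. -/
abbrev Sample (X A : Type*) := X × A × A × Bool

/-- The data available after `t` online iterations: the offline data set (of size `nOff`, possibly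
`0`) and the `t` online batches of size `m`. -/
abbrev History (X A : Type*) (nOff m t : ℕ) :=
  (Fin nOff → Sample X A) × (Fin t → Fin m → Sample X A)

/-- `‖z‖_S = √(zᵀ S z)`. -/
def inducedNorm {d : ℕ} (S : Matrix (Fin d) (Fin d) ℝ) (z : EuclideanSpace ℝ (Fin d)) : ℝ :=
  √(dotProduct z.ofLp (S.mulVec z.ofLp))

namespace KLBandit

variable {X A : Type*} [MeasurableSpace X] [MeasurableSpace A] {d : ℕ} (M : KLBandit X A d)

/-- `r_θ(x, a) = ⟪θ, φ(x, a)⟫`. -/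
def reward (θ : EuclideanSpace ℝ (Fin d)) (x : X) (a : A) : ℝ := inner ℝ θ (M.φ x a)

/-- `γ = 1 / (2 + exp (-B) + exp B)`. -/
def gamma : ℝ := 1 / (2 + Real.exp (-M.B) + Real.exp M.B)

/-- The Gibbs policy `π_θ(·|x) ∝ π₀(·|x) exp (⟪θ, φ(x, ·)⟫ / η)`. -/
def gibbs (θ : EuclideanSpace ℝ (Fin d)) (x : X) : Measure A :=
  (M.pi0 x).tilted (fun a => M.reward θ x a / M.η)

/-- The policy class `Π` of the Gibbs policies with `‖θ‖ ≤ B`. -/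
def policyClass : Set (X → Measure A) := {π | ∃ θ, ‖θ‖ ≤ M.B ∧ π = M.gibbs θ}

/-- `E_{x ∼ d₀} KL(π(·|x) ‖ π'(·|x))`. -/
def expectedKL (π π' : X → Measure A) : ℝ := ∫ x, (klDiv (π x) (π' x)).toReal ∂M.d0

/-- `E_{x ∼ d₀} [E_{a ∼ π(·|x)} r(x, a) - η KL(π(·|x) ‖ π₀(·|x))]`. -/
def regValue (r : X → A → ℝ) (π : X → Measure A) : ℝ :=
  ∫ x, ((∫ a, r x a ∂π x) - M.η * (klDiv (π x) (M.pi0 x)).toReal) ∂M.d0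

/-- The target `J`. -/
def J (π : X → Measure A) : ℝ := M.regValue (M.reward M.θstar) π

/-- `π` is an optimal policy: a maximizer of `J` in the policy class. -/
def IsOptimal (π : X → Measure A) : Prop := π ∈ M.policyClass ∧ IsMaxOn M.J M.policyClass π

/-- `φ(x, π) = E_{a ∼ π(·|x)} φ(x, a)`. -/
def meanFeature (x : X) (π : X → Measure A) : EuclideanSpace ℝ (Fin d) := ∫ a, M.φ x a ∂π x

/-- Contribution of one comparison to the Bradley-Terry log-likelihood. -/
def logLikSample (θ : EuclideanSpace ℝ (Fin d)) (s : Sample X A) : ℝ :=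
  let (x, a₁, a₂, y) := s
  if y then Real.log (Real.sigmoid (M.reward θ x a₁ - M.reward θ x a₂))
  else Real.log (Real.sigmoid (M.reward θ x a₂ - M.reward θ x a₁))

/-- The Bradley-Terry log-likelihood of all the data collected so far. -/
def logLik {nOff m t : ℕ} (h : History X A nOff m t) (θ : EuclideanSpace ℝ (Fin d)) : ℝ :=
  ∑ i, M.logLikSample θ (h.1 i) + ∑ i, ∑ j, M.logLikSample θ (h.2 i j)

/-- `φ(x, a¹) - φ(x, a²)` for a comparison. -/
def featureDiff (s : Sample X A) : EuclideanSpace ℝ (Fin d) :=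
  M.φ s.1 s.2.1 - M.φ s.1 s.2.2.1

/-- The covariance matrix
`lam • I + (1/m) ∑_{i<t} ∑_j (φ(x_{i,j}, a¹_{i,j}) - φ(x_{i,j}, a²_{i,j})) (⋯)ᵀ` of the online
data. -/
def covMatrix {nOff m t : ℕ} (lam : ℝ) (h : History X A nOff m t) :
    Matrix (Fin d) (Fin d) ℝ :=
  lam • (1 : Matrix (Fin d) (Fin d) ℝ) + (1 / (m : ℝ)) •
    ∑ i, ∑ j, Matrix.vecMulVec (M.featureDiff (h.2 i j)).ofLp (M.featureDiff (h.2 i j)).ofLp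

/-- The uncertainty `Γ(lam, π₁, π) = β ∑_j ‖φ(x_j, π) - φ(x_j, π₁)‖_{Σ⁻¹}` of `π` relative to
`π₁` on the current prompts `x_1, …, x_m`. -/
def uncertainty {nOff m t : ℕ} (lam β : ℝ) (h : History X A nOff m t) (xs : Fin m → X)
    (π₁ π : X → Measure A) : ℝ :=
  β * ∑ j, inducedNorm (M.covMatrix lam h)⁻¹ (M.meanFeature (xs j) π - M.meanFeature (xs j) π₁)

/-- The set of the policies in `Π` whose (scaled) KL divergence from `π₁` is at most their
uncertainty relative to `π₁`. -/
def enhancerSet {nOff m t : ℕ} (lam β : ℝ) (h : History X A nOff m t) (xs : Fin m → X)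
    (π₁ : X → Measure A) : Set (X → Measure A) :=
  {π ∈ M.policyClass | M.η * M.expectedKL π π₁ ≤ M.uncertainty lam β h xs π₁ π}

/-- The law of `(x, a¹, a², y)` for given `(x, a¹, a²)`, with the label from the Bradley-Terry
model: `y = true` with probability `σ(r*(x, a¹) - r*(x, a²))`. -/
def labelledLaw (p : X × A × A) : Measure (Sample X A) :=
  let q := Real.sigmoid (M.reward M.θstar p.1 p.2.1 - M.reward M.θstar p.1 p.2.2)
  ENNReal.ofReal q • Measure.dirac (p.1, p.2.1, p.2.2, true)
    + ENNReal.ofReal (1 - q) • Measure.dirac (p.1, p.2.1, p.2.2, false)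

/-- The law of `(x, a¹, a², y)` for a given prompt `x`, with `a¹ ∼ π₁(·|x)` and `a² ∼ π₂(·|x)`
independent. -/
def comparisonLaw (π₁ π₂ : X → Measure A) (x : X) : Measure (Sample X A) :=
  ((π₁ x).prod (π₂ x)).bind (fun a => M.labelledLaw (x, a.1, a.2))

/-- The law of the offline data: prompts and response pairs with an arbitrary joint law `ρ`, and
conditionally independent Bradley-Terry labels. -/
def offlineLaw {nOff : ℕ} (ρ : Measure (Fin nOff → X × A × A)) :
    Measure (Fin nOff → Sample X A) :=
  ρ.bind (fun p => Measure.pi (fun i => M.labelledLaw (p i)))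

end KLBandit

/-- The decision rules of the online iterative algorithm, as measurable functions of the data:
the estimated reward parameter, the parameter of the policy of the main agent, and the parameter
of the policy of the enhancer (which may also depend on the current prompts). -/
structure GSHFRules (X A : Type*) [MeasurableSpace X] [MeasurableSpace A] (d nOff m : ℕ) where
  mle : ∀ t, History X A nOff m t → EuclideanSpace ℝ (Fin d)
  mainParam : ∀ t, History X A nOff m t → EuclideanSpace ℝ (Fin d)
  enhParam : ∀ t, History X A nOff m t → (Fin m → X) → EuclideanSpace ℝ (Fin d)
  mle_measurable : ∀ t, Measurable (mle t)
  mainParam_measurable : ∀ t, Measurable (mainParam t)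
  enhParam_measurable : ∀ t, Measurable (Function.uncurry (enhParam t))

namespace GSHFRules

variable {X A : Type*} [MeasurableSpace X] [MeasurableSpace A] {d nOff m : ℕ}

/-- The policy of the main agent in the iteration that starts with the data `h`. -/
def mainPolicy (R : GSHFRules X A d nOff m) (M : KLBandit X A d) {t : ℕ}
    (h : History X A nOff m t) : X → Measure A := M.gibbs (R.mainParam t h)

/-- The policy of the enhancer in the iteration that starts with the data `h` and has the
prompts `xs`. -/
def enhPolicy (R : GSHFRules X A d nOff m) (M : KLBandit X A d) {t : ℕ}
    (h : History X A nOff m t) (xs : Fin m → X) : X → Measure A := M.gibbs (R.enhParam t h xs)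

/-- The rules are those of Online Iterative GSHF with the exploring enhancer (Option II) and the
parameters `lam`, `β`. -/
structure IsOptionII (R : GSHFRules X A d nOff m) (M : KLBandit X A d) (lam β : ℝ) : Prop where
  /-- The reward estimate is a maximum likelihood estimate in `Θ(B)`. -/
  mle_mem : ∀ t h, ‖R.mle t h‖ ≤ M.B
  mle_max : ∀ t h, IsMaxOn (M.logLik h) {θ | ‖θ‖ ≤ M.B} (R.mle t h)
  /-- The main agent maximizes the KL-regularized estimated reward in `Π`. -/
  main_mem : ∀ (t : ℕ) (h : History X A nOff m t), R.mainPolicy M h ∈ M.policyClass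
  main_max : ∀ (t : ℕ) (h : History X A nOff m t),
    IsMaxOn (M.regValue (M.reward (R.mle t h))) M.policyClass (R.mainPolicy M h)
  /-- The enhancer maximizes the uncertainty in the constrained set. -/
  enh_mem : ∀ (t : ℕ) (h : History X A nOff m t) (xs : Fin m → X),
    R.enhPolicy M h xs ∈ M.enhancerSet lam β h xs (R.mainPolicy M h)
  enh_max : ∀ (t : ℕ) (h : History X A nOff m t) (xs : Fin m → X),
    IsMaxOn (M.uncertainty lam β h xs (R.mainPolicy M h))
      (M.enhancerSet lam β h xs (R.mainPolicy M h)) (R.enhPolicy M h xs)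

/-- The law of the batch collected after the data `h`: `m` independent prompts from `d₀`, then
independent comparisons of the responses of the main agent and of the enhancer. -/
def batchLaw (R : GSHFRules X A d nOff m) (M : KLBandit X A d) {t : ℕ}
    (h : History X A nOff m t) : Measure (Fin m → Sample X A) :=
  (Measure.pi (fun _ : Fin m => M.d0)).bind (fun xs =>
    Measure.pi (fun j => M.comparisonLaw (R.mainPolicy M h) (R.enhPolicy M h xs) (xs j)))

/-- The law of the data after `t` iterations. -/
def runLaw (R : GSHFRules X A d nOff m) (M : KLBandit X A d)
    (ρ : Measure (Fin nOff → X × A × A)) : (t : ℕ) → Measure (History X A nOff m t)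
  | 0 => (M.offlineLaw ρ).map (fun D => (D, Fin.elim0))
  | t + 1 => (runLaw R M ρ t).bind (fun h => (R.batchLaw M h).map
      (fun b => (h.1, Fin.snoc (α := fun _ => Fin m → Sample X A) h.2 b)))

end GSHFRules

/-- The part of a history that is available before iteration `t` (counted from `0`). -/
def History.before {X A : Type*} {nOff m T : ℕ} (h : History X A nOff m T) (t : Fin T) :
    History X A nOff m t := (h.1, fun i => h.2 (Fin.castLE t.2.le i))

namespace KLBandit

variable {X A : Type*} [MeasurableSpace X] [MeasurableSpace A] {d : ℕ} (M : KLBandit X A d)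

/-- The batch size `m = ⌈d / (γ² ε²)⌉`. -/
def batchSize (ε : ℝ) : ℕ := ⌈(d : ℝ) / (M.gamma ^ 2 * ε ^ 2)⌉₊

/-- The regularization `c · d log (n / δ) / (m γ² B²)` for `n` iterations. -/
def regParam (c ε δ : ℝ) (n : ℕ) : ℝ :=
  c * (d * Real.log (n / δ) / (M.batchSize ε * M.gamma ^ 2 * M.B ^ 2))

/-- The bonus coefficient `c · √(d log (n / δ) / (γ² m))` for `n` iterations. -/
def bonusParam (c ε δ : ℝ) (n : ℕ) : ℝ :=
  c * √(d * Real.log (n / δ) / (M.gamma ^ 2 * M.batchSize ε))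

/-- The number of iterations: the least `n ≥ 1` with `n ≥ d log (1 + 4 n / (d lam))`, where `lam`
is the regularization parameter for `n` iterations. -/
def numIter (c ε δ : ℝ) : ℕ :=
  sInf {n : ℕ | 1 ≤ n ∧ d * Real.log (1 + 4 * n / (d * M.regParam c ε δ n)) ≤ n}

/-- The logarithmic factor `log (2 + d / (γ ε δ))`. -/
def logFactor (ε δ : ℝ) : ℝ := Real.log (2 + d / (M.gamma * ε * δ))

end KLBandit

end

noncomputable section

/-! ### Scalar inequalities -/

/-! The main agent maximizes the regularized estimated reward over the class, so its policy is
`d₀`-almost everywhere the Gibbs policy of the estimate `θ_t`. Divergences between Gibbs policies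
are explicit, and `J(π*) - J(π¹) + η E KL(π* ‖ π¹)` turns out to equal the mean of `⟪θ* - θ_t, φ(x,
π*) - φ(x, π¹)⟫` exactly (`J_sub_J_add_expectedKL`). This is the origin of the negative divergence
in the conclusion. By Cauchy–Schwarz the mean is at most the `Σ`-norm of the estimation error times
the mean `Σ⁻¹`-uncertainty of `π*`.

The first factor is of order `ε √L` in all iterations at once (`runLaw_sumSq_gt_le`). True reward
differences lie in `[-1, 1]`, which gives the log-likelihood a quadratic decrease of order `γ` away
from `θ*` on the whole parameter ball; the score at `θ*` is controlled by exponential moments on a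
net. The net is taken in the norm of the offline Gram matrix, conditionally on the offline prompts
and responses, so its cardinality does not depend on the amount or the quality of the offline data.

For the second factor, the elliptical potential and the choice of `T` give one iteration whose
comparisons have mean uncertainty at most `2` (`exists_sum_sampleNorm_le`). A Chernoff bound over
the responses, given the prompts, passes from the comparisons to the enhancer; maximality of the
enhancer passes to `π*`; a Chernoff bound over the prompts passes from the batch to `d₀`. If `π*`
violates the constraint of the enhancer, its divergence from `π¹`, which stands on the left of the
identity, exceeds its uncertainty and absorbs it (`gap_le_of_concentration`).

All this needs `ε √L` small compared with `B`; otherwise the deterministic bound `4 B` is enough.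
For the sample count, the inequality that defines `T` already holds at a constant multiple of `d L`
(`numIter_le`). -/

lemma sigmoid_add_sub_ge {v s : ℝ} (hv : |v| ≤ 1) (hs : 0 ≤ s) :
    s / (8 * (1 + s)) ≤ Real.sigmoid (v + s) - Real.sigmoid v := by
  have h1 : Real.exp v ≤ 3 := by
    have := Real.exp_le_exp.2 (abs_le.1 hv).2
    linarith [Real.exp_one_lt_d9]
  have h2 : Real.exp (-v) ≤ 3 := by
    have := Real.exp_le_exp.2 (show -v ≤ 1 by linarith [(abs_le.1 hv).1])
    linarith [Real.exp_one_lt_d9]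
  set a := Real.exp (-v) with ha
  have hapos : 0 < a := Real.exp_pos _
  have hv' : Real.exp v = a⁻¹ := by rw [ha, Real.exp_neg, inv_inv]
  rw [hv'] at h1
  have ha3 : 1 ≤ 3 * a := by
    rw [inv_le_iff_one_le_mul₀ hapos] at h1
    exact h1
  set b := Real.exp (-s) with hb
  have hbpos : 0 < b := Real.exp_pos _
  have hb1 : b ≤ 1 := by rw [hb]; exact Real.exp_le_one_iff.2 (by linarith)
  have hbs : b * (1 + s) ≤ 1 := by
    have : 1 + s ≤ Real.exp s := by linarith [Real.add_one_le_exp s]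
    calc b * (1 + s) ≤ b * Real.exp s := by gcongr
      _ = 1 := by rw [hb, ← Real.exp_add]; simp
  rw [Real.sigmoid_def, Real.sigmoid_def, neg_add, Real.exp_add, ← ha, ← hb]
  have e : (1 + a * b)⁻¹ - (1 + a)⁻¹ = a * (1 - b) / ((1 + a * b) * (1 + a)) := by
    field_simp
    ring
  rw [e, div_le_div_iff₀ (by positivity) (by positivity)]
  -- Here `a = exp (-v)` lies in `[1/3, 3]`, where `(1 + a)² ≤ 8 a`; this is the constant `8` of the
  -- statement.
  have k1 : (1 + a * b) * (1 + a) ≤ 8 * a := by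
    have : (1 + a * b) * (1 + a) ≤ (1 + a) * (1 + a) := by gcongr; nlinarith
    nlinarith
  have k2 : s ≤ (1 - b) * (1 + s) := by linarith
  calc s * ((1 + a * b) * (1 + a)) ≤ s * (8 * a) := by gcongr
    _ ≤ ((1 - b) * (1 + s)) * (8 * a) := by gcongr
    _ = _ := by ring

/-- A quantitative form of the monotonicity of the sigmoid function around `[-1, 1]`. -/
lemma sigmoid_add_sub_mul_ge {v s : ℝ} (hv : |v| ≤ 1) :
    s ^ 2 / (8 * (1 + |s|)) ≤ (Real.sigmoid (v + s) - Real.sigmoid v) * s := by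
  rcases le_total 0 s with hs | hs
  · have := mul_le_mul_of_nonneg_right (sigmoid_add_sub_ge hv hs) hs
    rw [abs_of_nonneg hs]
    calc _ = s / (8 * (1 + s)) * s := by ring
      _ ≤ _ := this
  · have h := mul_le_mul_of_nonneg_right
      (sigmoid_add_sub_ge (v := -v) (s := -s) (by rwa [abs_neg]) (by linarith))
      (show 0 ≤ -s by linarith)
    rw [← neg_add, Real.sigmoid_neg, Real.sigmoid_neg] at h
    rw [abs_of_nonpos hs]
    calc _ = -s / (8 * (1 + -s)) * -s := by ring
      _ ≤ _ := h
      _ = _ := by ring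

lemma log_sigmoid_eq_sub (w : ℝ) :
    Real.log (Real.sigmoid (-w)) = Real.log (Real.sigmoid w) - w := by
  rw [← Real.sigmoid_mul_rexp_neg, Real.log_mul (Real.sigmoid_pos w).ne' (Real.exp_pos _).ne',
    Real.log_exp]
  ring

/-- The tangent inequality for the concave function `log ∘ sigmoid`. -/
lemma log_sigmoid_add_le (v w : ℝ) :
    Real.log (Real.sigmoid (v + w)) ≤
      Real.log (Real.sigmoid v) + (1 - Real.sigmoid v) * w := by
  set q := Real.sigmoid v with hq
  have hq0 : 0 < q := Real.sigmoid_pos v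
  have hq1 : q < 1 := Real.sigmoid_lt_one v
  have hinv : (Real.sigmoid (v + w))⁻¹ = q⁻¹ * (q + (1 - q) * Real.exp (-w)) := by
    have e1 : Real.exp (-v) = q⁻¹ * (1 - q) := by
      rw [← Real.sigmoid_neg, ← Real.sigmoid_mul_rexp_neg, ← hq, inv_mul_cancel_left₀ hq0.ne']
    rw [Real.sigmoid_def, inv_inv, neg_add, Real.exp_add, e1]
    field_simp
  -- Convexity of `exp` at `0` and `-w` with weights `q` and `1 - q`; its logarithm is the tangent
  -- inequality.
  have hconv : Real.exp (-((1 - q) * w)) ≤ q + (1 - q) * Real.exp (-w) := by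
    have := convexOn_exp.2 (Set.mem_univ (0 : ℝ)) (Set.mem_univ (-w)) hq0.le
      (sub_nonneg.2 hq1.le) (by ring)
    simpa using this
  have hpos : 0 < q + (1 - q) * Real.exp (-w) := lt_of_lt_of_le (Real.exp_pos _) hconv
  have h1 : Real.log (Real.sigmoid (v + w)) = Real.log q - Real.log (q + (1 - q) * Real.exp (-w)) := by
    rw [← neg_inj, ← Real.log_inv, hinv, Real.log_mul (by positivity) hpos.ne', Real.log_inv]
    ring
  have h2 : -((1 - q) * w) ≤ Real.log (q + (1 - q) * Real.exp (-w)) :=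
    (Real.le_log_iff_exp_le hpos).2 hconv
  rw [h1]
  linarith

/-- A quadratic upper bound for `log ∘ sigmoid` around `[-1, 1]`. -/
lemma log_sigmoid_add_le_quadratic {v w : ℝ} (hv : |v| ≤ 1) :
    Real.log (Real.sigmoid (v + w)) ≤
      Real.log (Real.sigmoid v) + (1 - Real.sigmoid v) * w - w ^ 2 / (32 * (1 + |w| / 2)) := by
  -- Two tangent steps of length `w / 2`. The slope at the midpoint differs from the slope at `v` by
  -- an increment of the sigmoid, and this increment produces the quadratic term.
  have h1 := log_sigmoid_add_le (v + w / 2) (w / 2)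
  have h2 := log_sigmoid_add_le v (w / 2)
  have h3 := sigmoid_add_sub_mul_ge (s := w / 2) hv
  rw [add_assoc, add_halves] at h1
  have e : (w / 2) ^ 2 / (8 * (1 + |w / 2|)) = w ^ 2 / (32 * (1 + |w| / 2)) := by
    rw [abs_div, abs_two]; field_simp; ring
  rw [e] at h3
  nlinarith

/-- The linear term is exactly `x`, so for a centred variable it vanishes in the mean and only `exp
(x²)` is left. -/
lemma exp_le_add_exp_sq (x : ℝ) : Real.exp x ≤ x + Real.exp (x ^ 2) := by
  rcases le_or_gt |x| 1 with h | h
  · have h1 := (abs_le.1 (Real.abs_exp_sub_one_sub_id_le h)).2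
    have h2 := Real.add_one_le_exp (x ^ 2)
    linarith
  · rcases le_or_gt 0 x with h0 | h0
    · rw [abs_of_nonneg h0] at h
      have : Real.exp x ≤ Real.exp (x ^ 2) := Real.exp_le_exp.2 (by nlinarith)
      linarith
    · rw [abs_of_neg h0] at h
      have h2 := Real.add_one_le_exp (x ^ 2)
      have : Real.exp x ≤ 1 := Real.exp_le_one_iff.2 h0.le
      nlinarith

/-- A centred Bernoulli variable is subgaussian. -/
lemma bernoulli_mgf_le {q : ℝ} (h0 : 0 ≤ q) (h1 : q ≤ 1) (s : ℝ) :
    q * Real.exp ((1 - q) * s - s ^ 2) + (1 - q) * Real.exp (-q * s - s ^ 2) ≤ 1 := by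
  have a1 := exp_le_add_exp_sq ((1 - q) * s)
  have a2 := exp_le_add_exp_sq (-q * s)
  have b1 : Real.exp (((1 - q) * s) ^ 2) ≤ Real.exp (s ^ 2) :=
    Real.exp_le_exp.2 (by rw [mul_pow]; nlinarith [sq_nonneg s, mul_nonneg h0 (sub_nonneg.2 h1)])
  have b2 : Real.exp ((-q * s) ^ 2) ≤ Real.exp (s ^ 2) :=
    Real.exp_le_exp.2 (by rw [mul_pow]; nlinarith [sq_nonneg s, mul_nonneg h0 (sub_nonneg.2 h1)])
  rw [Real.exp_sub, Real.exp_sub, ← mul_div_assoc, ← mul_div_assoc, ← add_div,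
    div_le_one (Real.exp_pos _)]
  have c1 : q * Real.exp ((1 - q) * s) ≤ q * ((1 - q) * s + Real.exp (s ^ 2)) := by
    gcongr; linarith
  have c2 : (1 - q) * Real.exp (-q * s) ≤ (1 - q) * (-q * s + Real.exp (s ^ 2)) :=
    mul_le_mul_of_nonneg_left (by linarith) (by linarith)
  nlinarith

/-- The chord of `exp` over `[-1, 0]`, with `exp (-1) ≤ 1/2`. -/
lemma exp_neg_le_one_sub_half {y : ℝ} (h0 : 0 ≤ y) (h1 : y ≤ 1) :
    Real.exp (-y) ≤ 1 - y / 2 := by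
  have := convexOn_exp.2 (Set.mem_univ (0 : ℝ)) (Set.mem_univ (-1)) (sub_nonneg.2 h1) h0 (by ring)
  simp only [smul_eq_mul, mul_zero, zero_add, mul_neg, mul_one, Real.exp_zero] at this
  have h2 : Real.exp (-1) ≤ 1 / 2 := by
    rw [Real.exp_neg, one_div]
    exact inv_anti₀ (by norm_num) (by linarith [Real.exp_one_gt_d9])
  nlinarith

/-- Lower-tail Chernoff estimate: exponential moment of a variable with values in `[0, 1]`. -/
lemma lintegral_exp_half_mean_sub_le {Ω : Type*} [MeasurableSpace Ω] (μ : Measure Ω)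
    [IsProbabilityMeasure μ] {Y : Ω → ℝ} (hY : Measurable Y) (h0 : ∀ ω, 0 ≤ Y ω)
    (h1 : ∀ ω, Y ω ≤ 1) :
    ∫⁻ ω, ENNReal.ofReal (Real.exp ((∫ ω', Y ω' ∂μ) / 2 - Y ω)) ∂μ ≤ 1 := by
  have hint : Integrable Y μ := by
    refine Integrable.of_bound hY.aestronglyMeasurable 1 (ae_of_all _ fun ω => ?_)
    rw [Real.norm_of_nonneg (h0 ω)]; exact h1 ω
  set e := ∫ ω', Y ω' ∂μ with he
  have hexp : Integrable (fun ω => Real.exp (e / 2) * (1 - Y ω / 2)) μ :=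
    ((integrable_const 1).sub (hint.div_const 2)).const_mul _
  calc ∫⁻ ω, ENNReal.ofReal (Real.exp (e / 2 - Y ω)) ∂μ
      ≤ ∫⁻ ω, ENNReal.ofReal (Real.exp (e / 2) * (1 - Y ω / 2)) ∂μ := by
        refine lintegral_mono fun ω => ENNReal.ofReal_le_ofReal ?_
        rw [sub_eq_add_neg, Real.exp_add]
        gcongr
        exact exp_neg_le_one_sub_half (h0 ω) (h1 ω)
    _ = ENNReal.ofReal (∫ ω, Real.exp (e / 2) * (1 - Y ω / 2) ∂μ) := by
        rw [ofReal_integral_eq_lintegral_ofReal hexp]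
        refine ae_of_all _ fun ω => ?_
        have := h1 ω
        exact mul_nonneg (Real.exp_pos _).le (by linarith)
    _ ≤ 1 := by
        rw [integral_const_mul, integral_sub (integrable_const 1) (hint.div_const 2),
          integral_div, ← he]
        simp only [integral_const, probReal_univ, smul_eq_mul, mul_one]
        rw [← ENNReal.ofReal_one]
        apply ENNReal.ofReal_le_ofReal
        have := Real.add_one_le_exp (-(e / 2))
        calc Real.exp (e / 2) * (1 - e / 2) ≤ Real.exp (e / 2) * Real.exp (-(e / 2)) := by
              gcongr; linarith
          _ = 1 := by rw [← Real.exp_add]; simp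

/-! ### Linear algebra -/

open scoped MatrixOrder in
lemma Matrix.PosDef.exists_eq_transpose_mul {n : Type*} [Fintype n] [DecidableEq n]
    {S : Matrix n n ℝ} (hS : S.PosDef) :
    ∃ Q : Matrix n n ℝ, IsUnit Q.det ∧ S = Q.transpose * Q := by
  obtain ⟨Q, hQ⟩ := CStarAlgebra.nonneg_iff_eq_star_mul_self.mp hS.posSemidef.nonneg
  rw [Matrix.star_eq_conjTranspose, Matrix.conjTranspose_eq_transpose_of_trivial] at hQ
  refine ⟨Q, ?_, hQ⟩
  have := hS.det_pos
  rw [hQ, Matrix.det_mul, Matrix.det_transpose] at this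
  exact isUnit_iff_ne_zero.2 fun h => by simp [h] at this

lemma one_add_sum_le_prod_one_add {ι : Type*} (s : Finset ι) {f : ι → ℝ} (hf : ∀ i, 0 ≤ f i) :
    1 + ∑ i ∈ s, f i ≤ ∏ i ∈ s, (1 + f i) := by
  classical
  induction s using Finset.induction_on with
  | empty => simp
  | insert a s ha ih =>
    rw [Finset.sum_insert ha, Finset.prod_insert ha]
    have h1 := hf a
    have h2 : 0 ≤ ∑ i ∈ s, f i := Finset.sum_nonneg fun i _ => hf i
    nlinarith [mul_nonneg h1 h2]

/-! ### Determinant and trace inequalities -/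

section dets

variable {n : Type*} [Fintype n] [DecidableEq n]

/-- In terms of the eigenvalues this is `1 + ∑ λᵢ ≤ ∏ (1 + λᵢ)` for `λᵢ ≥ 0`. -/
lemma Matrix.PosSemidef.one_add_trace_le_det {P : Matrix n n ℝ} (hP : P.PosSemidef) :
    1 + P.trace ≤ (1 + P).det := by
  have hH := hP.isHermitian
  set U : Matrix n n ℝ := (hH.eigenvectorUnitary : Matrix n n ℝ) with hU
  have hspec := hH.spectral_theorem
  rw [Unitary.conjStarAlgAut_apply] at hspec
  have hUU : U * star U = 1 := Unitary.coe_mul_star_self _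
  have e : (1 + P).det = ∏ i, (1 + hH.eigenvalues i) := by
    have : 1 + P = U * (Matrix.diagonal fun i => 1 + hH.eigenvalues i) * star U := by
      have hd : (Matrix.diagonal fun i => 1 + hH.eigenvalues i)
          = 1 + Matrix.diagonal (RCLike.ofReal ∘ hH.eigenvalues) := by
        rw [← Matrix.diagonal_one, Matrix.diagonal_add]; rfl
      rw [hd, mul_add, add_mul, mul_one, hUU]
      congr 1
    rw [this, Matrix.det_mul, Matrix.det_mul, Matrix.det_diagonal, mul_right_comm, ← Matrix.det_mul,
      hUU, Matrix.det_one, one_mul]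
  rw [e, hH.trace_eq_sum_eigenvalues]
  exact one_add_sum_le_prod_one_add _ hP.eigenvalues_nonneg

/-- Writing `S = Qᵀ Q` and conjugating `P` by `Q⁻¹` reduces to `S = 1`. It takes the place of the
rank-one determinant formula, because a batch adds `m` rank-one terms at once. -/
lemma Matrix.PosDef.det_mul_one_add_trace_le {S P : Matrix n n ℝ} (hS : S.PosDef)
    (hP : P.PosSemidef) : S.det * (1 + (S⁻¹ * P).trace) ≤ (S + P).det := by
  obtain ⟨Q, hQ, rfl⟩ := hS.exists_eq_transpose_mul
  have hQt : IsUnit Q.transpose.det := by rwa [Matrix.det_transpose]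
  set N := (Q⁻¹).transpose * P * Q⁻¹ with hN
  have hNpos : N.PosSemidef := by
    have := hP.conjTranspose_mul_mul_same Q⁻¹
    rwa [Matrix.conjTranspose_eq_transpose_of_trivial] at this
  have e1 : Q.transpose * Q + P = Q.transpose * (1 + N) * Q := by
    rw [mul_add, add_mul, mul_one, hN, Matrix.transpose_nonsing_inv, mul_assoc _ P,
      Matrix.mul_nonsing_inv_cancel_left _ _ hQt, mul_assoc P, Matrix.nonsing_inv_mul _ hQ, mul_one]
  have e2 : ((Q.transpose * Q)⁻¹ * P).trace = N.trace := by
    rw [Matrix.mul_inv_rev, hN, Matrix.transpose_nonsing_inv, mul_assoc, Matrix.trace_mul_comm]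
  rw [e1, e2, Matrix.det_mul, Matrix.det_mul, Matrix.det_mul, Matrix.det_transpose,
    mul_right_comm Q.det (1 + N).det]
  exact mul_le_mul_of_nonneg_left hNpos.one_add_trace_le_det (mul_self_nonneg _)

/-- The inequality of arithmetic and geometric means for the eigenvalues. -/
lemma Matrix.PosSemidef.det_le_trace_div_card_pow [Nonempty n] {P : Matrix n n ℝ}
    (hP : P.PosSemidef) : P.det ≤ (P.trace / Fintype.card n) ^ Fintype.card n := by
  have hH := hP.isHermitian
  have h := Real.geom_mean_le_arith_mean_weighted Finset.univ
    (fun _ : n => (1 : ℝ) / Fintype.card n) hH.eigenvalues (fun _ _ => by positivity)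
    (by simp) (fun i _ => hP.eigenvalues_nonneg i)
  have hc : (Fintype.card n : ℝ) ≠ 0 := by simp
  rw [Real.finsetProd_rpow _ _ fun i _ => hP.eigenvalues_nonneg i, ← Finset.mul_sum] at h
  have hdet : P.det = ∏ i, hH.eigenvalues i := hH.det_eq_prod_eigenvalues
  have htr : P.trace = ∑ i, hH.eigenvalues i := hH.trace_eq_sum_eigenvalues
  rw [← hdet, ← htr] at h
  have hd : 0 ≤ P.det := hP.det_nonneg
  calc P.det = (P.det ^ ((1 : ℝ) / Fintype.card n)) ^ Fintype.card n := by
        rw [← Real.rpow_natCast, ← Real.rpow_mul hd, one_div, inv_mul_cancel₀ hc, Real.rpow_one]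
    _ ≤ (1 / Fintype.card n * P.trace) ^ Fintype.card n := by gcongr
    _ = _ := by rw [one_div_mul_eq_div]

end dets

/-! ### Norms of positive definite matrices, nets and the elliptical potential -/

section inducedNorm

variable {d : ℕ}

lemma inducedNorm_nonneg (S : Matrix (Fin d) (Fin d) ℝ) (z : EuclideanSpace ℝ (Fin d)) :
    0 ≤ inducedNorm S z := Real.sqrt_nonneg _

lemma sq_inducedNorm {S : Matrix (Fin d) (Fin d) ℝ} (hS : S.PosSemidef)
    (z : EuclideanSpace ℝ (Fin d)) :
    inducedNorm S z ^ 2 = z.ofLp ⬝ᵥ S.mulVec z.ofLp :=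
  Real.sq_sqrt (hS.dotProduct_mulVec_nonneg z.ofLp)

lemma dotProduct_ofLp (u v : EuclideanSpace ℝ (Fin d)) : u.ofLp ⬝ᵥ v.ofLp = inner ℝ u v := by
  rw [EuclideanSpace.inner_eq_star_dotProduct, dotProduct_comm]
  rfl

/-- The seminorm of a positive definite matrix is the Euclidean norm after a linear map. -/
lemma Matrix.PosDef.exists_inducedNorm_eq {S : Matrix (Fin d) (Fin d) ℝ} (hS : S.PosDef) :
    ∃ Q : Matrix (Fin d) (Fin d) ℝ, IsUnit Q.det ∧ S = Q.transpose * Q ∧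
      ∀ z, inducedNorm S z = ‖Matrix.toEuclideanCLM (𝕜 := ℝ) Q z‖ := by
  obtain ⟨Q, hQ, h⟩ := hS.exists_eq_transpose_mul
  refine ⟨Q, hQ, h, fun z => ?_⟩
  rw [inducedNorm, ← Real.sqrt_sq (norm_nonneg (Matrix.toEuclideanCLM (𝕜 := ℝ) Q z)),
    ← real_inner_self_eq_norm_sq, ← dotProduct_ofLp, Matrix.ofLp_toEuclideanCLM, h,
    ← Matrix.mulVec_mulVec, Matrix.dotProduct_mulVec, Matrix.vecMul_transpose]

/-- With `v = S w` the dual norm of `v` is the `S`-norm of `w`, and the claim is Cauchy–Schwarz for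
the form `S`. -/
lemma inner_le_inducedNorm_mul {S : Matrix (Fin d) (Fin d) ℝ} (hS : S.PosDef)
    (u v : EuclideanSpace ℝ (Fin d)) :
    inner ℝ u v ≤ inducedNorm S u * inducedNorm S⁻¹ v := by
  obtain ⟨Q, -, hSQ, hQ⟩ := hS.exists_inducedNorm_eq
  have hdet : IsUnit S.det := isUnit_iff_ne_zero.2 hS.det_pos.ne'
  set w : EuclideanSpace ℝ (Fin d) := WithLp.toLp 2 (S⁻¹.mulVec v.ofLp) with hw
  have hSw : S.mulVec w.ofLp = v.ofLp := by
    rw [hw, Matrix.mulVec_mulVec, Matrix.mul_nonsing_inv _ hdet, Matrix.one_mulVec]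
  have h1 : inducedNorm S⁻¹ v = inducedNorm S w := by
    rw [inducedNorm, inducedNorm, hSw, dotProduct_comm]
  have h2 : inner ℝ u v = inner ℝ (Matrix.toEuclideanCLM (𝕜 := ℝ) Q u)
      (Matrix.toEuclideanCLM (𝕜 := ℝ) Q w) := by
    rw [← dotProduct_ofLp, ← dotProduct_ofLp, ← hSw, hSQ, Matrix.ofLp_toEuclideanCLM,
      Matrix.ofLp_toEuclideanCLM, ← Matrix.mulVec_mulVec, Matrix.dotProduct_mulVec,
      Matrix.vecMul_transpose]
  rw [h1, hQ, hQ, h2]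
  exact real_inner_le_norm _ _

lemma inducedNorm_sub_le {S : Matrix (Fin d) (Fin d) ℝ} (hS : S.PosDef)
    (u v : EuclideanSpace ℝ (Fin d)) :
    inducedNorm S u ≤ inducedNorm S v + inducedNorm S (u - v) := by
  obtain ⟨Q, -, -, hQ⟩ := hS.exists_inducedNorm_eq
  rw [hQ, hQ, hQ, map_sub]
  exact norm_le_norm_add_norm_sub' _ _

lemma inducedNorm_smul {S : Matrix (Fin d) (Fin d) ℝ} (c : ℝ) (u : EuclideanSpace ℝ (Fin d)) :
    inducedNorm S (c • u) = |c| * inducedNorm S u := by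
  rw [inducedNorm, inducedNorm, WithLp.ofLp_smul, Matrix.mulVec_smul, smul_dotProduct,
    dotProduct_smul, smul_eq_mul, smul_eq_mul, ← mul_assoc, Real.sqrt_mul (mul_self_nonneg c),
    Real.sqrt_mul_self_eq_abs]

lemma inducedNorm_integral_le {Ω : Type*} [MeasurableSpace Ω] (μ : Measure Ω)
    {S : Matrix (Fin d) (Fin d) ℝ} (hS : S.PosDef) {f : Ω → EuclideanSpace ℝ (Fin d)}
    (hf : Integrable f μ) :
    inducedNorm S (∫ ω, f ω ∂μ) ≤ ∫ ω, inducedNorm S (f ω) ∂μ := by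
  obtain ⟨Q, -, -, hQ⟩ := hS.exists_inducedNorm_eq
  simp_rw [hQ]
  rw [← ContinuousLinearMap.integral_comp_comm _ hf]
  exact norm_integral_le_integral_norm _

/-- A grid is a net of the unit ball of the norm of a positive definite matrix. -/
lemma Matrix.PosDef.exists_net {S : Matrix (Fin d) (Fin d) ℝ} (hS : S.PosDef) {r s : ℝ}
    (hs : 0 < s) {k : ℕ} (hk : r ≤ k * s) :
    ∃ N : Finset (EuclideanSpace ℝ (Fin d)), N.card ≤ (2 * k + 1) ^ d ∧
      ∀ u, inducedNorm S u ≤ r → ∃ u' ∈ N, inducedNorm S (u - u') ≤ √d * s := by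
  classical
  obtain ⟨Q, hQdet, -, hQ⟩ := hS.exists_inducedNorm_eq
  -- In the coordinates `Q u` the norm is Euclidean, so the net is the preimage of a cubic grid of
  -- step `s`. Rounding each coordinate down errs by at most `s`, hence by `√d * s` in norm.
  let g : (Fin d → ℤ) → EuclideanSpace ℝ (Fin d) := fun c =>
    WithLp.toLp 2 (Q⁻¹.mulVec fun i => s * c i)
  refine ⟨(Fintype.piFinset fun _ => Finset.Icc (-(k : ℤ)) k).image g, ?_, fun u hu => ?_⟩
  · refine Finset.card_image_le.trans ?_
    rw [Fintype.card_piFinset_const, Int.card_Icc]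
    apply Nat.pow_le_pow_left
    omega
  · set w := Matrix.toEuclideanCLM (𝕜 := ℝ) Q u with hw
    rw [hQ, ← hw] at hu
    have hwi : ∀ i, |w i| ≤ k * s := fun i => by
      rw [← Real.norm_eq_abs]
      exact (PiLp.norm_apply_le w i).trans (hu.trans hk)
    let c : Fin d → ℤ := fun i => ⌊w i / s⌋
    refine ⟨g c, Finset.mem_image_of_mem _ (Fintype.mem_piFinset.2 fun i => ?_), ?_⟩
    · have := abs_le.1 (hwi i)
      rw [Finset.mem_Icc]
      constructor
      · apply Int.le_floor.2
        rw [le_div_iff₀ hs]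
        push_cast
        linarith
      · have h1 : w i / s ≤ k := by rw [div_le_iff₀ hs]; linarith
        have h2 : ((⌊w i / s⌋ : ℤ) : ℝ) ≤ ((k : ℤ) : ℝ) := (Int.floor_le (w i / s)).trans h1
        exact Int.cast_le.1 h2
    · have hg : Matrix.toEuclideanCLM (𝕜 := ℝ) Q (g c) = WithLp.toLp 2 fun i => s * (c i : ℝ) := by
        apply WithLp.ofLp_injective
        rw [Matrix.ofLp_toEuclideanCLM]
        simp only [g, Matrix.mulVec_mulVec, Matrix.mul_nonsing_inv _ hQdet, Matrix.one_mulVec]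
      rw [hQ, map_sub, hg, ← hw, EuclideanSpace.norm_eq,
        show √(d : ℝ) * s = √(d * s ^ 2) by
          rw [Real.sqrt_mul (Nat.cast_nonneg d), Real.sqrt_sq hs.le]]
      apply Real.sqrt_le_sqrt
      calc _ ≤ ∑ _i : Fin d, s ^ 2 := by
            refine Finset.sum_le_sum fun i _ => ?_
            rw [Real.norm_eq_abs, sq_abs]
            have h1 := Int.floor_le (w i / s)
            have h2 := Int.lt_floor_add_one (w i / s)
            rw [le_div_iff₀ hs] at h1
            rw [div_lt_iff₀ hs] at h2
            have e : (w - WithLp.toLp 2 fun i => s * (c i : ℝ)) i = w i - s * (⌊w i / s⌋ : ℝ) := rfl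
            rw [e]
            apply sq_le_sq'
            · linarith
            · linarith
        _ = d * s ^ 2 := by simp

/-- `lam I + c ∑ zᵢ zᵢᵀ`. -/
def gramMatrix {ι : Type*} [Fintype ι] (lam c : ℝ) (z : ι → EuclideanSpace ℝ (Fin d)) :
    Matrix (Fin d) (Fin d) ℝ :=
  lam • (1 : Matrix (Fin d) (Fin d) ℝ) + c • ∑ i, Matrix.vecMulVec (z i).ofLp (z i).ofLp

section gram

variable {ι : Type*} [Fintype ι] {lam c : ℝ}

lemma dotProduct_gramMatrix_mulVec (z : ι → EuclideanSpace ℝ (Fin d))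
    (u : EuclideanSpace ℝ (Fin d)) :
    u.ofLp ⬝ᵥ (gramMatrix lam c z).mulVec u.ofLp =
      lam * ‖u‖ ^ 2 + c * ∑ i, inner ℝ (z i) u ^ 2 := by
  rw [gramMatrix, Matrix.add_mulVec, Matrix.smul_mulVec, Matrix.smul_mulVec, Matrix.one_mulVec,
    Matrix.sum_mulVec, dotProduct_add, dotProduct_smul, dotProduct_smul, dotProduct_sum,
    dotProduct_ofLp, real_inner_self_eq_norm_sq, smul_eq_mul, smul_eq_mul]
  congr 2
  refine Finset.sum_congr rfl fun i _ => ?_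
  rw [Matrix.vecMulVec_mulVec, op_smul_eq_smul, dotProduct_smul, dotProduct_ofLp, dotProduct_ofLp,
    smul_eq_mul]
  rw [real_inner_comm u]
  ring

lemma posSemidef_sum_vecMulVec (z : ι → EuclideanSpace ℝ (Fin d)) :
    (∑ i, Matrix.vecMulVec (z i).ofLp (z i).ofLp).PosSemidef :=
  Matrix.posSemidef_sum _ fun i _ => by
    simpa using Matrix.posSemidef_vecMulVec_self_star (z i).ofLp

lemma gramMatrix_posDef (hlam : 0 < lam) (hc : 0 ≤ c) (z : ι → EuclideanSpace ℝ (Fin d)) :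
    (gramMatrix lam c z).PosDef :=
  (Matrix.PosDef.one.smul hlam).add_posSemidef ((posSemidef_sum_vecMulVec z).smul hc)

lemma sq_inducedNorm_gramMatrix (hlam : 0 < lam) (hc : 0 ≤ c) (z : ι → EuclideanSpace ℝ (Fin d))
    (u : EuclideanSpace ℝ (Fin d)) :
    inducedNorm (gramMatrix lam c z) u ^ 2 = lam * ‖u‖ ^ 2 + c * ∑ i, inner ℝ (z i) u ^ 2 := by
  rw [sq_inducedNorm (gramMatrix_posDef hlam hc z).posSemidef, dotProduct_gramMatrix_mulVec]

/-- For `w = S⁻¹ v` the square of the left side is `⟪v, w⟫ ≤ ‖v‖ ‖w‖`, while `√lam ‖w‖` is at most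
the left side since `S ≥ lam I`. This a priori range of the uncertainties is what the Chernoff
bounds require. -/
lemma inducedNorm_gramMatrix_inv_le (hlam : 0 < lam) (hc : 0 ≤ c)
    (z : ι → EuclideanSpace ℝ (Fin d)) (v : EuclideanSpace ℝ (Fin d)) :
    inducedNorm (gramMatrix lam c z)⁻¹ v ≤ ‖v‖ / √lam := by
  set S := gramMatrix lam c z with hS
  have hpos : S.PosDef := gramMatrix_posDef hlam hc z
  have hdet : IsUnit S.det := isUnit_iff_ne_zero.2 hpos.det_pos.ne'
  set w : EuclideanSpace ℝ (Fin d) := WithLp.toLp 2 (S⁻¹.mulVec v.ofLp) with hw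
  have hSw : S.mulVec w.ofLp = v.ofLp := by
    rw [hw, Matrix.mulVec_mulVec, Matrix.mul_nonsing_inv _ hdet, Matrix.one_mulVec]
  have h1 : inducedNorm S⁻¹ v ^ 2 = inner ℝ v w := by
    rw [sq_inducedNorm hpos.inv.posSemidef, ← dotProduct_ofLp]
  have h2 : inducedNorm S⁻¹ v ^ 2 = inducedNorm S w ^ 2 := by
    rw [sq_inducedNorm hpos.inv.posSemidef, sq_inducedNorm hpos.posSemidef, hSw, dotProduct_comm]
  have h3 : lam * ‖w‖ ^ 2 ≤ inducedNorm S⁻¹ v ^ 2 := by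
    rw [h2, sq_inducedNorm_gramMatrix hlam hc]
    have : 0 ≤ c * ∑ i, inner ℝ (z i) w ^ 2 :=
      mul_nonneg hc (Finset.sum_nonneg fun i _ => sq_nonneg _)
    linarith
  set a := inducedNorm S⁻¹ v with ha
  have ha0 : 0 ≤ a := inducedNorm_nonneg _ _
  have h4 : a ^ 2 ≤ ‖v‖ * ‖w‖ := h1 ▸ real_inner_le_norm v w
  have h5 : √lam * ‖w‖ ≤ a := by
    refine (sq_le_sq₀ (by positivity) ha0).1 ?_
    rw [mul_pow, Real.sq_sqrt hlam.le]
    exact h3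
  have hsl : 0 < √lam := Real.sqrt_pos.2 hlam
  rw [le_div_iff₀ hsl]
  rcases ha0.eq_or_lt with h0 | h0
  · rw [← h0, zero_mul]; exact norm_nonneg v
  · have : a * (a * √lam) ≤ a * ‖v‖ := by
      calc a * (a * √lam) = a ^ 2 * √lam := by ring
        _ ≤ ‖v‖ * ‖w‖ * √lam := by gcongr
        _ = ‖v‖ * (√lam * ‖w‖) := by ring
        _ ≤ ‖v‖ * a := by gcongr
        _ = a * ‖v‖ := mul_comm _ _
    exact le_of_mul_le_mul_left this h0

lemma trace_gramMatrix (z : ι → EuclideanSpace ℝ (Fin d)) :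
    (gramMatrix lam c z).trace = lam * d + c * ∑ i, ‖z i‖ ^ 2 := by
  rw [gramMatrix, Matrix.trace_add, Matrix.trace_smul, Matrix.trace_smul, Matrix.trace_one,
    Matrix.trace_sum, Fintype.card_fin, smul_eq_mul, smul_eq_mul]
  congr 2
  refine Finset.sum_congr rfl fun i _ => ?_
  rw [Matrix.trace_vecMulVec, dotProduct_ofLp, real_inner_self_eq_norm_sq]

lemma trace_inv_mul_sum_vecMulVec {S : Matrix (Fin d) (Fin d) ℝ} (hS : S.PosDef)
    (z : ι → EuclideanSpace ℝ (Fin d)) :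
    (S⁻¹ * ∑ i, Matrix.vecMulVec (z i).ofLp (z i).ofLp).trace = ∑ i, inducedNorm S⁻¹ (z i) ^ 2 := by
  rw [Finset.mul_sum, Matrix.trace_sum]
  refine Finset.sum_congr rfl fun i _ => ?_
  rw [Matrix.mul_vecMulVec, Matrix.trace_vecMulVec, sq_inducedNorm hS.inv.posSemidef,
    dotProduct_comm]

/-- Self-normalized bound: an exponential-moment bound on a net of the ball of the base norm
controls `S` in the dual of the full norm. -/
lemma inner_le_of_net {ι' : Type*} [Fintype ι'] (z₀ : ι → EuclideanSpace ℝ (Fin d))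
    (z₁ : ι' → EuclideanSpace ℝ (Fin d)) (S : EuclideanSpace ℝ (Fin d))
    (N : Finset (EuclideanSpace ℝ (Fin d))) {r h ℓ : ℝ} (hr : 1 ≤ r) (hℓ : 0 ≤ ℓ)
    (hz₁ : ∀ i, ‖z₁ i‖ ≤ 2) (hh' : (2 + 4 * Fintype.card ι') * h ^ 2 ≤ 1 / 4)
    (hN : ∀ u, inducedNorm (gramMatrix 1 1 z₀) u ≤ r →
      ∃ u' ∈ N, inducedNorm (gramMatrix 1 1 z₀) (u - u') ≤ h)
    (hS : ∀ u' ∈ N, inner ℝ u' S - (∑ i, inner ℝ (z₀ i) u' ^ 2 + ∑ i, inner ℝ (z₁ i) u' ^ 2) ≤ ℓ)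
    (D : EuclideanSpace ℝ (Fin d)) :
    inner ℝ S D ≤ 2 * ((r + 1 / 2) ^ 2 + ℓ) / r *
      √(‖D‖ ^ 2 + 2 * ∑ i, inner ℝ (z₀ i) D ^ 2 + ∑ i, inner ℝ (z₁ i) D ^ 2) := by
  set G := gramMatrix 1 1 (Sum.elim (Sum.elim z₀ z₀) z₁) with hG
  have hGpos : G.PosDef := gramMatrix_posDef one_pos zero_le_one _
  have hGsq : ∀ u, inducedNorm G u ^ 2 =
      ‖u‖ ^ 2 + 2 * ∑ i, inner ℝ (z₀ i) u ^ 2 + ∑ i, inner ℝ (z₁ i) u ^ 2 := fun u => by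
    rw [hG, sq_inducedNorm_gramMatrix one_pos zero_le_one, Fintype.sum_sum_type,
      Fintype.sum_sum_type]
    simp only [Sum.elim_inl, Sum.elim_inr]
    ring
  have hAsq : ∀ u, inducedNorm (gramMatrix 1 1 z₀) u ^ 2 =
      ‖u‖ ^ 2 + ∑ i, inner ℝ (z₀ i) u ^ 2 := fun u => by
    rw [sq_inducedNorm_gramMatrix one_pos zero_le_one]; ring
  have hn0 : ∀ u, 0 ≤ ∑ i, inner ℝ (z₀ i) u ^ 2 := fun u => Finset.sum_nonneg fun i _ => sq_nonneg _
  have hn1 : ∀ u, 0 ≤ ∑ i, inner ℝ (z₁ i) u ^ 2 := fun u => Finset.sum_nonneg fun i _ => sq_nonneg _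
  have hdet : IsUnit G.det := isUnit_iff_ne_zero.2 hGpos.det_pos.ne'
  set w : EuclideanSpace ℝ (Fin d) := WithLp.toLp 2 (G⁻¹.mulVec S.ofLp) with hw
  have hGw : G.mulVec w.ofLp = S.ofLp := by
    rw [hw, Matrix.mulVec_mulVec, Matrix.mul_nonsing_inv _ hdet, Matrix.one_mulVec]
  set q := inducedNorm G⁻¹ S with hq
  have hq0 : 0 ≤ q := inducedNorm_nonneg _ _
  have hqw : q ^ 2 = inner ℝ w S := by
    rw [sq_inducedNorm hGpos.inv.posSemidef, ← dotProduct_ofLp, dotProduct_comm]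
  have hqG : inducedNorm G w = q := by
    rw [hq, inducedNorm, inducedNorm, hGw, dotProduct_comm]
  have hqbound : q ≤ 2 * ((r + 1 / 2) ^ 2 + ℓ) / r := by
    rcases hq0.eq_or_lt with h0 | h0
    · rw [← h0]; positivity
    -- The maximizer of `⟪·, S⟫` on the `G`-ball of radius `r`; the maximum is `r * q`.
    set u := (r / q) • w with hu
    have huG : inducedNorm G u = r := by
      rw [hu, inducedNorm_smul, hqG, abs_of_nonneg (by positivity), div_mul_cancel₀ _ h0.ne']
    have huS : inner ℝ u S = r * q := by
      rw [hu, real_inner_smul_left, ← hqw]; field_simp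
    have huA : inducedNorm (gramMatrix 1 1 z₀) u ≤ r := by
      refine (sq_le_sq₀ (inducedNorm_nonneg _ _) (by linarith)).1 ?_
      rw [← huG, hAsq, hGsq]
      linarith [hn0 u, hn1 u]
    obtain ⟨u', hu'N, hu'⟩ := hN u huA
    -- The net is fine only in the base norm. The vectors `z₁ i`, of norm at most `2`, raise the
    -- error by a factor governed by their number, which `hh'` absorbs.
    have hdG : inducedNorm G (u - u') ≤ 1 / 2 := by
      refine (sq_le_sq₀ (inducedNorm_nonneg _ _) (by norm_num)).1 ?_
      rw [hGsq]
      have h1 : ∑ i, inner ℝ (z₁ i) (u - u') ^ 2 ≤ 4 * Fintype.card ι' * ‖u - u'‖ ^ 2 := by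
        calc _ ≤ ∑ _i : ι', 4 * ‖u - u'‖ ^ 2 := by
              refine Finset.sum_le_sum fun i _ => ?_
              rw [← sq_abs]
              calc |inner ℝ (z₁ i) (u - u')| ^ 2 ≤ (‖z₁ i‖ * ‖u - u'‖) ^ 2 := by
                    gcongr; exact abs_real_inner_le_norm _ _
                _ ≤ (2 * ‖u - u'‖) ^ 2 := by gcongr; exact hz₁ i
                _ = _ := by ring
          _ = _ := by rw [Finset.sum_const, Finset.card_univ, nsmul_eq_mul]; ring
      have h2 : ‖u - u'‖ ^ 2 + ∑ i, inner ℝ (z₀ i) (u - u') ^ 2 ≤ h ^ 2 := by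
        rw [← hAsq]
        have := inducedNorm_nonneg (gramMatrix 1 1 z₀) (u - u')
        gcongr
      have h3 : ‖u - u'‖ ^ 2 ≤ h ^ 2 := by linarith [hn0 (u - u')]
      have h4 : 4 * (Fintype.card ι' : ℝ) * ‖u - u'‖ ^ 2 ≤ 4 * Fintype.card ι' * h ^ 2 := by gcongr
      nlinarith [sq_nonneg ‖u - u'‖]
    have k1 := hS u' hu'N
    -- Rounding to the net loses at most `q / 2 ≤ r * q / 2`, so half of the maximum survives; hence
    -- the factor `2` in the bound.
    have k2 : inner ℝ (u - u') S ≤ 1 / 2 * q :=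
      (inner_le_inducedNorm_mul hGpos _ _).trans (by gcongr)
    have k3 : inducedNorm G u' ≤ r + 1 / 2 := by
      have := inducedNorm_sub_le hGpos u' u
      have e : inducedNorm G (u' - u) = inducedNorm G (u - u') := by
        rw [← neg_sub, ← neg_one_smul ℝ, inducedNorm_smul]; simp
      linarith
    have k4 : inducedNorm G u' ^ 2 ≤ (r + 1 / 2) ^ 2 := by
      have := inducedNorm_nonneg G u'
      gcongr
    rw [hGsq] at k4
    rw [inner_sub_left, huS] at k2
    rw [le_div_iff₀ (by linarith)]
    nlinarith [hn0 u', sq_nonneg ‖u'‖]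
  calc inner ℝ S D = inner ℝ D S := real_inner_comm _ _
    _ ≤ inducedNorm G D * q := inner_le_inducedNorm_mul hGpos _ _
    _ = q * inducedNorm G D := mul_comm _ _
    _ ≤ 2 * ((r + 1 / 2) ^ 2 + ℓ) / r * inducedNorm G D := by
        have := inducedNorm_nonneg G D
        gcongr
    _ = _ := by rw [← hGsq, Real.sqrt_sq (inducedNorm_nonneg _ _)]

end gram

/-- Elliptical potential lemma for batches. -/
lemma sum_log_one_add_le (hd : 1 ≤ d) {m : ℕ} (hm : 1 ≤ m) {lam : ℝ} (hlam : 0 < lam)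
    (z : ℕ → Fin m → EuclideanSpace ℝ (Fin d)) (hz : ∀ i j, ‖z i j‖ ≤ 2)
    (S : ℕ → Matrix (Fin d) (Fin d) ℝ)
    (hS : ∀ t, S t = gramMatrix lam (1 / (m : ℝ)) fun p : Fin t × Fin m => z p.1 p.2) (T : ℕ) :
    ∑ t ∈ Finset.range T, Real.log (1 + 1 / (m : ℝ) * ∑ j, inducedNorm (S t)⁻¹ (z t j) ^ 2) ≤
      d * Real.log (1 + 4 * T / (d * lam)) := by
  have hm0 : (0 : ℝ) < m := by exact_mod_cast hm
  have hd0 : (0 : ℝ) < d := by exact_mod_cast hd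
  have hpos : ∀ t, (S t).PosDef := fun t => by
    rw [hS]; exact gramMatrix_posDef hlam (by positivity) _
  have hsucc : ∀ t, S (t + 1) =
      S t + (1 / (m : ℝ)) • ∑ j, Matrix.vecMulVec (z t j).ofLp (z t j).ofLp := fun t => by
    rw [hS, hS, gramMatrix, gramMatrix, Fintype.sum_prod_type, Fintype.sum_prod_type,
      Fin.sum_univ_castSucc, smul_add, ← add_assoc]
    rfl
  -- Each summand is at most an increment of `log det (S t)`, so the sum telescopes. The last
  -- determinant is bounded through the trace, which grows by at most `4` per batch.
  have hstep : ∀ t, Real.log (1 + 1 / (m : ℝ) * ∑ j, inducedNorm (S t)⁻¹ (z t j) ^ 2) ≤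
      Real.log (S (t + 1)).det - Real.log (S t).det := fun t => by
    have h1 := (hpos t).det_mul_one_add_trace_le
      ((posSemidef_sum_vecMulVec (z t)).smul (show (0 : ℝ) ≤ 1 / m by positivity))
    rw [← hsucc, Matrix.mul_smul, Matrix.trace_smul, trace_inv_mul_sum_vecMulVec (hpos t),
      smul_eq_mul] at h1
    have hp : 0 < 1 + 1 / (m : ℝ) * ∑ j, inducedNorm (S t)⁻¹ (z t j) ^ 2 := by positivity
    rw [le_sub_iff_add_le, ← Real.log_mul hp.ne' (hpos t).det_pos.ne', mul_comm]
    exact Real.log_le_log (mul_pos (hpos t).det_pos hp) h1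
  have h0 : (S 0).det = lam ^ d := by
    rw [hS, gramMatrix]
    simp
  have : Nonempty (Fin d) := ⟨⟨0, hd⟩⟩
  have hT : (S T).det ≤ (lam * (1 + 4 * T / (d * lam))) ^ d := by
    refine (hpos T).posSemidef.det_le_trace_div_card_pow.trans ?_
    rw [Fintype.card_fin]
    have htr : (S T).trace ≤ lam * d + 4 * T := by
      rw [hS, trace_gramMatrix]
      have : ∑ p : Fin T × Fin m, ‖z p.1 p.2‖ ^ 2 ≤ ∑ _p : Fin T × Fin m, (4 : ℝ) := by
        refine Finset.sum_le_sum fun p _ => ?_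
        have := hz p.1 p.2
        nlinarith [norm_nonneg (z p.1 p.2)]
      rw [Finset.sum_const, Finset.card_univ, Fintype.card_prod, Fintype.card_fin,
        Fintype.card_fin, nsmul_eq_mul] at this
      have h2 : 1 / (m : ℝ) * ∑ p : Fin T × Fin m, ‖z p.1 p.2‖ ^ 2 ≤
          1 / (m : ℝ) * ((T * m : ℕ) * 4) := by gcongr
      push_cast at h2
      have e : 1 / (m : ℝ) * (T * m * 4) = 4 * T := by field_simp
      linarith
    have htr0 : 0 ≤ (S T).trace := (hpos T).posSemidef.trace_nonneg
    have e : lam * (1 + 4 * T / (d * lam)) = (lam * d + 4 * T) / d := by field_simp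
    rw [e]
    gcongr
  calc _ ≤ ∑ t ∈ Finset.range T, (Real.log (S (t + 1)).det - Real.log (S t).det) :=
        Finset.sum_le_sum fun t _ => hstep t
    _ = Real.log (S T).det - Real.log (S 0).det :=
        Finset.sum_range_sub (fun t => Real.log (S t).det) T
    _ ≤ Real.log ((lam * (1 + 4 * T / (d * lam))) ^ d) - Real.log (lam ^ d) := by
        rw [h0]
        gcongr
        exact (hpos T).det_pos
    _ = _ := by
        rw [Real.log_pow, Real.log_pow, Real.log_mul hlam.ne' (by positivity)]
        ring

end inducedNorm

/-! ### Measurability of the laws of the model -/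

/-- Boxes form a generating π-system, and the mass of a box is a finite product of measurable
functions of the parameter. -/
lemma measurable_measure_pi {α ι : Type*} [MeasurableSpace α] [Fintype ι] {β : ι → Type*}
    [∀ i, MeasurableSpace (β i)] {κ : α → ∀ i, Measure (β i)}
    [∀ a i, IsProbabilityMeasure (κ a i)] (hκ : ∀ i, Measurable fun a => κ a i) :
    Measurable fun a => Measure.pi (κ a) := by
  refine Measurable.measure_of_isPiSystem_of_isProbabilityMeasure generateFrom_pi.symm
    isPiSystem_pi ?_
  rintro s ⟨t, ht, rfl⟩
  simp only [Measure.pi_pi]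
  exact Finset.measurable_prod _ fun i _ =>
    (Measure.measurable_coe (ht i (Set.mem_univ i))).comp (hκ i)

lemma lintegral_pi_prod {ι : Type*} [Fintype ι] {β : ι → Type*}
    [∀ i, MeasurableSpace (β i)] (μ : ∀ i, Measure (β i)) [∀ i, IsProbabilityMeasure (μ i)]
    {f : ∀ i, β i → ENNReal} (hf : ∀ i, Measurable (f i)) :
    ∫⁻ b, ∏ i, f i (b i) ∂Measure.pi μ = ∏ i, ∫⁻ s, f i s ∂μ i := by
  have hind : iIndepFun (fun i (b : ∀ i, β i) => f i (b i)) (Measure.pi μ) :=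
    iIndepFun_pi fun i => (hf i).aemeasurable
  rw [lintegral_prod_eq_prod_lintegral_of_indepFun Finset.univ _ hind
    fun i => (hf i).comp (measurable_pi_apply i)]
  exact Finset.prod_congr rfl fun i _ => (measurePreserving_eval μ i).lintegral_comp (hf i)

lemma lintegral_pi_prod_le_one {ι : Type*} [Fintype ι] {β : ι → Type*}
    [∀ i, MeasurableSpace (β i)] (μ : ∀ i, Measure (β i)) [∀ i, IsProbabilityMeasure (μ i)]
    {f : ∀ i, β i → ENNReal} (hf : ∀ i, Measurable (f i)) (h1 : ∀ i, ∫⁻ s, f i s ∂μ i ≤ 1) :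
    ∫⁻ b, ∏ i, f i (b i) ∂Measure.pi μ ≤ 1 := by
  rw [lintegral_pi_prod μ hf]
  exact Finset.prod_le_one' fun i _ => h1 i

namespace KLBandit

variable {X A : Type*} [MeasurableSpace X] [MeasurableSpace A] {d : ℕ} (M : KLBandit X A d)

instance : IsProbabilityMeasure M.d0 := M.d0_prob
instance : IsMarkovKernel M.pi0 := M.pi0_markov

lemma measurable_reward : Measurable fun p : EuclideanSpace ℝ (Fin d) × X × A =>
    M.reward p.1 p.2.1 p.2.2 :=
  Measurable.inner measurable_fst (M.φ_measurable.comp measurable_snd)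

lemma measurable_φ (x : X) : Measurable (M.φ x) := M.φ_measurable.of_uncurry_left

lemma measurable_reward_right (θ : EuclideanSpace ℝ (Fin d)) (x : X) : Measurable (M.reward θ x) :=
  Measurable.inner measurable_const (M.measurable_φ x)

lemma abs_reward_le (θ : EuclideanSpace ℝ (Fin d)) (x : X) (a : A) : |M.reward θ x a| ≤ ‖θ‖ :=
  (abs_real_inner_le_norm _ _).trans
    (mul_le_of_le_one_right (norm_nonneg _) (M.φ_norm_le x a))

lemma integrable_φ (x : X) (μ : Measure A) [IsFiniteMeasure μ] : Integrable (M.φ x) μ :=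
  Integrable.of_bound (M.measurable_φ x).aestronglyMeasurable 1 (ae_of_all _ (M.φ_norm_le x))

lemma integrable_exp_reward (θ : EuclideanSpace ℝ (Fin d)) (x : X) (μ : Measure A)
    [IsFiniteMeasure μ] : Integrable (fun a => Real.exp (M.reward θ x a / M.η)) μ := by
  refine Integrable.of_bound ((M.measurable_reward_right θ x).div_const _).exp.aestronglyMeasurable
    (Real.exp (‖θ‖ / M.η)) (ae_of_all _ fun a => ?_)
  rw [Real.norm_of_nonneg (Real.exp_pos _).le]
  have := M.η_pos
  have := (abs_le.1 (M.abs_reward_le θ x a)).2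
  gcongr

instance isProbabilityMeasure_gibbs (θ : EuclideanSpace ℝ (Fin d)) (x : X) :
    IsProbabilityMeasure (M.gibbs θ x) :=
  isProbabilityMeasure_tilted (M.integrable_exp_reward θ x _)

/-- The partition function of the Gibbs policies. -/
def partition (θ : EuclideanSpace ℝ (Fin d)) (x : X) : ℝ :=
  ∫ a, Real.exp (M.reward θ x a / M.η) ∂M.pi0 x

lemma measurable_partition :
    Measurable fun p : EuclideanSpace ℝ (Fin d) × X => M.partition p.1 p.2 := by
  have h : StronglyMeasurable (Function.uncurry fun (p : EuclideanSpace ℝ (Fin d) × X) (a : A) =>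
      Real.exp (M.reward p.1 p.2 a / M.η)) := by
    refine Measurable.stronglyMeasurable ?_
    refine Measurable.exp (Measurable.div_const ?_ _)
    exact M.measurable_reward.comp (MeasurableEquiv.prodAssoc.measurable)
  exact (h.integral_kernel_prod_right'
    (κ := M.pi0.comap (Prod.snd : EuclideanSpace ℝ (Fin d) × X → X) measurable_snd)).measurable

lemma measurable_gibbs :
    Measurable fun p : EuclideanSpace ℝ (Fin d) × X => M.gibbs p.1 p.2 := by
  let κ : Kernel (EuclideanSpace ℝ (Fin d) × X) A := M.pi0.comap Prod.snd measurable_snd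
  have hf : Measurable (Function.uncurry fun (p : EuclideanSpace ℝ (Fin d) × X) (a : A) =>
      ENNReal.ofReal (Real.exp (M.reward p.1 p.2 a / M.η) / M.partition p.1 p.2)) := by
    refine Measurable.ennreal_ofReal (Measurable.div ?_ ?_)
    · refine Measurable.exp (Measurable.div_const ?_ _)
      exact M.measurable_reward.comp (MeasurableEquiv.prodAssoc.measurable)
    · exact M.measurable_partition.comp measurable_fst
  have : (fun p : EuclideanSpace ℝ (Fin d) × X => M.gibbs p.1 p.2) =
      fun p => κ.withDensity (fun p a =>
        ENNReal.ofReal (Real.exp (M.reward p.1 p.2 a / M.η) / M.partition p.1 p.2)) p := by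
    funext p
    rw [Kernel.withDensity_apply _ hf]
    rfl
  rw [this]
  exact Kernel.measurable _

/-- The Gibbs policies as a Markov kernel. -/
def gibbsKernel : Kernel (EuclideanSpace ℝ (Fin d) × X) A := ⟨_, M.measurable_gibbs⟩

instance : IsMarkovKernel M.gibbsKernel := ⟨fun p => M.isProbabilityMeasure_gibbs p.1 p.2⟩

lemma measurable_meanFeature :
    Measurable fun p : EuclideanSpace ℝ (Fin d) × X => M.meanFeature p.2 (M.gibbs p.1) := by
  have h : StronglyMeasurable (Function.uncurry fun (p : EuclideanSpace ℝ (Fin d) × X) (a : A) =>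
      M.φ p.2 a) :=
    (M.φ_measurable.comp
      ((measurable_snd.comp measurable_fst).prodMk measurable_snd)).stronglyMeasurable
  exact (h.integral_kernel_prod_right' (κ := M.gibbsKernel)).measurable

lemma norm_meanFeature_le (θ : EuclideanSpace ℝ (Fin d)) (x : X) :
    ‖M.meanFeature x (M.gibbs θ)‖ ≤ 1 := by
  have := norm_integral_le_of_norm_le_const (μ := M.gibbs θ x) (ae_of_all _ (M.φ_norm_le x))
  simpa [meanFeature] using this

/-- The probability that the first response is preferred. -/
def prefProb (p : X × A × A) : ℝ :=
  Real.sigmoid (M.reward M.θstar p.1 p.2.1 - M.reward M.θstar p.1 p.2.2)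

lemma measurable_prefProb : Measurable M.prefProb := by
  refine continuous_sigmoid.measurable.comp (Measurable.sub ?_ ?_)
  · exact M.measurable_reward.comp (measurable_const.prodMk
      (measurable_fst.prodMk (measurable_fst.comp measurable_snd)))
  · exact M.measurable_reward.comp (measurable_const.prodMk
      (measurable_fst.prodMk (measurable_snd.comp measurable_snd)))

lemma lintegral_labelledLaw (p : X × A × A) {f : Sample X A → ENNReal} (hf : Measurable f) :
    ∫⁻ s, f s ∂M.labelledLaw p =
      ENNReal.ofReal (M.prefProb p) * f (p.1, p.2.1, p.2.2, true) +
        ENNReal.ofReal (1 - M.prefProb p) * f (p.1, p.2.1, p.2.2, false) := by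
  simp only [labelledLaw]
  rw [lintegral_add_measure, lintegral_smul_measure, lintegral_smul_measure, lintegral_dirac' _ hf,
    lintegral_dirac' _ hf]
  rfl

lemma prefProb_nonneg (p : X × A × A) : 0 ≤ M.prefProb p := Real.sigmoid_nonneg _

lemma prefProb_le_one (p : X × A × A) : M.prefProb p ≤ 1 := Real.sigmoid_le_one _

instance isProbabilityMeasure_labelledLaw (p : X × A × A) :
    IsProbabilityMeasure (M.labelledLaw p) := ⟨by
  rw [← lintegral_one, M.lintegral_labelledLaw p measurable_const, mul_one, mul_one,
    ← ENNReal.ofReal_add (M.prefProb_nonneg p) (sub_nonneg.2 (M.prefProb_le_one p))]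
  simp⟩

lemma measurable_lintegral_labelledLaw {f : Sample X A → ENNReal} (hf : Measurable f) :
    Measurable fun p => ∫⁻ s, f s ∂M.labelledLaw p := by
  simp_rw [M.lintegral_labelledLaw _ hf]
  refine Measurable.add (Measurable.mul ?_ ?_) (Measurable.mul ?_ ?_)
  · exact M.measurable_prefProb.ennreal_ofReal
  · exact hf.comp (measurable_fst.prodMk ((measurable_fst.comp measurable_snd).prodMk
      ((measurable_snd.comp measurable_snd).prodMk measurable_const)))
  · exact (measurable_const.sub M.measurable_prefProb).ennreal_ofReal
  · exact hf.comp (measurable_fst.prodMk ((measurable_fst.comp measurable_snd).prodMk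
      ((measurable_snd.comp measurable_snd).prodMk measurable_const)))

lemma measurable_labelledLaw : Measurable M.labelledLaw := by
  refine Measure.measurable_of_measurable_coe _ fun s hs => ?_
  have := M.measurable_lintegral_labelledLaw (f := s.indicator 1) (measurable_one.indicator hs)
  simpa [lintegral_indicator_one hs] using this

/-- The law of the comparison of two Gibbs policies. -/
abbrev gibbsComparison (θ₁ θ₂ : EuclideanSpace ℝ (Fin d)) (x : X) : Measure (Sample X A) :=
  M.comparisonLaw (M.gibbs θ₁) (M.gibbs θ₂) x

lemma measurable_labelledLaw_right (x : X) :
    Measurable fun a : A × A => M.labelledLaw (x, a.1, a.2) :=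
  M.measurable_labelledLaw.comp (measurable_const.prodMk measurable_id)

lemma lintegral_gibbsComparison (θ₁ θ₂ : EuclideanSpace ℝ (Fin d)) (x : X)
    {f : Sample X A → ENNReal} (hf : Measurable f) :
    ∫⁻ s, f s ∂M.gibbsComparison θ₁ θ₂ x =
      ∫⁻ a, ∫⁻ s, f s ∂M.labelledLaw (x, a.1, a.2) ∂(M.gibbs θ₁ x).prod (M.gibbs θ₂ x) :=
  Measure.lintegral_bind (M.measurable_labelledLaw_right x).aemeasurable hf.aemeasurable

instance isProbabilityMeasure_gibbsComparison (θ₁ θ₂ : EuclideanSpace ℝ (Fin d)) (x : X) :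
    IsProbabilityMeasure (M.gibbsComparison θ₁ θ₂ x) := ⟨by
  rw [← lintegral_one, M.lintegral_gibbsComparison _ _ _ measurable_const]
  simp⟩

lemma measurable_gibbsComparison {P : Type*} [MeasurableSpace P]
    {θ₁ θ₂ : P → EuclideanSpace ℝ (Fin d)} {x : P → X} (h₁ : Measurable θ₁) (h₂ : Measurable θ₂)
    (hx : Measurable x) : Measurable fun p => M.gibbsComparison (θ₁ p) (θ₂ p) (x p) := by
  let κ₁ : Kernel P A := M.gibbsKernel.comap (fun p => (θ₁ p, x p)) (h₁.prodMk hx)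
  let κ₂ : Kernel P A := M.gibbsKernel.comap (fun p => (θ₂ p, x p)) (h₂.prodMk hx)
  refine Measure.measurable_of_measurable_coe _ fun s hs => ?_
  have e : ∀ p, M.gibbsComparison (θ₁ p) (θ₂ p) (x p) s =
      ∫⁻ a, M.labelledLaw (x p, a.1, a.2) s ∂(κ₁ ×ₖ κ₂) p := fun p => by
    rw [Kernel.prod_apply]
    exact Measure.bind_apply hs (M.measurable_labelledLaw_right (x p)).aemeasurable
  simp_rw [e]
  refine Measurable.lintegral_kernel_prod_right (κ := κ₁ ×ₖ κ₂) ?_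
  exact (Measure.measurable_coe hs).comp (M.measurable_labelledLaw.comp
    ((hx.comp measurable_fst).prodMk measurable_snd))

/-- The prompt of a comparison for the prompt `x` is `x`. -/
lemma gibbsComparison_map (θ₁ θ₂ : EuclideanSpace ℝ (Fin d)) (x : X) :
    (M.gibbsComparison θ₁ θ₂ x).map (fun s => (x, s.2)) = M.gibbsComparison θ₁ θ₂ x := by
  have hmeas : Measurable fun s : Sample X A => (x, s.2) := measurable_const.prodMk measurable_snd
  refine Measure.ext_of_lintegral _ fun f hf => ?_
  have hf' : Measurable fun s : Sample X A => f (x, s.2) := hf.comp hmeas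
  rw [lintegral_map hf hmeas, M.lintegral_gibbsComparison _ _ _ hf',
    M.lintegral_gibbsComparison _ _ _ hf]
  refine lintegral_congr fun a => ?_
  rw [M.lintegral_labelledLaw _ hf', M.lintegral_labelledLaw _ hf]

/-- A sample records its own prompt, which is almost surely the given one. The enhancer is defined
from the prompts, whereas events about the data read the prompts off the batch; the two descriptions
become interchangeable under the integral. -/
lemma lintegral_pi_gibbsComparison {m : ℕ} (θ₁ θ₂ : EuclideanSpace ℝ (Fin d)) (xs : Fin m → X)
    {F : (Fin m → X) × (Fin m → Sample X A) → ENNReal} (hF : Measurable F) :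
    ∫⁻ b, F (fun j => (b j).1, b) ∂Measure.pi (fun j => M.gibbsComparison θ₁ θ₂ (xs j)) =
      ∫⁻ b, F (xs, b) ∂Measure.pi (fun j => M.gibbsComparison θ₁ θ₂ (xs j)) := by
  have hm : ∀ j, Measurable fun s : Sample X A => (xs j, s.2) :=
    fun j => measurable_const.prodMk measurable_snd
  have : ∀ j, IsProbabilityMeasure ((M.gibbsComparison θ₁ θ₂ (xs j)).map
      fun s => (xs j, s.2)) := fun j => Measure.isProbabilityMeasure_map (hm j).aemeasurable
  have key := Measure.pi_map_pi (μ := fun j => M.gibbsComparison θ₁ θ₂ (xs j))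
    (f := fun j s => (xs j, s.2)) fun j => (hm j).aemeasurable
  simp_rw [gibbsComparison_map] at key
  have hΦ : Measurable fun (b : Fin m → Sample X A) j => (xs j, (b j).2) :=
    measurable_pi_lambda _ fun j => (hm j).comp (measurable_pi_apply j)
  have hF1 : Measurable fun b : Fin m → Sample X A => F (fun j => (b j).1, b) :=
    hF.comp (Measurable.prodMk
      (measurable_pi_lambda _ fun j => measurable_fst.comp (measurable_pi_apply j)) measurable_id)
  have hF2 : Measurable fun b : Fin m → Sample X A => F (xs, b) :=
    hF.comp (measurable_const.prodMk measurable_id)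
  rw [← key, lintegral_map hF1 hΦ, lintegral_map hF2 hΦ]

lemma measurable_featureDiff : Measurable M.featureDiff :=
  (M.φ_measurable.comp (measurable_fst.prodMk (measurable_fst.comp measurable_snd))).sub
    (M.φ_measurable.comp (measurable_fst.prodMk
      (measurable_fst.comp (measurable_snd.comp measurable_snd))))

lemma norm_featureDiff_le (s : Sample X A) : ‖M.featureDiff s‖ ≤ 2 := by
  have h1 := M.φ_norm_le s.1 s.2.1
  have h2 := M.φ_norm_le s.1 s.2.2.1
  exact (norm_sub_le _ _).trans (by linarith)

lemma measurable_pi_labelledLaw {nOff : ℕ} :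
    Measurable fun p : Fin nOff → X × A × A => Measure.pi fun i => M.labelledLaw (p i) :=
  measurable_measure_pi fun i => M.measurable_labelledLaw.comp (measurable_pi_apply i)

lemma lintegral_offlineLaw {nOff : ℕ} (ρ : Measure (Fin nOff → X × A × A))
    {f : (Fin nOff → Sample X A) → ENNReal} (hf : Measurable f) :
    ∫⁻ D, f D ∂M.offlineLaw ρ = ∫⁻ p, ∫⁻ D, f D ∂Measure.pi (fun i => M.labelledLaw (p i)) ∂ρ :=
  Measure.lintegral_bind M.measurable_pi_labelledLaw.aemeasurable hf.aemeasurable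

end KLBandit

/-! ### Histories and the law of a run -/

/-- The data after one more batch. -/
def History.append {X A : Type*} {nOff m t : ℕ} (h : History X A nOff m t)
    (b : Fin m → Sample X A) : History X A nOff m (t + 1) :=
  (h.1, Fin.snoc (α := fun _ => Fin m → Sample X A) h.2 b)

/-- The data after the first `s` batches. -/
def History.take {X A : Type*} {nOff m T : ℕ} (h : History X A nOff m T) {s : ℕ} (hs : s ≤ T) :
    History X A nOff m s := (h.1, fun i => h.2 (Fin.castLE hs i))

namespace History

variable {X A : Type*} {nOff m : ℕ}

lemma take_append {t : ℕ} (h : History X A nOff m t) (b : Fin m → Sample X A) :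
    (h.append b).take (Nat.le_succ t) = h := by
  refine Prod.ext rfl (funext fun i => ?_)
  exact Fin.snoc_castSucc (α := fun _ => Fin m → Sample X A) b h.2 i

variable [MeasurableSpace X] [MeasurableSpace A]

lemma measurable_append {t : ℕ} :
    Measurable fun p : History X A nOff m t × (Fin m → Sample X A) => p.1.append p.2 := by
  refine (measurable_fst.comp measurable_fst).prodMk (measurable_pi_lambda _ fun i => ?_)
  refine Fin.lastCases ?_ (fun i => ?_) i
  · simp only [Fin.snoc_last]
    exact measurable_snd
  · simp only [Fin.snoc_castSucc]
    exact (measurable_pi_apply i).comp (measurable_snd.comp measurable_fst)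

lemma measurable_append_right {t : ℕ} (h : History X A nOff m t) :
    Measurable fun b : Fin m → Sample X A => h.append b :=
  measurable_append.comp (measurable_const.prodMk measurable_id)

lemma measurable_take {T s : ℕ} (hs : s ≤ T) :
    Measurable fun h : History X A nOff m T => h.take hs :=
  measurable_fst.prodMk (measurable_pi_lambda _ fun i =>
    (measurable_pi_apply (Fin.castLE hs i)).comp measurable_snd)

end History

namespace GSHFRules

variable {X A : Type*} [MeasurableSpace X] [MeasurableSpace A] {d nOff m : ℕ}

variable (R : GSHFRules X A d nOff m) (M : KLBandit X A d)

lemma measurable_pi_comparison (t : ℕ) :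
    Measurable fun p : History X A nOff m t × (Fin m → X) =>
      Measure.pi fun j => M.gibbsComparison (R.mainParam t p.1) (R.enhParam t p.1 p.2) (p.2 j) :=
  measurable_measure_pi fun j => M.measurable_gibbsComparison
    ((R.mainParam_measurable t).comp measurable_fst) (R.enhParam_measurable t)
    ((measurable_pi_apply j).comp measurable_snd)

lemma lintegral_batchLaw_aux {t : ℕ} (h : History X A nOff m t)
    {f : (Fin m → Sample X A) → ENNReal} (hf : Measurable f) :
    ∫⁻ b, f b ∂ R.batchLaw M h = ∫⁻ xs, ∫⁻ b, f b ∂Measure.pi (fun j =>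
      M.gibbsComparison (R.mainParam t h) (R.enhParam t h xs) (xs j))
        ∂Measure.pi (fun _ : Fin m => M.d0) :=
  Measure.lintegral_bind ((R.measurable_pi_comparison M t).comp
    (measurable_const.prodMk measurable_id)).aemeasurable hf.aemeasurable

/-- Integration of a function of the prompts and of the whole batch. -/
lemma lintegral_batchLaw {t : ℕ} (h : History X A nOff m t)
    {F : (Fin m → X) × (Fin m → Sample X A) → ENNReal} (hF : Measurable F) :
    ∫⁻ b, F (fun j => (b j).1, b) ∂ R.batchLaw M h = ∫⁻ xs, ∫⁻ b, F (xs, b) ∂Measure.pi (fun j =>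
      M.gibbsComparison (R.mainParam t h) (R.enhParam t h xs) (xs j))
        ∂Measure.pi (fun _ : Fin m => M.d0) := by
  rw [R.lintegral_batchLaw_aux M h (f := fun b => F (fun j => (b j).1, b))]
  · exact lintegral_congr fun xs => M.lintegral_pi_gibbsComparison _ _ xs hF
  · exact hF.comp (Measurable.prodMk
      (measurable_pi_lambda _ fun j => measurable_fst.comp (measurable_pi_apply j)) measurable_id)

instance isProbabilityMeasure_batchLaw {t : ℕ} (h : History X A nOff m t) :
    IsProbabilityMeasure (R.batchLaw M h) := ⟨by
  rw [← lintegral_one, R.lintegral_batchLaw_aux M h measurable_const]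
  simp⟩

lemma measurable_batchLaw (t : ℕ) :
    Measurable fun h : History X A nOff m t => R.batchLaw M h := by
  refine Measure.measurable_of_measurable_coe _ fun s hs => ?_
  have e : ∀ h : History X A nOff m t, R.batchLaw M h s = ∫⁻ xs, (Measure.pi fun j =>
      M.gibbsComparison (R.mainParam t h) (R.enhParam t h xs) (xs j)) s
        ∂Measure.pi (fun _ : Fin m => M.d0) := fun h =>
    Measure.bind_apply hs ((R.measurable_pi_comparison M t).comp
      (measurable_const.prodMk measurable_id)).aemeasurable
  simp_rw [e]
  exact Measurable.lintegral_prod_right'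
    ((Measure.measurable_coe hs).comp (R.measurable_pi_comparison M t))

/-- The law of a batch as a Markov kernel. -/
def batchKernel (t : ℕ) : Kernel (History X A nOff m t) (Fin m → Sample X A) :=
  ⟨_, R.measurable_batchLaw M t⟩

instance (t : ℕ) : IsMarkovKernel (R.batchKernel M t) :=
  ⟨fun h => R.isProbabilityMeasure_batchLaw M h⟩

lemma measurable_lintegral_batchLaw {t : ℕ}
    {f : History X A nOff m t × (Fin m → Sample X A) → ENNReal} (hf : Measurable f) :
    Measurable fun h : History X A nOff m t => ∫⁻ b, f (h, b) ∂ R.batchLaw M h :=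
  Measurable.lintegral_kernel_prod_right' (κ := R.batchKernel M t) hf

lemma measurable_map_batchLaw (t : ℕ) : Measurable fun h : History X A nOff m t =>
    (R.batchLaw M h).map fun b => h.append b := by
  refine Measure.measurable_of_measurable_coe _ fun s hs => ?_
  have e : ∀ h : History X A nOff m t, (R.batchLaw M h).map (fun b => h.append b) s =
      ∫⁻ b, s.indicator 1 (h.append b) ∂ R.batchLaw M h := fun h => by
    rw [← lintegral_indicator_one hs, lintegral_map (measurable_one.indicator hs)
      h.measurable_append_right]
  simp_rw [e]
  exact R.measurable_lintegral_batchLaw M (f := fun p => s.indicator 1 (p.1.append p.2))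
    ((measurable_one.indicator hs).comp History.measurable_append)

lemma lintegral_runLaw_succ (ρ : Measure (Fin nOff → X × A × A)) (t : ℕ)
    {f : History X A nOff m (t + 1) → ENNReal} (hf : Measurable f) :
    ∫⁻ h, f h ∂ R.runLaw M ρ (t + 1) =
      ∫⁻ h, ∫⁻ b, f (h.append b) ∂ R.batchLaw M h ∂ R.runLaw M ρ t := by
  have h1 : ∫⁻ h, f h ∂ R.runLaw M ρ (t + 1) =
      ∫⁻ h, ∫⁻ h', f h' ∂(R.batchLaw M h).map (fun b => h.append b) ∂ R.runLaw M ρ t :=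
    Measure.lintegral_bind (R.measurable_map_batchLaw M t).aemeasurable hf.aemeasurable
  rw [h1]
  refine lintegral_congr fun h => ?_
  rw [lintegral_map hf h.measurable_append_right]

lemma lintegral_runLaw_zero (ρ : Measure (Fin nOff → X × A × A))
    {f : History X A nOff m 0 → ENNReal} (hf : Measurable f) :
    ∫⁻ h, f h ∂ R.runLaw M ρ 0 = ∫⁻ p, ∫⁻ D, f (D, Fin.elim0)
      ∂Measure.pi (fun i => M.labelledLaw (p i)) ∂ρ := by
  have hm : Measurable fun D : Fin nOff → Sample X A =>
      ((D, Fin.elim0) : History X A nOff m 0) := measurable_id.prodMk measurable_const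
  have h1 : ∫⁻ h, f h ∂ R.runLaw M ρ 0 = ∫⁻ D, f (D, Fin.elim0) ∂M.offlineLaw ρ :=
    lintegral_map hf hm
  rw [h1]
  exact M.lintegral_offlineLaw ρ (hf.comp hm)

instance isProbabilityMeasure_runLaw (ρ : Measure (Fin nOff → X × A × A)) [IsProbabilityMeasure ρ]
    (t : ℕ) : IsProbabilityMeasure (R.runLaw M ρ t) := by
  refine ⟨?_⟩
  rw [← lintegral_one]
  induction t with
  | zero => rw [R.lintegral_runLaw_zero M ρ measurable_const]; simp
  | succ t ih => rw [R.lintegral_runLaw_succ M ρ t measurable_const]; simpa using ih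

/-- Disintegration of the law of the data over the offline prompts and responses. -/
lemma lintegral_runLaw_eq_dirac (ρ : Measure (Fin nOff → X × A × A)) (t : ℕ)
    {f : History X A nOff m t → ENNReal} (hf : Measurable f) :
    ∫⁻ h, f h ∂ R.runLaw M ρ t = ∫⁻ p, ∫⁻ h, f h ∂ R.runLaw M (Measure.dirac p) t ∂ρ := by
  induction t with
  | zero =>
    rw [R.lintegral_runLaw_zero M ρ hf]
    refine lintegral_congr fun p => ?_
    rw [R.lintegral_runLaw_zero M _ hf, lintegral_dirac']
    have hm : Measurable fun D : Fin nOff → Sample X A =>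
        ((D, Fin.elim0) : History X A nOff m 0) := measurable_id.prodMk measurable_const
    exact (Measure.measurable_lintegral (hf.comp hm)).comp M.measurable_pi_labelledLaw
  | succ t ih =>
    rw [R.lintegral_runLaw_succ M ρ t hf,
      ih (R.measurable_lintegral_batchLaw M (f := fun p => f (p.1.append p.2))
        (hf.comp History.measurable_append))]
    refine lintegral_congr fun p => ?_
    rw [R.lintegral_runLaw_succ M _ t hf]

/-- Later batches integrate out to mass one, so events about early iterations may be studied under
the law of the shorter run. -/
lemma runLaw_map_take (ρ : Measure (Fin nOff → X × A × A)) {s T : ℕ} (hs : s ≤ T) :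
    (R.runLaw M ρ T).map (fun h => h.take hs) = R.runLaw M ρ s := by
  induction T, hs using Nat.le_induction with
  | base => exact Measure.map_id
  | succ T hs ih =>
    rw [← ih]
    refine Measure.ext_of_lintegral _ fun f hf => ?_
    rw [lintegral_map hf (History.measurable_take _), lintegral_map hf (History.measurable_take _),
      R.lintegral_runLaw_succ M ρ T (f := fun h => f (h.take (Nat.le_succ_of_le hs)))
        (hf.comp (History.measurable_take _))]
    refine lintegral_congr fun h => ?_
    have e : ∀ b, (h.append b).take (Nat.le_succ_of_le hs) = h.take hs := fun b => by
      conv_rhs => rw [← h.take_append b]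
      rfl
    simp [e]

end GSHFRules

/-! ### The KL-regularized value of the Gibbs policies -/

/-- The log-density of the tilted measure is `g` minus the logarithm of the partition function, and
boundedness of `g` makes it integrable. -/
lemma klDiv_tilted_ne_top_and_toReal_eq {Ω : Type*} [MeasurableSpace Ω] (μ : Measure Ω) [IsProbabilityMeasure μ]
    {g : Ω → ℝ} (hg : Measurable g) {K : ℝ} (hK : ∀ ω, |g ω| ≤ K) :
    klDiv (μ.tilted g) μ ≠ ⊤ ∧ (klDiv (μ.tilted g) μ).toReal =
      ∫ ω, g ω ∂μ.tilted g - Real.log (∫ ω, Real.exp (g ω) ∂μ) := by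
  have hexp : Integrable (fun ω => Real.exp (g ω)) μ := by
    refine Integrable.of_bound hg.exp.aestronglyMeasurable (Real.exp K) (ae_of_all _ fun ω => ?_)
    rw [Real.norm_of_nonneg (Real.exp_pos _).le]
    exact Real.exp_le_exp.2 (abs_le.1 (hK ω)).2
  have := isProbabilityMeasure_tilted hexp
  have h : ∀ᵐ ω ∂μ.tilted g, llr (μ.tilted g) μ ω = g ω - Real.log (∫ ω, Real.exp (g ω) ∂μ) :=
    (tilted_absolutelyContinuous μ g).ae_le (log_rnDeriv_tilted_left_self hexp)
  have hint : Integrable g (μ.tilted g) :=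
    Integrable.of_bound hg.aestronglyMeasurable K (ae_of_all _ hK)
  refine ⟨klDiv_ne_top (tilted_absolutelyContinuous μ g)
    ((hint.sub (integrable_const _)).congr (h.mono fun _ hω => hω.symm)), ?_⟩
  rw [toReal_klDiv_of_measure_eq (tilted_absolutelyContinuous μ g) (by simp),
    integral_congr_ae h, integral_sub hint (integrable_const _)]
  simp

namespace KLBandit

variable {X A : Type*} [MeasurableSpace X] [MeasurableSpace A] {d : ℕ} (M : KLBandit X A d)

lemma integral_reward_gibbs (θ θ' : EuclideanSpace ℝ (Fin d)) (x : X) :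
    ∫ a, M.reward θ x a ∂M.gibbs θ' x = inner ℝ θ (M.meanFeature x (M.gibbs θ')) :=
  integral_inner (M.integrable_φ x _) θ

lemma partition_pos (θ : EuclideanSpace ℝ (Fin d)) (x : X) : 0 < M.partition θ x :=
  integral_exp_pos (M.integrable_exp_reward θ x _)

lemma abs_reward_div_le (θ : EuclideanSpace ℝ (Fin d)) (x : X) (a : A) :
    |M.reward θ x a / M.η| ≤ ‖θ‖ / M.η := by
  rw [abs_div, abs_of_pos M.η_pos]
  have := M.η_pos
  have := M.abs_reward_le θ x a
  gcongr

/-- Tilts compose. Gibbs policies are thus bounded tilts of one another, and their mutual divergence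
follows from the formula for a single tilt. -/
lemma gibbs_eq_tilted (θ θ' : EuclideanSpace ℝ (Fin d)) (x : X) :
    M.gibbs θ' x = (M.gibbs θ x).tilted fun a => M.reward (θ' - θ) x a / M.η := by
  rw [gibbs, gibbs, tilted_tilted (M.integrable_exp_reward θ x _)]
  congr 1
  funext a
  simp only [Pi.add_apply, reward, inner_sub_left]
  ring

lemma toReal_klDiv_gibbs (θ θ' : EuclideanSpace ℝ (Fin d)) (x : X) :
    (klDiv (M.gibbs θ' x) (M.gibbs θ x)).toReal =
      inner ℝ (θ' - θ) (M.meanFeature x (M.gibbs θ')) / M.η -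
        (Real.log (M.partition θ' x) - Real.log (M.partition θ x)) := by
  have h := (klDiv_tilted_ne_top_and_toReal_eq (M.gibbs θ x) (g := fun a => M.reward (θ' - θ) x a / M.η)
    ((M.measurable_reward_right _ x).div_const _) (M.abs_reward_div_le (θ' - θ) x)).2
  rw [← M.gibbs_eq_tilted θ θ' x, integral_div, integral_reward_gibbs] at h
  rw [h, ← Real.log_div (M.partition_pos θ' x).ne' (M.partition_pos θ x).ne']
  congr 2
  rw [gibbs, integral_exp_tilted]
  congr 1
  refine integral_congr_ae (ae_of_all _ fun a => ?_)
  simp only [Pi.add_apply, reward, inner_sub_left]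
  congr 1
  ring

lemma toReal_klDiv_gibbs_pi0 (θ : EuclideanSpace ℝ (Fin d)) (x : X) :
    (klDiv (M.gibbs θ x) (M.pi0 x)).toReal =
      inner ℝ θ (M.meanFeature x (M.gibbs θ)) / M.η - Real.log (M.partition θ x) := by
  have h := (klDiv_tilted_ne_top_and_toReal_eq (M.pi0 x) (g := fun a => M.reward θ x a / M.η)
    ((M.measurable_reward_right _ x).div_const _) (M.abs_reward_div_le θ x)).2
  rw [integral_div] at h
  rw [← integral_reward_gibbs]
  exact h

lemma integrable_inner_meanFeature (θ θ' : EuclideanSpace ℝ (Fin d)) :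
    Integrable (fun x => inner ℝ θ (M.meanFeature x (M.gibbs θ'))) M.d0 := by
  have hm : Measurable fun x => M.meanFeature x (M.gibbs θ') :=
    M.measurable_meanFeature.comp (g := fun p : EuclideanSpace ℝ (Fin d) × X =>
      M.meanFeature p.2 (M.gibbs p.1)) (f := fun x => (θ', x)) measurable_prodMk_left
  have hm' : Measurable fun x => (inner ℝ θ (M.meanFeature x (M.gibbs θ')) : ℝ) :=
    (innerSL ℝ θ).continuous.measurable.comp hm
  refine Integrable.of_bound hm'.aestronglyMeasurable ‖θ‖ (ae_of_all _ fun x => ?_)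
  exact (abs_real_inner_le_norm _ _).trans
    (mul_le_of_le_one_right (norm_nonneg _) (M.norm_meanFeature_le θ' x))

lemma abs_log_partition_le (θ : EuclideanSpace ℝ (Fin d)) (x : X) :
    |Real.log (M.partition θ x)| ≤ ‖θ‖ / M.η := by
  have h := fun a => abs_le.1 (M.abs_reward_div_le θ x a)
  have hint := M.integrable_exp_reward θ x (M.pi0 x)
  rw [abs_le]
  constructor
  · rw [Real.le_log_iff_exp_le (M.partition_pos θ x)]
    have := integral_mono (integrable_const (Real.exp (-(‖θ‖ / M.η)))) hint
      fun a => Real.exp_le_exp.2 (h a).1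
    simpa [partition] using this
  · rw [Real.log_le_iff_le_exp (M.partition_pos θ x)]
    have := integral_mono hint (integrable_const (Real.exp (‖θ‖ / M.η)))
      fun a => Real.exp_le_exp.2 (h a).2
    simpa [partition] using this

lemma integrable_log_partition (θ : EuclideanSpace ℝ (Fin d)) :
    Integrable (fun x => Real.log (M.partition θ x)) M.d0 :=
  Integrable.of_bound (M.measurable_partition.comp
    (measurable_const.prodMk measurable_id)).log.aestronglyMeasurable (‖θ‖ / M.η)
    (ae_of_all _ (M.abs_log_partition_le θ))

/-- `E_{x ∼ d₀} ⟪θ, φ(x, π_θ')⟫`. -/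
def meanReward (θ θ' : EuclideanSpace ℝ (Fin d)) : ℝ :=
  ∫ x, inner ℝ θ (M.meanFeature x (M.gibbs θ')) ∂M.d0

/-- `E_{x ∼ d₀} log Z_θ(x)`. -/
def meanLogPartition (θ : EuclideanSpace ℝ (Fin d)) : ℝ :=
  ∫ x, Real.log (M.partition θ x) ∂M.d0

lemma meanReward_sub (θ₁ θ₂ θ' : EuclideanSpace ℝ (Fin d)) :
    M.meanReward (θ₁ - θ₂) θ' = M.meanReward θ₁ θ' - M.meanReward θ₂ θ' := by
  rw [meanReward, meanReward, meanReward, ← integral_sub (M.integrable_inner_meanFeature _ _)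
    (M.integrable_inner_meanFeature _ _)]
  simp only [inner_sub_left]

/-- With the divergence made explicit, values and expected divergences are combinations of mean
rewards and mean log-partition functions, so identities between them are linear. -/
lemma regValue_gibbs (θ θ' : EuclideanSpace ℝ (Fin d)) :
    M.regValue (M.reward θ) (M.gibbs θ') =
      M.meanReward θ θ' - M.meanReward θ' θ' + M.η * M.meanLogPartition θ' := by
  have e : ∀ x, (∫ a, M.reward θ x a ∂M.gibbs θ' x) -
      M.η * (klDiv (M.gibbs θ' x) (M.pi0 x)).toReal =
      inner ℝ θ (M.meanFeature x (M.gibbs θ')) - inner ℝ θ' (M.meanFeature x (M.gibbs θ')) +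
        M.η * Real.log (M.partition θ' x) := fun x => by
    have := M.η_pos
    rw [integral_reward_gibbs, toReal_klDiv_gibbs_pi0]
    field_simp
    ring
  rw [regValue]
  simp_rw [e]
  have hsub : Integrable (fun x => inner ℝ θ (M.meanFeature x (M.gibbs θ')) -
      inner ℝ θ' (M.meanFeature x (M.gibbs θ'))) M.d0 :=
    (M.integrable_inner_meanFeature _ _).sub (M.integrable_inner_meanFeature _ _)
  rw [integral_add hsub ((M.integrable_log_partition θ').const_mul _), integral_sub
    (M.integrable_inner_meanFeature _ _) (M.integrable_inner_meanFeature _ _), integral_const_mul]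
  rfl

lemma integrable_toReal_klDiv_gibbs (θ θ' : EuclideanSpace ℝ (Fin d)) :
    Integrable (fun x => (klDiv (M.gibbs θ' x) (M.gibbs θ x)).toReal) M.d0 := by
  simp_rw [toReal_klDiv_gibbs]
  exact ((M.integrable_inner_meanFeature _ _).div_const _).sub
    ((M.integrable_log_partition θ').sub (M.integrable_log_partition θ))

lemma eta_mul_expectedKL_gibbs (θ θ' : EuclideanSpace ℝ (Fin d)) :
    M.η * M.expectedKL (M.gibbs θ') (M.gibbs θ) =
      M.meanReward θ' θ' - M.meanReward θ θ' -
        M.η * (M.meanLogPartition θ' - M.meanLogPartition θ) := by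
  have := M.η_pos
  rw [expectedKL]
  simp_rw [toReal_klDiv_gibbs]
  have hsub : Integrable (fun x => Real.log (M.partition θ' x) - Real.log (M.partition θ x)) M.d0 :=
    (M.integrable_log_partition θ').sub (M.integrable_log_partition θ)
  rw [integral_sub ((M.integrable_inner_meanFeature _ _).div_const _) hsub, integral_div,
    integral_sub (M.integrable_log_partition θ') (M.integrable_log_partition θ), ← meanReward_sub]
  change M.η * (M.meanReward (θ' - θ) θ' / M.η - (M.meanLogPartition θ' - M.meanLogPartition θ)) = _
  field_simp

lemma expectedKL_nonneg (π π' : X → Measure A) : 0 ≤ M.expectedKL π π' :=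
  integral_nonneg fun _ => ENNReal.toReal_nonneg

/-- A policy of the class that maximizes the regularized value of `r_θ` agrees with `π_θ`. -/
lemma gibbs_ae_eq_of_isMaxOn {θ θ₁ : EuclideanSpace ℝ (Fin d)} (hθ : ‖θ‖ ≤ M.B)
    (hmax : IsMaxOn (M.regValue (M.reward θ)) M.policyClass (M.gibbs θ₁)) :
    ∀ᵐ x ∂M.d0, M.gibbs θ₁ x = M.gibbs θ x := by
  have h1 : M.regValue (M.reward θ) (M.gibbs θ) ≤ M.regValue (M.reward θ) (M.gibbs θ₁) :=
    hmax ⟨θ, hθ, rfl⟩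
  have hη := M.η_pos
  -- The value of `π_θ` exceeds that of `π_θ₁` by exactly `η` times this divergence, so maximality
  -- of `π_θ₁` makes it vanish.
  have h2 : M.expectedKL (M.gibbs θ₁) (M.gibbs θ) = 0 := by
    refine le_antisymm ?_ (M.expectedKL_nonneg _ _)
    rw [regValue_gibbs, regValue_gibbs] at h1
    have h3 := M.eta_mul_expectedKL_gibbs θ θ₁
    have h4 : M.η * M.expectedKL (M.gibbs θ₁) (M.gibbs θ) ≤ 0 := by rw [h3]; linarith
    exact nonpos_of_mul_nonpos_right h4 hη
  rw [expectedKL, integral_eq_zero_iff_of_nonneg (fun _ => ENNReal.toReal_nonneg)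
    (M.integrable_toReal_klDiv_gibbs θ θ₁)] at h2
  filter_upwards [h2] with x hx
  have hne : klDiv (M.gibbs θ₁ x) (M.gibbs θ x) ≠ ⊤ := by
    rw [M.gibbs_eq_tilted θ θ₁ x]
    exact (klDiv_tilted_ne_top_and_toReal_eq _ ((M.measurable_reward_right _ x).div_const _)
      (M.abs_reward_div_le (θ₁ - θ) x)).1
  have h0 : klDiv (M.gibbs θ₁ x) (M.gibbs θ x) = 0 :=
    ((ENNReal.toReal_eq_zero_iff _).1 hx).resolve_right hne
  exact klDiv_eq_zero_iff.1 h0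

/-- Decomposition of the suboptimality of the main agent. -/
lemma J_sub_J_add_expectedKL {θ θ₁ : EuclideanSpace ℝ (Fin d)} (θ' : EuclideanSpace ℝ (Fin d))
    (hθ : ‖θ‖ ≤ M.B)
    (hmax : IsMaxOn (M.regValue (M.reward θ)) M.policyClass (M.gibbs θ₁)) :
    M.J (M.gibbs θ') - M.J (M.gibbs θ₁) + M.η * M.expectedKL (M.gibbs θ') (M.gibbs θ₁) =
      ∫ x, inner ℝ (M.θstar - θ) (M.meanFeature x (M.gibbs θ') - M.meanFeature x (M.gibbs θ₁))
        ∂M.d0 := by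
  -- Once `π_θ₁` is replaced by `π_θ`, the log-partition terms of the values and of the divergence
  -- cancel, and so do the self-reward terms of `θ'`.
  have hae := M.gibbs_ae_eq_of_isMaxOn hθ hmax
  have e1 : M.J (M.gibbs θ₁) = M.J (M.gibbs θ) := by
    refine integral_congr_ae ?_
    filter_upwards [hae] with x hx
    rw [hx]
  have e2 : M.expectedKL (M.gibbs θ') (M.gibbs θ₁) = M.expectedKL (M.gibbs θ') (M.gibbs θ) := by
    refine integral_congr_ae ?_
    filter_upwards [hae] with x hx
    rw [hx]
  have e3 : ∫ x, inner ℝ (M.θstar - θ) (M.meanFeature x (M.gibbs θ') - M.meanFeature x (M.gibbs θ₁))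
        ∂M.d0 = M.meanReward (M.θstar - θ) θ' - M.meanReward (M.θstar - θ) θ := by
    rw [meanReward, meanReward, ← integral_sub (M.integrable_inner_meanFeature _ _)
      (M.integrable_inner_meanFeature _ _)]
    refine integral_congr_ae ?_
    filter_upwards [hae] with x hx
    rw [inner_sub_right]
    simp only [meanFeature, hx]
  rw [e1, e2, e3, eta_mul_expectedKL_gibbs, J, J, regValue_gibbs, regValue_gibbs, meanReward_sub,
    meanReward_sub]
  ring

end KLBandit

/-! ### Concentration of the maximum likelihood estimate -/

namespace KLBandit

variable {X A : Type*} [MeasurableSpace X] [MeasurableSpace A] {d : ℕ} (M : KLBandit X A d)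

lemma gamma_pos : 0 < M.gamma := by rw [gamma]; positivity

lemma gamma_mul_B_le_one : M.gamma * M.B ≤ 1 := by
  rw [gamma, one_div_mul_eq_div, div_le_one (by positivity)]
  linarith [Real.add_one_le_exp M.B, Real.exp_pos (-M.B)]

/-- Since `γ⁻¹ ≥ 3 + B`. Apart from positivity, this and `gamma_mul_B_le_one` are all that is used
of the definition of `γ`. -/
lemma gamma_mul_le_two : M.gamma * (1 + 2 * M.B) ≤ 2 := by
  rw [gamma, one_div_mul_eq_div, div_le_iff₀ (by positivity)]
  linarith [Real.add_one_le_exp M.B, Real.exp_pos (-M.B)]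

/-- The centred label of a comparison. -/
def noise (s : Sample X A) : ℝ :=
  (if s.2.2.2 then 1 else 0) - M.prefProb (s.1, s.2.1, s.2.2.1)

lemma measurable_noise : Measurable M.noise := by
  refine Measurable.sub ?_ ?_
  · have : Measurable fun b : Bool => if b then (1 : ℝ) else 0 := measurable_of_countable _
    exact this.comp (measurable_snd.comp (measurable_snd.comp measurable_snd))
  · exact M.measurable_prefProb.comp (measurable_fst.prodMk
      ((measurable_fst.comp measurable_snd).prodMk
        (measurable_fst.comp (measurable_snd.comp measurable_snd))))

/-- The exponential-moment weight of a comparison in the direction `u`. -/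
def expWeight (u : EuclideanSpace ℝ (Fin d)) (s : Sample X A) : ENNReal :=
  ENNReal.ofReal (Real.exp (M.noise s * inner ℝ (M.featureDiff s) u
    - inner ℝ (M.featureDiff s) u ^ 2))

lemma measurable_expWeight (u : EuclideanSpace ℝ (Fin d)) : Measurable (M.expWeight u) := by
  have h : Measurable fun s => (inner ℝ (M.featureDiff s) u : ℝ) :=
    M.measurable_featureDiff.inner measurable_const
  exact ((M.measurable_noise.mul h).sub (h.pow_const 2)).exp.ennreal_ofReal

lemma lintegral_labelledLaw_expWeight_le (u : EuclideanSpace ℝ (Fin d)) (p : X × A × A) :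
    ∫⁻ s, M.expWeight u s ∂M.labelledLaw p ≤ 1 := by
  rw [M.lintegral_labelledLaw p (M.measurable_expWeight u)]
  have h0 := M.prefProb_nonneg p
  have h1 := M.prefProb_le_one p
  simp only [expWeight, noise, featureDiff, if_true, Bool.false_eq_true, if_false, Prod.mk.eta,
    zero_sub]
  rw [← ENNReal.ofReal_mul h0, ← ENNReal.ofReal_mul (sub_nonneg.2 h1),
    ← ENNReal.ofReal_add (by positivity) (mul_nonneg (sub_nonneg.2 h1) (Real.exp_pos _).le),
    ← ENNReal.ofReal_one]
  exact ENNReal.ofReal_le_ofReal (bernoulli_mgf_le h0 h1 _)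

lemma abs_inner_θstar_featureDiff_le (s : Sample X A) :
    |inner ℝ M.θstar (M.featureDiff s)| ≤ 1 := by
  have h1 := M.reward_mem s.1 s.2.1
  have h2 := M.reward_mem s.1 s.2.2.1
  rw [featureDiff, inner_sub_right, abs_le]
  exact ⟨by linarith [h1.1, h2.2], by linarith [h1.2, h2.1]⟩

/-- The log-likelihood of a comparison is strongly concave around `θstar`. -/
lemma logLikSample_le {θ : EuclideanSpace ℝ (Fin d)} (hθ : ‖θ‖ ≤ M.B) (s : Sample X A) :
    M.logLikSample θ s ≤ M.logLikSample M.θstar s +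
      M.noise s * inner ℝ (M.featureDiff s) (θ - M.θstar) -
        M.gamma / 64 * inner ℝ (M.featureDiff s) (θ - M.θstar) ^ 2 := by
  set v : ℝ := inner ℝ M.θstar (M.featureDiff s) with hv
  set w : ℝ := inner ℝ (M.featureDiff s) (θ - M.θstar) with hw
  have hv1 : |v| ≤ 1 := M.abs_inner_θstar_featureDiff_le s
  have hvw : inner ℝ θ (M.featureDiff s) = v + w := by
    rw [hv, hw, real_inner_comm (θ - M.θstar), ← inner_add_left]; simp
  have hw4 : |w| ≤ 4 * M.B := by
    have h1 : ‖θ - M.θstar‖ ≤ 2 * M.B :=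
      (norm_sub_le _ _).trans (by linarith [M.θstar_norm_le])
    calc |w| ≤ ‖M.featureDiff s‖ * ‖θ - M.θstar‖ := abs_real_inner_le_norm _ _
      _ ≤ 2 * (2 * M.B) := by
          have := M.norm_featureDiff_le s
          gcongr
      _ = _ := by ring
  have hq := log_sigmoid_add_le_quadratic (w := w) hv1
  -- As `|w| ≤ 4 B`, the damping `1 + |w| / 2` is at most `2 / γ`; hence `64 = 32 * 2`.
  have hk : M.gamma / 64 * w ^ 2 ≤ w ^ 2 / (32 * (1 + |w| / 2)) := by
    rw [le_div_iff₀ (by positivity)]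
    have h1 : M.gamma * (1 + |w| / 2) ≤ 2 := by
      refine le_trans ?_ M.gamma_mul_le_two
      have := M.gamma_pos
      gcongr
      linarith
    nlinarith [sq_nonneg w]
  obtain ⟨x, a₁, a₂, y⟩ := s
  have e1 : ∀ θ', M.reward θ' x a₁ - M.reward θ' x a₂ =
      inner ℝ θ' (M.featureDiff (x, a₁, a₂, y)) := fun θ' => by
    rw [featureDiff, inner_sub_right]; rfl
  have e2 : ∀ θ', M.reward θ' x a₂ - M.reward θ' x a₁ =
      -inner ℝ θ' (M.featureDiff (x, a₁, a₂, y)) := fun θ' => by rw [← e1]; ring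
  have e3 : M.prefProb (x, a₁, a₂) = Real.sigmoid v := by rw [prefProb, e1]
  cases y with
  | true =>
    simp only [logLikSample, noise, if_true, e1, e3, hvw]
    linarith
  | false =>
    simp only [logLikSample, noise, Bool.false_eq_true, if_false, e2, e3, hvw, log_sigmoid_eq_sub]
    rw [← hv]
    linarith

/-- The sum of the squares of `⟪featureDiff s, u⟫` over the data. -/
def sumSq {nOff m t : ℕ} (h : History X A nOff m t) (u : EuclideanSpace ℝ (Fin d)) : ℝ :=
  ∑ i, inner ℝ (M.featureDiff (h.1 i)) u ^ 2 +
    ∑ p : Fin t × Fin m, inner ℝ (M.featureDiff (h.2 p.1 p.2)) u ^ 2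

/-- The score of the log-likelihood at `θstar`. -/
def score {nOff m t : ℕ} (h : History X A nOff m t) : EuclideanSpace ℝ (Fin d) :=
  ∑ i, M.noise (h.1 i) • M.featureDiff (h.1 i) +
    ∑ p : Fin t × Fin m, M.noise (h.2 p.1 p.2) • M.featureDiff (h.2 p.1 p.2)

/-- The exponential-moment weight of the data in the direction `u`. -/
def historyWeight {nOff m t : ℕ} (u : EuclideanSpace ℝ (Fin d)) (h : History X A nOff m t) :
    ENNReal :=
  (∏ i, M.expWeight u (h.1 i)) * ∏ i, ∏ j, M.expWeight u (h.2 i j)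

/-- The product form can be integrated factor by factor along the run; the exponential form is the
one that enters the net argument. -/
lemma historyWeight_eq {nOff m t : ℕ} (u : EuclideanSpace ℝ (Fin d)) (h : History X A nOff m t) :
    M.historyWeight u h = ENNReal.ofReal (Real.exp (inner ℝ u (M.score h) - M.sumSq h u)) := by
  rw [historyWeight, ← Fintype.prod_prod_type' (fun i j => M.expWeight u (h.2 i j))]
  simp only [expWeight]
  rw [← ENNReal.ofReal_prod_of_nonneg fun _ _ => (Real.exp_pos _).le,
    ← ENNReal.ofReal_prod_of_nonneg fun _ _ => (Real.exp_pos _).le,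
    ← ENNReal.ofReal_mul (Finset.prod_nonneg fun _ _ => (Real.exp_pos _).le),
    ← Real.exp_sum, ← Real.exp_sum, ← Real.exp_add, score, sumSq, inner_add_right, inner_sum,
    inner_sum, Finset.sum_sub_distrib, Finset.sum_sub_distrib]
  simp only [real_inner_smul_right, real_inner_comm u]
  congr 2
  ring

lemma measurable_historyWeight {nOff m t : ℕ} (u : EuclideanSpace ℝ (Fin d)) :
    Measurable fun h : History X A nOff m t => M.historyWeight u h := by
  refine Measurable.mul (Finset.measurable_prod _ fun i _ => ?_)
    (Finset.measurable_prod _ fun i _ => Finset.measurable_prod _ fun j _ => ?_)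
  · exact (M.measurable_expWeight u).comp ((measurable_pi_apply i).comp measurable_fst)
  · exact (M.measurable_expWeight u).comp ((measurable_pi_apply j).comp
      ((measurable_pi_apply i).comp measurable_snd))

/-- The basic inequality of maximum likelihood estimation. -/
lemma gamma_mul_sumSq_le {nOff m t : ℕ} (h : History X A nOff m t)
    {θ : EuclideanSpace ℝ (Fin d)} (hθ : ‖θ‖ ≤ M.B)
    (hmax : IsMaxOn (M.logLik h) {θ | ‖θ‖ ≤ M.B} θ) :
    M.gamma / 64 * M.sumSq h (θ - M.θstar) ≤ inner ℝ (M.score h) (θ - M.θstar) := by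
  have h1 : M.logLik h M.θstar ≤ M.logLik h θ := hmax M.θstar_norm_le
  have h2 : M.logLik h θ ≤ M.logLik h M.θstar + inner ℝ (M.score h) (θ - M.θstar) -
      M.gamma / 64 * M.sumSq h (θ - M.θstar) := by
    have k1 := Finset.sum_le_sum fun i (_ : i ∈ Finset.univ) => M.logLikSample_le hθ (h.1 i)
    have k2 := Finset.sum_le_sum fun (p : Fin t × Fin m) (_ : p ∈ Finset.univ) =>
      M.logLikSample_le hθ (h.2 p.1 p.2)
    rw [Finset.sum_sub_distrib, Finset.sum_add_distrib, ← Finset.mul_sum] at k1 k2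
    rw [logLik, logLik, ← Fintype.sum_prod_type' (fun i j => M.logLikSample θ (h.2 i j)),
      ← Fintype.sum_prod_type' (fun i j => M.logLikSample M.θstar (h.2 i j)), score, sumSq,
      inner_add_left, sum_inner, sum_inner]
    simp only [real_inner_smul_left]
    linarith
  linarith

/-- A quadratic inequality in `√Y`: subadditivity of the square root separates `b`, and Young's
inequality leaves half of `κ * Y` on the left. -/
lemma le_of_mul_le_mul_sqrt {κ q b Y : ℝ} (hκ : 0 < κ) (hq : 0 ≤ q) (hb : 0 ≤ b) (hY : 0 ≤ Y)
    (h : κ * Y ≤ q * √(b ^ 2 + 2 * Y)) : Y ≤ 2 * b * q / κ + 2 * q ^ 2 / κ ^ 2 := by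
  have h1 : √(b ^ 2 + 2 * Y) ≤ b + √(2 * Y) := by
    rw [Real.sqrt_le_left (by positivity)]
    nlinarith [Real.sq_sqrt (show 0 ≤ 2 * Y by linarith), Real.sqrt_nonneg (2 * Y)]
  have h2 : κ * Y ≤ q * b + q * √(2 * Y) := by nlinarith
  have h3 : q * √(2 * Y) ≤ q ^ 2 / κ + κ * Y / 2 := by
    have hs := Real.sq_sqrt (show 0 ≤ 2 * Y by linarith)
    set r := √(2 * Y)
    have : q ^ 2 / κ + κ * Y / 2 - q * r = (q - κ * r / 2) ^ 2 / κ := by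
      have : Y = r ^ 2 / 2 := by linarith
      rw [this]; field_simp; ring
    have : 0 ≤ (q - κ * r / 2) ^ 2 / κ := by positivity
    linarith
  have h4 : κ * Y ≤ 2 * q * b + 2 * (q ^ 2 / κ) := by linarith
  have e : 2 * b * q / κ + 2 * q ^ 2 / κ ^ 2 = (2 * q * b + 2 * (q ^ 2 / κ)) / κ := by
    field_simp
  rw [e, le_div_iff₀ hκ]
  linarith

/-- On the event that the weights are small on the net, the maximum likelihood estimate is
accurate. -/
lemma sumSq_le_of_historyWeight_lt {nOff m t : ℕ} (h : History X A nOff m t)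
    {θ : EuclideanSpace ℝ (Fin d)} (hθ : ‖θ‖ ≤ M.B)
    (hmax : IsMaxOn (M.logLik h) {θ | ‖θ‖ ≤ M.B} θ) {ℓ s : ℝ} (hℓ : 1 ≤ ℓ)
    (hs' : (2 + 4 * (t * m)) * (√d * s) ^ 2 ≤ 1 / 4) (N : Finset (EuclideanSpace ℝ (Fin d)))
    (hN : ∀ u, inducedNorm (gramMatrix 1 1 fun i => M.featureDiff (h.1 i)) u ≤ √ℓ → ∃ u' ∈ N,
      inducedNorm (gramMatrix 1 1 fun i => M.featureDiff (h.1 i)) (u - u') ≤ √d * s)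
    (hw : ∀ u ∈ N, M.historyWeight u h < ENNReal.ofReal (Real.exp ℓ)) :
    M.sumSq h (θ - M.θstar) ≤ 500000 * ℓ / M.gamma ^ 2 := by
  have hr : 1 ≤ √ℓ := Real.one_le_sqrt.2 hℓ
  set D := θ - M.θstar with hD
  have hγ := M.gamma_pos
  have hD2 : ‖D‖ ≤ 2 * M.B := (norm_sub_le _ _).trans (by linarith [M.θstar_norm_le])
  have key := inner_le_of_net (fun i => M.featureDiff (h.1 i))
    (fun p : Fin t × Fin m => M.featureDiff (h.2 p.1 p.2)) (M.score h) N hr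
    (by linarith : 0 ≤ ℓ) (h := √d * s) (fun p => M.norm_featureDiff_le _)
    (by rw [Fintype.card_prod, Fintype.card_fin, Fintype.card_fin]; push_cast; exact hs') hN
    (fun u hu => by
      have := hw u hu
      rw [historyWeight_eq, ENNReal.ofReal_lt_ofReal_iff (Real.exp_pos _), Real.exp_lt_exp] at this
      exact this.le) D
  -- The radius `√ℓ` balances the two terms of the numerator and makes `q` of order `√ℓ`.
  set q := 2 * ((√ℓ + 1 / 2) ^ 2 + ℓ) / √ℓ with hq
  have hq0 : 0 ≤ q := by positivity
  have hq7 : q ≤ 7 * √ℓ := by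
    rw [hq, div_le_iff₀ (by linarith)]
    nlinarith [Real.sq_sqrt (show 0 ≤ ℓ by linarith)]
  have hY0 : 0 ≤ M.sumSq h D := by rw [sumSq]; positivity
  have hbound : inner ℝ (M.score h) D ≤ q * √((2 * M.B) ^ 2 + 2 * M.sumSq h D) := by
    refine key.trans (mul_le_mul_of_nonneg_left (Real.sqrt_le_sqrt ?_) hq0)
    have h1 : ‖D‖ ^ 2 ≤ (2 * M.B) ^ 2 := by gcongr
    have h2 : 0 ≤ ∑ p : Fin t × Fin m, inner ℝ (M.featureDiff (h.2 p.1 p.2)) D ^ 2 := by positivity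
    rw [sumSq]
    linarith
  have hB := M.B_pos
  have h1 := le_of_mul_le_mul_sqrt (show 0 < M.gamma / 64 by positivity) hq0
    (show 0 ≤ 2 * M.B by positivity) hY0 ((M.gamma_mul_sumSq_le h hθ hmax).trans hbound)
  refine h1.trans ?_
  have hsq : √ℓ ^ 2 = ℓ := Real.sq_sqrt (by linarith)
  -- The term that carries `B` comes from `‖D‖ ≤ 2 B`; `γ B ≤ 1` trades it for another factor `1 /
  -- γ`.
  have k1 : 2 * (2 * M.B) * q / (M.gamma / 64) ≤ 2000 * ℓ / M.gamma ^ 2 := by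
    rw [div_le_div_iff₀ (by positivity) (by positivity)]
    have a1 : q ≤ 7 * ℓ := hq7.trans (by nlinarith)
    calc 2 * (2 * M.B) * q * M.gamma ^ 2 = 4 * (M.gamma * M.B) * q * M.gamma := by ring
      _ ≤ 4 * 1 * (7 * ℓ) * M.gamma := by
          have := M.gamma_mul_B_le_one
          gcongr
      _ ≤ 2000 * ℓ * (M.gamma / 64) := by nlinarith [mul_pos (show 0 < ℓ by linarith) hγ]
  have k2 : 2 * q ^ 2 / (M.gamma / 64) ^ 2 ≤ 450000 * ℓ / M.gamma ^ 2 := by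
    have a1 : q ^ 2 ≤ 49 * ℓ := by
      calc q ^ 2 ≤ (7 * √ℓ) ^ 2 := by gcongr
        _ = 49 * ℓ := by rw [mul_pow, hsq]; norm_num
    rw [div_pow M.gamma, div_div_eq_mul_div]
    refine div_le_div_of_nonneg_right ?_ (by positivity)
    linarith
  have k3 : 2000 * ℓ / M.gamma ^ 2 + 450000 * ℓ / M.gamma ^ 2 ≤ 500000 * ℓ / M.gamma ^ 2 := by
    rw [← add_div]
    gcongr
    linarith
  linarith

end KLBandit

namespace GSHFRules

variable {X A : Type*} [MeasurableSpace X] [MeasurableSpace A] {d nOff m : ℕ}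
  (R : GSHFRules X A d nOff m) (M : KLBandit X A d)

/-- Given the past and the new prompts, the comparisons of a batch are independent, and averaging
the label alone already brings each factor to at most `1`. For the offline data too only the labels
are averaged, so the law of the prompts and responses is immaterial. -/
lemma lintegral_historyWeight_le (ρ : Measure (Fin nOff → X × A × A)) [IsProbabilityMeasure ρ]
    (u : EuclideanSpace ℝ (Fin d)) (t : ℕ) : ∫⁻ h, M.historyWeight u h ∂ R.runLaw M ρ t ≤ 1 := by
  induction t with
  | zero =>
    rw [R.lintegral_runLaw_zero M ρ (M.measurable_historyWeight u)]
    calc _ ≤ ∫⁻ _p, 1 ∂ρ := by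
          refine lintegral_mono fun p => ?_
          simp only [KLBandit.historyWeight, Finset.univ_eq_empty, Finset.prod_empty, mul_one]
          exact lintegral_pi_prod_le_one _ (fun _ => M.measurable_expWeight u)
            fun i => M.lintegral_labelledLaw_expWeight_le u _
      _ = 1 := by simp
  | succ t ih =>
    rw [R.lintegral_runLaw_succ M ρ t (M.measurable_historyWeight u)]
    refine le_trans (lintegral_mono fun h => ?_) ih
    have e : ∀ b, M.historyWeight u (h.append b) =
        M.historyWeight u h * ∏ j, M.expWeight u (b j) := fun b => by
      simp only [KLBandit.historyWeight, History.append]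
      rw [Fin.prod_univ_castSucc]
      simp only [Fin.snoc_castSucc, Fin.snoc_last, mul_assoc]
    simp_rw [e]
    have hm : Measurable fun b : Fin m → Sample X A => ∏ j, M.expWeight u (b j) :=
      Finset.measurable_prod _ fun j _ => (M.measurable_expWeight u).comp (measurable_pi_apply j)
    rw [lintegral_const_mul _ hm, R.lintegral_batchLaw_aux M h hm]
    refine mul_le_of_le_one_right' ?_
    calc _ ≤ ∫⁻ _xs, 1 ∂Measure.pi (fun _ : Fin m => M.d0) := by
          refine lintegral_mono fun xs => ?_
          refine lintegral_pi_prod_le_one _ (fun _ => M.measurable_expWeight u) fun j => ?_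
          rw [M.lintegral_gibbsComparison _ _ _ (M.measurable_expWeight u)]
          refine (lintegral_mono fun a => M.lintegral_labelledLaw_expWeight_le u _).trans ?_
          simp
      _ = 1 := by simp

/-- For a deterministic offline design the offline feature differences are constants, so a net built
from them does not depend on the labels. -/
lemma ae_featureDiff_eq (p : Fin nOff → X × A × A) (t : ℕ) :
    ∀ᵐ h ∂ R.runLaw M (Measure.dirac p) t, ∀ i,
      M.featureDiff (h.1 i) = M.φ (p i).1 (p i).2.1 - M.φ (p i).1 (p i).2.2 := by
  rw [ae_all_iff]
  intro i
  set z := M.φ (p i).1 (p i).2.1 - M.φ (p i).1 (p i).2.2 with hz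
  set E : Set (Sample X A) := {s | M.featureDiff s ≠ z} with hE
  have hEm : MeasurableSet E := (M.measurable_featureDiff (measurableSet_singleton z)).compl
  have hf : Measurable (E.indicator (1 : Sample X A → ENNReal)) := measurable_one.indicator hEm
  have hf0 : Measurable fun h : History X A nOff m 0 => E.indicator (1 : Sample X A → ENNReal) (h.1 i) :=
    hf.comp ((measurable_pi_apply i).comp measurable_fst)
  have h0 : ∫⁻ h, E.indicator (1 : Sample X A → ENNReal) (h.1 i)
      ∂ R.runLaw M (Measure.dirac p) 0 = 0 := by
    rw [R.lintegral_runLaw_zero M _ hf0, lintegral_dirac']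
    · have := (measurePreserving_eval (fun i => M.labelledLaw (p i)) i).lintegral_comp hf
      refine this.trans ?_
      rw [M.lintegral_labelledLaw _ hf]
      simp [E, KLBandit.featureDiff, hz]
    · exact (Measure.measurable_lintegral (hf.comp (measurable_pi_apply i))).comp
        M.measurable_pi_labelledLaw
  rw [← R.runLaw_map_take M _ (Nat.zero_le t), lintegral_map hf0 (History.measurable_take _)] at h0
  filter_upwards [(lintegral_eq_zero_iff (hf0.comp (History.measurable_take _))).1 h0] with h hh
  by_contra hne
  have hmem : h.1 i ∈ E := hne
  have : E.indicator (1 : Sample X A → ENNReal) (h.1 i) = 0 := hh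
  rw [Set.indicator_of_mem hmem] at this
  exact one_ne_zero this

lemma measurable_sumSq (t : ℕ) : Measurable fun h : History X A nOff m t =>
    M.sumSq h (R.mle t h - M.θstar) := by
  have hθ : Measurable fun h : History X A nOff m t => R.mle t h - M.θstar :=
    (R.mle_measurable t).sub_const _
  refine Measurable.add (Finset.measurable_sum _ fun i _ => ?_)
    (Finset.measurable_sum _ fun q _ => ?_)
  · exact (Measurable.inner (M.measurable_featureDiff.comp
      ((measurable_pi_apply i).comp measurable_fst)) hθ).pow_const 2
  · exact (Measurable.inner (M.measurable_featureDiff.comp ((measurable_pi_apply q.2).comp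
      ((measurable_pi_apply q.1).comp measurable_snd))) hθ).pow_const 2

/-- The confidence bound for the maximum likelihood estimate. -/
lemma runLaw_sumSq_gt_le (ρ : Measure (Fin nOff → X × A × A)) [IsProbabilityMeasure ρ] (t : ℕ)
    (hmem : ∀ h, ‖R.mle t h‖ ≤ M.B)
    (hmax : ∀ h, IsMaxOn (M.logLik h) {θ | ‖θ‖ ≤ M.B} (R.mle t h)) {ℓ s : ℝ} (hℓ : 1 ≤ ℓ)
    (hs : 0 < s) (hs' : (2 + 4 * (t * m)) * (√d * s) ^ 2 ≤ 1 / 4) {k : ℕ} (hk : √ℓ ≤ k * s) :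
    R.runLaw M ρ t {h | 500000 * ℓ / M.gamma ^ 2 < M.sumSq h (R.mle t h - M.θstar)} ≤
      ENNReal.ofReal ((2 * k + 1) ^ d * Real.exp (-ℓ)) := by
  set E := {h | 500000 * ℓ / M.gamma ^ 2 < M.sumSq h (R.mle t h - M.θstar)} with hE
  have hEm : MeasurableSet E := measurableSet_lt measurable_const (R.measurable_sumSq M t)
  have hp : ∀ p, R.runLaw M (Measure.dirac p) t E ≤
      ENNReal.ofReal ((2 * k + 1) ^ d * Real.exp (-ℓ)) := fun p => by
    -- For fixed `p` the net is deterministic, so Markov's inequality and a union bound apply to its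
    -- points; its cardinality does not involve `nOff`.
    obtain ⟨N, hNcard, hN⟩ := (gramMatrix_posDef one_pos zero_le_one fun i =>
      M.φ (p i).1 (p i).2.1 - M.φ (p i).1 (p i).2.2).exists_net hs hk
    have hsub : E ≤ᵐ[R.runLaw M (Measure.dirac p) t]
        ⋃ u ∈ N, {h | ENNReal.ofReal (Real.exp ℓ) ≤ M.historyWeight u h} := by
      filter_upwards [R.ae_featureDiff_eq M p t] with h hh hhE
      by_contra hcon
      have hcon' : ∀ u ∈ N, M.historyWeight u h < ENNReal.ofReal (Real.exp ℓ) := by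
        intro u hu
        by_contra hlt
        exact hcon (Set.mem_biUnion hu (not_lt.1 hlt))
      refine absurd (M.sumSq_le_of_historyWeight_lt h (hmem h) (hmax h) hℓ hs' N ?_ hcon')
        (not_le.2 hhE)
      simp_rw [hh]
      exact hN
    calc R.runLaw M (Measure.dirac p) t E
        ≤ R.runLaw M (Measure.dirac p) t
            (⋃ u ∈ N, {h | ENNReal.ofReal (Real.exp ℓ) ≤ M.historyWeight u h}) :=
          measure_mono_ae hsub
      _ ≤ ∑ u ∈ N, R.runLaw M (Measure.dirac p) t
            {h | ENNReal.ofReal (Real.exp ℓ) ≤ M.historyWeight u h} :=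
          measure_biUnion_finset_le _ _
      _ ≤ ∑ _u ∈ N, ENNReal.ofReal (Real.exp (-ℓ)) := by
          refine Finset.sum_le_sum fun u _ => ?_
          refine (meas_ge_le_lintegral_div (M.measurable_historyWeight u).aemeasurable
            (by simp [Real.exp_pos]) (by simp)).trans ?_
          rw [Real.exp_neg, ENNReal.ofReal_inv_of_pos (Real.exp_pos _), ← one_div]
          gcongr
          exact R.lintegral_historyWeight_le M _ u t
      _ = ENNReal.ofReal (N.card * Real.exp (-ℓ)) := by
          rw [Finset.sum_const, nsmul_eq_mul, ENNReal.ofReal_mul (by positivity),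
            ENNReal.ofReal_natCast]
      _ ≤ _ := by
          apply ENNReal.ofReal_le_ofReal
          gcongr
          exact_mod_cast hNcard
  rw [← lintegral_indicator_one hEm, R.lintegral_runLaw_eq_dirac M ρ t
    (measurable_one.indicator hEm)]
  simp_rw [lintegral_indicator_one hEm]
  refine (lintegral_mono hp).trans ?_
  simp

end GSHFRules

/-! ### Concentration of the prompts and of the responses -/

lemma measurable_inducedNorm_inv {P : Type*} [MeasurableSpace P] {d : ℕ}
    {S : P → Matrix (Fin d) (Fin d) ℝ} (hS : ∀ i j, Measurable fun p => S p i j)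
    {v : P → EuclideanSpace ℝ (Fin d)} (hv : Measurable v) :
    Measurable fun p => inducedNorm (S p)⁻¹ (v p) := by
  have hdet : ∀ {S : P → Matrix (Fin d) (Fin d) ℝ}, (∀ i j, Measurable fun p => S p i j) →
      Measurable fun p => (S p).det := fun {S} hS => by
    simp_rw [Matrix.det_apply]
    exact Finset.measurable_sum _ fun σ _ =>
      (Finset.measurable_prod _ fun i _ => hS (σ i) i).const_smul _
  have hinv : ∀ i j, Measurable fun p => (S p)⁻¹ i j := fun i j => by
    simp_rw [Matrix.inv_def, Matrix.smul_apply, Ring.inverse_eq_inv', Matrix.adjugate_apply,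
      smul_eq_mul]
    refine (hdet hS).inv.mul (hdet fun k l => ?_)
    simp_rw [Matrix.updateRow_apply]
    split_ifs
    · exact measurable_const
    · exact hS k l
  have hvi : ∀ i, Measurable fun p => (v p).ofLp i := fun i =>
    (EuclideanSpace.proj (𝕜 := ℝ) i).continuous.measurable.comp hv
  refine Measurable.sqrt ?_
  simp only [dotProduct, Matrix.mulVec]
  exact Finset.measurable_sum _ fun i _ => (hvi i).mul
    (Finset.measurable_sum _ fun j _ => (hinv i j).mul (hvi j))

namespace KLBandit

variable {X A : Type*} [MeasurableSpace X] [MeasurableSpace A] {d : ℕ} (M : KLBandit X A d)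

lemma covMatrix_eq_gramMatrix {nOff m t : ℕ} (lam : ℝ) (h : History X A nOff m t) :
    M.covMatrix lam h = gramMatrix lam (1 / (m : ℝ)) fun p : Fin t × Fin m =>
      M.featureDiff (h.2 p.1 p.2) := by
  rw [covMatrix, gramMatrix, Fintype.sum_prod_type]

lemma covMatrix_posDef {nOff m t : ℕ} {lam : ℝ} (hlam : 0 < lam) (h : History X A nOff m t) :
    (M.covMatrix lam h).PosDef := by
  rw [covMatrix_eq_gramMatrix]
  exact gramMatrix_posDef hlam (by positivity) _

lemma inducedNorm_covMatrix_inv_le {nOff m t : ℕ} {lam : ℝ} (hlam : 0 < lam)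
    (h : History X A nOff m t) {v : EuclideanSpace ℝ (Fin d)} (hv : ‖v‖ ≤ 2) :
    inducedNorm (M.covMatrix lam h)⁻¹ v ≤ 2 / √lam := by
  rw [covMatrix_eq_gramMatrix]
  refine (inducedNorm_gramMatrix_inv_le hlam (by positivity) _ v).trans ?_
  gcongr

lemma measurable_inducedNorm_covMatrix_inv {P : Type*} [MeasurableSpace P] {nOff m t : ℕ}
    (lam : ℝ) {h : P → History X A nOff m t} (hh : Measurable h)
    {v : P → EuclideanSpace ℝ (Fin d)} (hv : Measurable v) :
    Measurable fun p => inducedNorm (M.covMatrix lam (h p))⁻¹ (v p) := by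
  refine measurable_inducedNorm_inv (fun k l => ?_) hv
  have hz : ∀ (i : Fin t) (j : Fin m) (k : Fin d), Measurable fun p =>
      (M.featureDiff ((h p).2 i j)).ofLp k := fun i j k =>
    (EuclideanSpace.proj (𝕜 := ℝ) k).continuous.measurable.comp (M.measurable_featureDiff.comp
      ((measurable_pi_apply j).comp ((measurable_pi_apply i).comp (measurable_snd.comp hh))))
  simp only [covMatrix, Matrix.add_apply, Matrix.smul_apply, Matrix.sum_apply,
    Matrix.vecMulVec_apply, smul_eq_mul]
  exact measurable_const.add (measurable_const.mul (Finset.measurable_sum _ fun i _ =>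
    Finset.measurable_sum _ fun j _ => (hz i j k).mul (hz i j l)))

/-- The uncertainty of the policy `π_θ'` relative to `π_θ₁` at the prompt `x`. -/
def promptNorm {nOff m t : ℕ} (lam : ℝ) (h : History X A nOff m t)
    (θ' θ₁ : EuclideanSpace ℝ (Fin d)) (x : X) : ℝ :=
  inducedNorm (M.covMatrix lam h)⁻¹ (M.meanFeature x (M.gibbs θ') - M.meanFeature x (M.gibbs θ₁))

/-- The uncertainty of a comparison. -/
def sampleNorm {nOff m t : ℕ} (lam : ℝ) (h : History X A nOff m t) (s : Sample X A) : ℝ :=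
  inducedNorm (M.covMatrix lam h)⁻¹ (M.featureDiff s)

lemma norm_meanFeature_sub_le (θ' θ₁ : EuclideanSpace ℝ (Fin d)) (x : X) :
    ‖M.meanFeature x (M.gibbs θ') - M.meanFeature x (M.gibbs θ₁)‖ ≤ 2 :=
  (norm_sub_le _ _).trans (by linarith [M.norm_meanFeature_le θ' x, M.norm_meanFeature_le θ₁ x])

lemma measurable_meanFeature_comp {P : Type*} [MeasurableSpace P]
    {θ : P → EuclideanSpace ℝ (Fin d)} {x : P → X} (hθ : Measurable θ) (hx : Measurable x) :
    Measurable fun p => M.meanFeature (x p) (M.gibbs (θ p)) :=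
  M.measurable_meanFeature.comp (g := fun p : EuclideanSpace ℝ (Fin d) × X =>
      M.meanFeature p.2 (M.gibbs p.1)) (f := fun p => (θ p, x p)) (hθ.prodMk hx)

lemma measurable_promptNorm {P : Type*} [MeasurableSpace P] {nOff m t : ℕ}
    (lam : ℝ) {h : P → History X A nOff m t} (hh : Measurable h)
    {θ' θ₁ : P → EuclideanSpace ℝ (Fin d)} (hθ' : Measurable θ') (hθ₁ : Measurable θ₁)
    {x : P → X} (hx : Measurable x) :
    Measurable fun p => M.promptNorm lam (h p) (θ' p) (θ₁ p) (x p) :=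
  M.measurable_inducedNorm_covMatrix_inv lam hh
    ((M.measurable_meanFeature_comp hθ' hx).sub (M.measurable_meanFeature_comp hθ₁ hx))

lemma measurable_sampleNorm {P : Type*} [MeasurableSpace P] {nOff m t : ℕ}
    (lam : ℝ) {h : P → History X A nOff m t} (hh : Measurable h)
    {s : P → Sample X A} (hs : Measurable s) :
    Measurable fun p => M.sampleNorm lam (h p) (s p) :=
  M.measurable_inducedNorm_covMatrix_inv lam hh (M.measurable_featureDiff.comp hs)

/-- The label integrates out, and two independent responses to the prompt `x` remain. -/
lemma integral_featureDiff_gibbsComparison (θ₁ θ₂ : EuclideanSpace ℝ (Fin d)) (x : X) :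
    ∫ s, M.featureDiff s ∂M.gibbsComparison θ₁ θ₂ x =
      M.meanFeature x (M.gibbs θ₁) - M.meanFeature x (M.gibbs θ₂) := by
  have hproj : (M.gibbsComparison θ₁ θ₂ x).map (fun s => (s.2.1, s.2.2.1)) =
      (M.gibbs θ₁ x).prod (M.gibbs θ₂ x) := by
    have hm : Measurable fun s : Sample X A => (s.2.1, s.2.2.1) :=
      (measurable_fst.comp measurable_snd).prodMk
        (measurable_fst.comp (measurable_snd.comp measurable_snd))
    refine Measure.ext_of_lintegral _ fun f hf => ?_
    have hf' : Measurable fun s : Sample X A => f (s.2.1, s.2.2.1) := hf.comp hm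
    rw [lintegral_map hf hm, M.lintegral_gibbsComparison _ _ _ hf']
    refine lintegral_congr fun a => ?_
    rw [M.lintegral_labelledLaw _ hf', ← add_mul, ← ENNReal.ofReal_add (M.prefProb_nonneg _)
      (sub_nonneg.2 (M.prefProb_le_one _))]
    simp
  have hm : Measurable fun s : Sample X A => (s.2.1, s.2.2.1) :=
    (measurable_fst.comp measurable_snd).prodMk
      (measurable_fst.comp (measurable_snd.comp measurable_snd))
  have hφ1 : Measurable fun a : A × A => M.φ x a.1 := (M.measurable_φ x).comp measurable_fst
  have hφ2 : Measurable fun a : A × A => M.φ x a.2 := (M.measurable_φ x).comp measurable_snd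
  have hφ : Measurable fun a : A × A => M.φ x a.1 - M.φ x a.2 := hφ1.sub hφ2
  have hφ' : Measurable fun s : Sample X A => M.φ x s.2.1 - M.φ x s.2.2.1 := hφ.comp hm
  have h1 : ∫ s, M.featureDiff s ∂M.gibbsComparison θ₁ θ₂ x =
      ∫ s, (M.φ x s.2.1 - M.φ x s.2.2.1) ∂M.gibbsComparison θ₁ θ₂ x := by
    rw [← M.gibbsComparison_map θ₁ θ₂ x, integral_map
      (measurable_const.prodMk measurable_snd).aemeasurable
      M.measurable_featureDiff.aestronglyMeasurable, integral_map
      (measurable_const.prodMk measurable_snd).aemeasurable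
      hφ'.aestronglyMeasurable]
    rfl
  have h2 : ∫ s, (M.φ x s.2.1 - M.φ x s.2.2.1) ∂M.gibbsComparison θ₁ θ₂ x =
      ∫ a, (M.φ x a.1 - M.φ x a.2) ∂(M.gibbs θ₁ x).prod (M.gibbs θ₂ x) := by
    rw [← hproj, integral_map hm.aemeasurable hφ.aestronglyMeasurable]
  have i1 : Integrable (fun a : A × A => M.φ x a.1) ((M.gibbs θ₁ x).prod (M.gibbs θ₂ x)) :=
    Integrable.of_bound hφ1.aestronglyMeasurable 1 (ae_of_all _ fun a => M.φ_norm_le x a.1)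
  have i2 : Integrable (fun a : A × A => M.φ x a.2) ((M.gibbs θ₁ x).prod (M.gibbs θ₂ x)) :=
    Integrable.of_bound hφ2.aestronglyMeasurable 1 (ae_of_all _ fun a => M.φ_norm_le x a.2)
  rw [h1, h2, integral_sub i1 i2, integral_fun_fst, integral_fun_snd]
  simp [meanFeature]

/-- The uncertainty of a policy is at most the mean uncertainty of the comparisons. -/
lemma promptNorm_le_integral_sampleNorm {nOff m t : ℕ} {lam : ℝ} (hlam : 0 < lam)
    (h : History X A nOff m t) (θ₁ θ₂ : EuclideanSpace ℝ (Fin d)) (x : X) :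
    M.promptNorm lam h θ₂ θ₁ x ≤ ∫ s, M.sampleNorm lam h s ∂M.gibbsComparison θ₁ θ₂ x := by
  have hint : Integrable M.featureDiff (M.gibbsComparison θ₁ θ₂ x) :=
    Integrable.of_bound M.measurable_featureDiff.aestronglyMeasurable 2
      (ae_of_all _ M.norm_featureDiff_le)
  have := inducedNorm_integral_le (M.gibbsComparison θ₁ θ₂ x) (M.covMatrix_posDef hlam h).inv hint
  rw [integral_featureDiff_gibbsComparison] at this
  refine le_trans (le_of_eq ?_) this
  rw [promptNorm, ← neg_sub, ← neg_one_smul ℝ, inducedNorm_smul]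
  simp

end KLBandit

namespace GSHFRules

variable {X A : Type*} [MeasurableSpace X] [MeasurableSpace A] {d nOff m : ℕ}
  (R : GSHFRules X A d nOff m) (M : KLBandit X A d)

/-- Markov's inequality for a functional of the data and of the next batch. -/
lemma runLaw_batch_ge_le (ρ : Measure (Fin nOff → X × A × A)) [IsProbabilityMeasure ρ] {T : ℕ}
    (t : Fin T) {G : History X A nOff m t × (Fin m → Sample X A) → ENNReal} (hG : Measurable G)
    (h1 : ∀ h, ∫⁻ b, G (h, b) ∂ R.batchLaw M h ≤ 1) {c : ℝ} (hc : 0 < c) :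
    R.runLaw M ρ T {h | ENNReal.ofReal c ≤ G (h.before t, h.2 t)} ≤ ENNReal.ofReal (1 / c) := by
  have hGm : Measurable fun h : History X A nOff m (t + 1) =>
      G (h.take (Nat.le_succ t), h.2 (Fin.last t)) :=
    hG.comp ((History.measurable_take _).prodMk
      ((measurable_pi_apply (Fin.last (t : ℕ))).comp measurable_snd))
  have hint : ∫⁻ h, G (h.before t, h.2 t) ∂ R.runLaw M ρ T ≤ 1 := by
    have e : ∫⁻ h, G (h.before t, h.2 t) ∂ R.runLaw M ρ T =
        ∫⁻ h, G (h.take (Nat.le_succ t), h.2 (Fin.last t)) ∂ R.runLaw M ρ (t + 1) := by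
      rw [← R.runLaw_map_take M ρ (show (t : ℕ) + 1 ≤ T from t.2),
        lintegral_map hGm (History.measurable_take _)]
      rfl
    rw [e, R.lintegral_runLaw_succ M ρ t hGm]
    calc _ ≤ ∫⁻ _h, 1 ∂ R.runLaw M ρ t := by
          refine lintegral_mono fun h => le_trans (le_of_eq ?_) (h1 h)
          refine lintegral_congr fun b => ?_
          rw [h.take_append b]
          simp only [History.append, Fin.snoc_last]
      _ = 1 := by simp
  have hm : Measurable fun h : History X A nOff m T => G (h.before t, h.2 t) :=
    hG.comp ((History.measurable_take t.2.le).prodMk ((measurable_pi_apply t).comp measurable_snd))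
  refine (meas_ge_le_lintegral_div hm.aemeasurable (by simpa using hc) (by simp)).trans ?_
  rw [one_div, ENNReal.ofReal_inv_of_pos hc, ← one_div]
  gcongr

lemma prod_ofReal_exp {ι : Type*} [Fintype ι] (f : ι → ℝ) :
    ∏ i, ENNReal.ofReal (Real.exp (f i)) = ENNReal.ofReal (Real.exp (∑ i, f i)) := by
  rw [← ENNReal.ofReal_prod_of_nonneg fun _ _ => (Real.exp_pos _).le, Real.exp_sum]

/-- Lower-tail bound for a function of the data and of the prompts of the next batch. -/
lemma runLaw_prompts_le (ρ : Measure (Fin nOff → X × A × A)) [IsProbabilityMeasure ρ] {T : ℕ}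
    (t : Fin T) {f : History X A nOff m t → X → ℝ}
    (hf : Measurable fun p : History X A nOff m t × X => f p.1 p.2) (hf0 : ∀ h x, 0 ≤ f h x)
    (hf1 : ∀ h x, f h x ≤ 1) (l : ℝ) :
    R.runLaw M ρ T {h | 2 * ∑ j, f (h.before t) (h.2 t j).1 + 2 * l ≤
      m * ∫ x, f (h.before t) x ∂M.d0} ≤ ENNReal.ofReal (Real.exp (-l)) := by
  have hfi : Measurable fun h => ∫ x, f h x ∂M.d0 :=
    (hf.stronglyMeasurable.integral_prod_right' (ν := M.d0)).measurable
  -- A product of Chernoff factors, of mean at most `1` because the prompts are independent given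
  -- the past. Here `f` may depend on the past but not on the current prompts, which suits a fixed
  -- comparator and not the enhancer.
  let G : History X A nOff m t × (Fin m → Sample X A) → ENNReal := fun p =>
    ∏ j, ENNReal.ofReal (Real.exp ((∫ x, f p.1 x ∂M.d0) / 2 - f p.1 (p.2 j).1))
  have hG : Measurable G := Finset.measurable_prod _ fun j _ =>
    (((hfi.comp measurable_fst).div_const 2).sub (hf.comp (measurable_fst.prodMk
      (measurable_fst.comp ((measurable_pi_apply j).comp measurable_snd))))).exp.ennreal_ofReal
  have hG1 : ∀ h, ∫⁻ b, G (h, b) ∂ R.batchLaw M h ≤ 1 := fun h => by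
    have hfh : Measurable (f h) := hf.comp measurable_prodMk_left
    have hm : Measurable fun x => ENNReal.ofReal (Real.exp ((∫ x, f h x ∂M.d0) / 2 - f h x)) :=
      (measurable_const.sub hfh).exp.ennreal_ofReal
    have hF : Measurable fun p : (Fin m → X) × (Fin m → Sample X A) =>
        ∏ j, ENNReal.ofReal (Real.exp ((∫ x, f h x ∂M.d0) / 2 - f h (p.1 j))) :=
      Finset.measurable_prod _ fun j _ => hm.comp ((measurable_pi_apply j).comp measurable_fst)
    have := R.lintegral_batchLaw M h hF
    refine this.trans_le ?_
    simp only [lintegral_const, measure_univ, mul_one]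
    exact lintegral_pi_prod_le_one _ (fun _ => hm) fun _ =>
      lintegral_exp_half_mean_sub_le M.d0 hfh (hf0 h) (hf1 h)
  have key := R.runLaw_batch_ge_le M ρ t hG hG1 (Real.exp_pos l)
  rw [one_div, ← Real.exp_neg] at key
  refine (measure_mono ?_).trans key
  intro h hh
  simp only [Set.mem_ofPred_eq] at hh ⊢
  simp only [G]
  rw [prod_ofReal_exp]
  refine ENNReal.ofReal_le_ofReal (Real.exp_le_exp.2 ?_)
  rw [Finset.sum_sub_distrib, Finset.sum_const, Finset.card_univ, Fintype.card_fin, nsmul_eq_mul]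
  linarith

lemma measurable_integral_gibbsComparison {t : ℕ} {f : History X A nOff m t → Sample X A → ℝ}
    (hf : Measurable fun p : History X A nOff m t × Sample X A => f p.1 p.2) (j : Fin m) :
    Measurable fun p : History X A nOff m t × (Fin m → X) =>
      ∫ s, f p.1 s ∂M.gibbsComparison (R.mainParam t p.1) (R.enhParam t p.1 p.2) (p.2 j) := by
  have hκ : Measurable fun p : History X A nOff m t × (Fin m → X) =>
      M.gibbsComparison (R.mainParam t p.1) (R.enhParam t p.1 p.2) (p.2 j) :=
    M.measurable_gibbsComparison ((R.mainParam_measurable t).comp measurable_fst)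
      (R.enhParam_measurable t) ((measurable_pi_apply j).comp measurable_snd)
  let κ : Kernel (History X A nOff m t × (Fin m → X)) (Sample X A) := ⟨_, hκ⟩
  have : IsMarkovKernel κ := ⟨fun p => M.isProbabilityMeasure_gibbsComparison _ _ _⟩
  have hfs : StronglyMeasurable fun q : (History X A nOff m t × (Fin m → X)) × Sample X A =>
      f q.1.1 q.2 := (hf.comp ((measurable_fst.comp measurable_fst).prodMk
        measurable_snd)).stronglyMeasurable
  exact (hfs.integral_kernel_prod_right' (κ := κ)).measurable

/-- Lower-tail bound for a function of the data and of the comparisons of the next batch. -/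
lemma runLaw_samples_le (ρ : Measure (Fin nOff → X × A × A)) [IsProbabilityMeasure ρ] {T : ℕ}
    (t : Fin T) {f : History X A nOff m t → Sample X A → ℝ}
    (hf : Measurable fun p : History X A nOff m t × Sample X A => f p.1 p.2)
    (hf0 : ∀ h x, 0 ≤ f h x) (hf1 : ∀ h x, f h x ≤ 1) (l : ℝ) :
    R.runLaw M ρ T {h | 2 * ∑ j, f (h.before t) (h.2 t j) + 2 * l ≤
      ∑ j, ∫ s, f (h.before t) s ∂M.gibbsComparison (R.mainParam t (h.before t))
        (R.enhParam t (h.before t) fun j => (h.2 t j).1) (h.2 t j).1} ≤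
      ENNReal.ofReal (Real.exp (-l)) := by
  -- The enhancer depends on all the prompts of the batch, so the conditioning includes them: for
  -- fixed prompts the comparisons are independent, and `I` collects their conditional means.
  obtain ⟨I, hIdef⟩ : ∃ I : History X A nOff m t × (Fin m → X) → Fin m → ℝ, ∀ p j, I p j =
      ∫ s, f p.1 s ∂M.gibbsComparison (R.mainParam t p.1) (R.enhParam t p.1 p.2) (p.2 j) :=
    ⟨_, fun _ _ => rfl⟩
  have hI : ∀ j, Measurable fun p => I p j := fun j => by
    simp_rw [hIdef]
    exact R.measurable_integral_gibbsComparison M hf j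
  have hF : Measurable fun q : History X A nOff m t × ((Fin m → X) × (Fin m → Sample X A)) =>
      ∏ j, ENNReal.ofReal (Real.exp (I (q.1, q.2.1) j / 2 - f q.1 (q.2.2 j))) := by
    refine Finset.measurable_prod _ fun j _ => ?_
    have h1 : Measurable fun q : History X A nOff m t × ((Fin m → X) × (Fin m → Sample X A)) =>
        I (q.1, q.2.1) j :=
      (hI j).comp (measurable_fst.prodMk (measurable_fst.comp measurable_snd))
    have h2 : Measurable fun q : History X A nOff m t × ((Fin m → X) × (Fin m → Sample X A)) =>
        f q.1 (q.2.2 j) :=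
      hf.comp (measurable_fst.prodMk ((measurable_pi_apply j).comp
        (measurable_snd.comp measurable_snd)))
    exact ((h1.div_const 2).sub h2).exp.ennreal_ofReal
  obtain ⟨F, hFdef⟩ : ∃ F : History X A nOff m t → (Fin m → X) × (Fin m → Sample X A) → ENNReal,
      ∀ h p, F h p = ∏ j, ENNReal.ofReal (Real.exp (I (h, p.1) j / 2 - f h (p.2 j))) :=
    ⟨_, fun _ _ => rfl⟩
  simp_rw [← hFdef] at hF
  have hG : Measurable fun p : History X A nOff m t × (Fin m → Sample X A) =>
      F p.1 (fun j => (p.2 j).1, p.2) :=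
    hF.comp (measurable_fst.prodMk (Measurable.prodMk
      (measurable_pi_lambda _ fun j =>
        measurable_fst.comp ((measurable_pi_apply j).comp measurable_snd)) measurable_snd))
  have hG1 : ∀ h, ∫⁻ b, F h (fun j => (b j).1, b) ∂ R.batchLaw M h ≤ 1 := fun h => by
    have hfh : Measurable (f h) := hf.comp measurable_prodMk_left
    have hFh : Measurable (F h) := hF.comp measurable_prodMk_left
    rw [R.lintegral_batchLaw M h hFh]
    calc _ ≤ ∫⁻ _xs, 1 ∂Measure.pi (fun _ : Fin m => M.d0) := by
          refine lintegral_mono fun xs => ?_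
          simp_rw [hFdef]
          refine lintegral_pi_prod_le_one (fun j =>
              M.gibbsComparison (R.mainParam t h) (R.enhParam t h xs) (xs j))
            (f := fun j s => ENNReal.ofReal (Real.exp (I (h, xs) j / 2 - f h s)))
            (fun j => (measurable_const.sub hfh).exp.ennreal_ofReal) fun j => ?_
          simp_rw [hIdef]
          exact lintegral_exp_half_mean_sub_le _ hfh (hf0 h) (hf1 h)
      _ = 1 := by simp
  have key := R.runLaw_batch_ge_le M ρ t hG hG1 (Real.exp_pos l)
  rw [one_div, ← Real.exp_neg] at key
  refine (measure_mono ?_).trans key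
  intro h hh
  simp only [Set.mem_ofPred_eq] at hh ⊢
  rw [hFdef, prod_ofReal_exp]
  refine ENNReal.ofReal_le_ofReal (Real.exp_le_exp.2 ?_)
  rw [Finset.sum_sub_distrib, ← Finset.sum_div]
  simp_rw [hIdef]
  linarith

/-- The mean uncertainty of a policy over the prompts is controlled by its uncertainty on the
batch. -/
lemma runLaw_promptNorm_le (ρ : Measure (Fin nOff → X × A × A)) [IsProbabilityMeasure ρ] {T : ℕ}
    (t : Fin T) {lam : ℝ} (hlam : 0 < lam) (θ' : EuclideanSpace ℝ (Fin d)) (l : ℝ) :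
    R.runLaw M ρ T {h | 2 * ∑ j, M.promptNorm lam (h.before t) θ' (R.mainParam t (h.before t))
        (h.2 t j).1 + 2 * (2 / √lam) * l ≤
      m * ∫ x, M.promptNorm lam (h.before t) θ' (R.mainParam t (h.before t)) x ∂M.d0} ≤
      ENNReal.ofReal (Real.exp (-l)) := by
  -- Division by the a priori bound `2 / √lam` brings the uncertainties into `[0, 1]`; it comes back
  -- as a factor of the deviation term.
  set r := 2 / √lam with hr
  have hr0 : 0 < r := by positivity
  have hf : Measurable fun p : History X A nOff m t × X =>
      M.promptNorm lam p.1 θ' (R.mainParam t p.1) p.2 / r :=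
    (M.measurable_promptNorm lam measurable_fst measurable_const
      ((R.mainParam_measurable t).comp measurable_fst) measurable_snd).div_const _
  refine (measure_mono ?_).trans (R.runLaw_prompts_le M ρ t
    (f := fun h x => M.promptNorm lam h θ' (R.mainParam t h) x / r) hf
    (fun h x => div_nonneg (inducedNorm_nonneg _ _) hr0.le) (fun h x => (div_le_one hr0).2
      (M.inducedNorm_covMatrix_inv_le hlam h (M.norm_meanFeature_sub_le _ _ x))) l)
  intro h hh
  simp only [Set.mem_ofPred_eq] at hh ⊢
  rw [integral_div, ← Finset.sum_div, ← mul_div_assoc, ← mul_div_assoc, div_add' _ _ _ hr0.ne']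
  refine div_le_div_of_nonneg_right ?_ hr0.le
  linarith

/-- The uncertainty of the enhancer on the batch is controlled by the uncertainty of the collected
comparisons. -/
lemma runLaw_sampleNorm_le (ρ : Measure (Fin nOff → X × A × A)) [IsProbabilityMeasure ρ] {T : ℕ}
    (t : Fin T) {lam : ℝ} (hlam : 0 < lam) (l : ℝ) :
    R.runLaw M ρ T {h | 2 * ∑ j, M.sampleNorm lam (h.before t) (h.2 t j) + 2 * (2 / √lam) * l ≤
      ∑ j, M.promptNorm lam (h.before t)
        (R.enhParam t (h.before t) fun j => (h.2 t j).1) (R.mainParam t (h.before t))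
        (h.2 t j).1} ≤ ENNReal.ofReal (Real.exp (-l)) := by
  set r := 2 / √lam with hr
  have hr0 : 0 < r := by positivity
  have hf : Measurable fun p : History X A nOff m t × Sample X A => M.sampleNorm lam p.1 p.2 / r :=
    (M.measurable_sampleNorm lam measurable_fst measurable_snd).div_const _
  refine (measure_mono ?_).trans (R.runLaw_samples_le M ρ t
    (f := fun h s => M.sampleNorm lam h s / r) hf
    (fun h x => div_nonneg (inducedNorm_nonneg _ _) hr0.le) (fun h s => (div_le_one hr0).2
      (M.inducedNorm_covMatrix_inv_le hlam h (M.norm_featureDiff_le s))) l)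
  intro h hh
  simp only [Set.mem_ofPred_eq] at hh ⊢
  simp only [integral_div]
  rw [← Finset.sum_div, ← Finset.sum_div, ← mul_div_assoc, div_add' _ _ _ hr0.ne']
  refine div_le_div_of_nonneg_right ?_ hr0.le
  refine le_trans (by linarith) (hh.trans (Finset.sum_le_sum fun j _ => ?_))
  exact M.promptNorm_le_integral_sampleNorm hlam _ _ _ _

end GSHFRules

/-! ### The parameters of the algorithm -/

/-- A crude sublinear bound, used only to find numbers that dominate their own logarithms. -/
lemma log_one_add_le_two_mul_sqrt {x : ℝ} (hx : 0 ≤ x) : Real.log (1 + x) ≤ 2 * √x := by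
  have h1 : Real.log (1 + x) = 2 * Real.log √(1 + x) := by
    rw [Real.log_sqrt (by linarith)]; ring
  have h2 := Real.log_le_sub_one_of_pos (Real.sqrt_pos.2 (show 0 < 1 + x by linarith))
  have h3 : √(1 + x) ≤ 1 + √x := by
    rw [Real.sqrt_le_left (by positivity)]
    nlinarith [Real.sq_sqrt hx, Real.sqrt_nonneg x]
  linarith

namespace KLBandit

variable {X A : Type*} [MeasurableSpace X] [MeasurableSpace A] {d : ℕ} (M : KLBandit X A d)
  {c ε δ : ℝ}

lemma le_batchSize (ε : ℝ) : (d : ℝ) / (M.gamma ^ 2 * ε ^ 2) ≤ M.batchSize ε := Nat.le_ceil _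

lemma batchSize_pos (hd : 1 ≤ d) (hε : 0 < ε) : 0 < M.batchSize ε := by
  have := M.gamma_pos
  have : (0 : ℝ) < d := by exact_mod_cast hd
  exact Nat.ceil_pos.2 (by positivity)

lemma batchSize_le (hε : 0 < ε) (h : M.gamma ^ 2 * ε ^ 2 ≤ d) :
    (M.batchSize ε : ℝ) ≤ 2 * (d / (M.gamma ^ 2 * ε ^ 2)) := by
  have hγ := M.gamma_pos
  have h1 : 1 ≤ (d : ℝ) / (M.gamma ^ 2 * ε ^ 2) := (one_le_div (by positivity)).2 h
  have := Nat.ceil_lt_add_one (show 0 ≤ (d : ℝ) / (M.gamma ^ 2 * ε ^ 2) by linarith)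
  rw [batchSize]
  linarith

lemma half_le_log_div {n : ℕ} (hn : 2 ≤ n) (hδ : 0 < δ) (hδ1 : δ < 1) :
    1 / 2 ≤ Real.log (n / δ) := by
  have h1 : (2 : ℝ) ≤ n / δ := by
    rw [le_div_iff₀ hδ]
    have : (2 : ℝ) ≤ n := by exact_mod_cast hn
    nlinarith
  have := Real.log_le_log (by norm_num) h1
  linarith [Real.log_two_gt_d9]

lemma log_div_pos {n : ℕ} (hn : 1 ≤ n) (hδ : 0 < δ) (hδ1 : δ < 1) : 0 < Real.log (n / δ) := by
  apply Real.log_pos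
  rw [lt_div_iff₀ hδ]
  have : (1 : ℝ) ≤ n := by exact_mod_cast hn
  linarith

lemma regParam_pos (hd : 1 ≤ d) (hc : 0 < c) (hε : 0 < ε) (hδ : 0 < δ) (hδ1 : δ < 1) {n : ℕ}
    (hn : 1 ≤ n) : 0 < M.regParam c ε δ n := by
  have := M.gamma_pos
  have := M.B_pos
  have : (0 : ℝ) < M.batchSize ε := by exact_mod_cast M.batchSize_pos hd hε
  have : (0 : ℝ) < d := by exact_mod_cast hd
  have := log_div_pos hn hδ hδ1
  rw [regParam]
  positivity

/-- For `n ≥ 2` the regularization stays above a constant independent of `n`, because `log (n / δ) ≥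
1/2`; the condition then follows from `d log (1 + a n) ≤ n`, true for large `n`. Without
nonemptiness the infimum would be the default value `0`. -/
lemma numIter_set_nonempty (hd : 1 ≤ d) (hc : 0 < c) (hε : 0 < ε) (hδ : 0 < δ) (hδ1 : δ < 1) :
    {n : ℕ | 1 ≤ n ∧ d * Real.log (1 + 4 * n / (d * M.regParam c ε δ n)) ≤ n}.Nonempty := by
  have hγ := M.gamma_pos
  have hB := M.B_pos
  have hm : (0 : ℝ) < M.batchSize ε := by exact_mod_cast M.batchSize_pos hd hε
  have hd0 : (0 : ℝ) < d := by exact_mod_cast hd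
  set b := c * (d * (1 / 2) / (M.batchSize ε * M.gamma ^ 2 * M.B ^ 2)) with hb
  have hb0 : 0 < b := by positivity
  set a := 4 / (d * b) with ha
  have ha0 : 0 < a := by positivity
  obtain ⟨n, hn⟩ := exists_nat_ge (4 * d ^ 2 * a + 2)
  have hn2 : 2 ≤ n := by
    have : (2 : ℝ) ≤ n := by
      have : 0 ≤ 4 * (d : ℝ) ^ 2 * a := by positivity
      linarith
    exact_mod_cast this
  refine ⟨n, by omega, ?_⟩
  have hn0 : (0 : ℝ) < n := by positivity
  have hlam : b ≤ M.regParam c ε δ n := by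
    rw [hb, regParam]
    have := half_le_log_div hn2 hδ hδ1
    gcongr
  have h1 : 4 * n / (d * M.regParam c ε δ n) ≤ a * n := by
    rw [ha, div_mul_eq_mul_div]
    gcongr
  have hreg : 0 < M.regParam c ε δ n := hb0.trans_le hlam
  calc (d : ℝ) * Real.log (1 + 4 * n / (d * M.regParam c ε δ n))
      ≤ d * Real.log (1 + a * n) := by gcongr
    _ ≤ d * (2 * √(a * n)) := by gcongr; exact log_one_add_le_two_mul_sqrt (by positivity)
    _ = √(4 * d ^ 2 * (a * n)) := by
        rw [show 4 * (d : ℝ) ^ 2 = (2 * d) ^ 2 by ring, Real.sqrt_mul (by positivity) (a * n),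
          Real.sqrt_sq (by positivity)]
        ring
    _ ≤ n := by
        rw [Real.sqrt_le_left hn0.le]
        nlinarith

lemma one_le_numIter (hd : 1 ≤ d) (hc : 0 < c) (hε : 0 < ε) (hδ : 0 < δ) (hδ1 : δ < 1) :
    1 ≤ M.numIter c ε δ := (Nat.sInf_mem (M.numIter_set_nonempty hd hc hε hδ hδ1)).1

lemma mul_log_le_numIter (hd : 1 ≤ d) (hc : 0 < c) (hε : 0 < ε) (hδ : 0 < δ) (hδ1 : δ < 1) :
    d * Real.log (1 + 4 * M.numIter c ε δ / (d * M.regParam c ε δ (M.numIter c ε δ))) ≤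
      M.numIter c ε δ := (Nat.sInf_mem (M.numIter_set_nonempty hd hc hε hδ hδ1)).2

/-- The constant in the bound for the number of iterations. -/
def _root_.iterConst (c : ℝ) : ℝ := (3 + 4 * √(32 / c)) ^ 2

lemma _root_.nine_le_iterConst (c : ℝ) : 9 ≤ iterConst c := by
  rw [iterConst]
  nlinarith [Real.sqrt_nonneg (32 / c)]

/-- With `K = iterConst c`, one has `K = √K (3 + 4 √(32 / c))`, whose first part is at least `3` and
whose second part is twice the square-root bound for the logarithm. -/
lemma _root_.iterConst_ge {c : ℝ} (hc : 0 < c) :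
    3 + 2 * Real.log (1 + 32 * iterConst c / c) ≤ iterConst c := by
  have hK := nine_le_iterConst c
  have h1 := log_one_add_le_two_mul_sqrt (show 0 ≤ 32 * iterConst c / c by positivity)
  have h2 : √(32 * iterConst c / c) = √(32 / c) * (3 + 4 * √(32 / c)) := by
    rw [mul_div_right_comm, Real.sqrt_mul (by positivity), iterConst, Real.sqrt_sq (by positivity)]
  rw [h2] at h1
  have h3 : iterConst c = (3 + 4 * √(32 / c)) ^ 2 := rfl
  nlinarith [Real.sqrt_nonneg (32 / c)]

lemma exp_logFactor (hε : 0 < ε) (hδ : 0 < δ) :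
    Real.exp (M.logFactor ε δ) = 2 + d / (M.gamma * ε * δ) := by
  have := M.gamma_pos
  exact Real.exp_log (by positivity)

lemma half_le_logFactor (hε : 0 < ε) (hδ : 0 < δ) : 1 / 2 ≤ M.logFactor ε δ := by
  have := M.gamma_pos
  have h1 : Real.log 2 ≤ M.logFactor ε δ := by
    apply Real.log_le_log (by norm_num)
    have : 0 ≤ (d : ℝ) / (M.gamma * ε * δ) := by positivity
    linarith
  linarith [Real.log_two_gt_d9]

lemma logFactor_le_exp (ε δ : ℝ) : M.logFactor ε δ ≤ Real.exp (M.logFactor ε δ) := by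
  linarith [Real.add_one_le_exp (M.logFactor ε δ)]

lemma inv_le_exp_logFactor (hd : 1 ≤ d) (hε : 0 < ε) (hδ : 0 < δ) (hδ1 : δ < 1) :
    1 / (M.gamma * ε) ≤ Real.exp (M.logFactor ε δ) := by
  have hγ := M.gamma_pos
  rw [M.exp_logFactor hε hδ]
  have hd0 : (1 : ℝ) ≤ d := by exact_mod_cast hd
  have h1 : 1 / (M.gamma * ε) ≤ d / (M.gamma * ε * δ) := by
    rw [div_le_div_iff₀ (by positivity) (by positivity)]
    have : 0 < M.gamma * ε := by positivity
    nlinarith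
  linarith

/-- It suffices that `⌈K d L⌉` satisfies the defining condition. Since `γ ε ≥ exp (-L)`, the
argument of the logarithm is there polynomial in `exp L`, and `iterConst` is made so that its
logarithm is at most `K L`. -/
lemma numIter_le (hd : 1 ≤ d) (hc : 0 < c) (hε : 0 < ε) (hδ : 0 < δ) (hδ1 : δ < 1)
    (h : M.gamma ^ 2 * ε ^ 2 ≤ d) :
    (M.numIter c ε δ : ℝ) ≤ 2 * iterConst c * (d * M.logFactor ε δ) := by
  have hγ := M.gamma_pos
  have hB := M.B_pos
  have hm : (0 : ℝ) < M.batchSize ε := by exact_mod_cast M.batchSize_pos hd hε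
  have hd1 : (1 : ℝ) ≤ d := by exact_mod_cast hd
  set L := M.logFactor ε δ with hL
  set K := iterConst c with hK
  have hL2 : 1 / 2 ≤ L := M.half_le_logFactor hε hδ
  have hK9 : 9 ≤ K := nine_le_iterConst c
  have hdL : 1 / 2 ≤ d * L := by nlinarith
  have hKdL : 4 ≤ K * (d * L) := by nlinarith
  set n := ⌈K * (d * L)⌉₊ with hn
  have hn1 : K * (d * L) ≤ n := Nat.le_ceil _
  have hn2 : (n : ℝ) ≤ 2 * K * (d * L) := by
    have := Nat.ceil_lt_add_one (show 0 ≤ K * (d * L) by linarith)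
    linarith
  have hn3 : 2 ≤ n := by
    have : (2 : ℝ) ≤ n := by linarith
    exact_mod_cast this
  refine le_trans ?_ hn2
  have hmem : n ∈ {n : ℕ | 1 ≤ n ∧ d * Real.log (1 + 4 * n / (d * M.regParam c ε δ n)) ≤ n} := by
    refine ⟨by omega, le_trans ?_ hn1⟩
    -- In `1/4`, one half is the lower bound for `log (n / δ)` and the other is the price of
    -- rounding the batch size up; `γ B ≤ 1` removes `B`.
    have hlam : c * (M.gamma * ε) ^ 2 / 4 ≤ M.regParam c ε δ n := by
      have h1 := half_le_log_div hn3 hδ hδ1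
      have h2 := M.batchSize_le hε h
      have h3 : (M.gamma * M.B) ^ 2 ≤ 1 := by
        have := M.gamma_mul_B_le_one
        have : 0 ≤ M.gamma * M.B := by positivity
        nlinarith
      rw [regParam, mul_div_assoc]
      refine mul_le_mul_of_nonneg_left ?_ hc.le
      calc (M.gamma * ε) ^ 2 / 4
          = d * (1 / 2) / (2 * (d / (M.gamma ^ 2 * ε ^ 2)) * 1) := by field_simp; ring
        _ ≤ d * Real.log (n / δ) / (M.batchSize ε * (M.gamma * M.B) ^ 2) := by gcongr
        _ = _ := by ring_nf
    have hreg : 0 < c * (M.gamma * ε) ^ 2 / 4 := by positivity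
    have hE := M.inv_le_exp_logFactor hd hε hδ hδ1
    rw [← hL] at hE
    have hLE : L ≤ Real.exp L := M.logFactor_le_exp ε δ
    have hbound : 4 * n / (d * M.regParam c ε δ n) ≤ 32 * K / c * Real.exp (3 * L) := by
      calc 4 * n / (d * M.regParam c ε δ n)
          ≤ 4 * (2 * K * (d * L)) / (d * (c * (M.gamma * ε) ^ 2 / 4)) := by gcongr
        _ = 32 * K / c * (L * (1 / (M.gamma * ε)) ^ 2) := by field_simp; ring
        _ ≤ 32 * K / c * (Real.exp L * (Real.exp L) ^ 2) := by gcongr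
        _ = _ := by rw [← Real.exp_nat_mul, ← Real.exp_add]; congr 2; push_cast; ring
    have hlog : Real.log (1 + 4 * n / (d * M.regParam c ε δ n)) ≤ K * L := by
      have hpos : 0 ≤ 4 * n / (d * M.regParam c ε δ n) := by
        have := hreg.trans_le hlam
        positivity
      calc Real.log (1 + 4 * n / (d * M.regParam c ε δ n))
          ≤ Real.log ((1 + 32 * K / c) * Real.exp (3 * L)) := by
            refine Real.log_le_log (by linarith) ?_
            have : 1 ≤ Real.exp (3 * L) := Real.one_le_exp (by linarith)
            linarith
        _ = Real.log (1 + 32 * K / c) + 3 * L := by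
            rw [Real.log_mul (by positivity) (Real.exp_pos _).ne', Real.log_exp]
        _ ≤ K * L := by
            have h1 : 3 + 2 * Real.log (1 + 32 * K / c) ≤ K := iterConst_ge hc
            have h2 : 0 ≤ Real.log (1 + 32 * K / c) := Real.log_nonneg (by
              have : 0 ≤ 32 * K / c := by positivity
              linarith)
            nlinarith
    calc (d : ℝ) * Real.log (1 + 4 * n / (d * M.regParam c ε δ n)) ≤ d * (K * L) := by gcongr
      _ = K * (d * L) := by ring
  have hle : M.numIter c ε δ ≤ n := Nat.sInf_le hmem
  exact_mod_cast hle

/-- The bound for the number of samples. -/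
lemma batchSize_mul_numIter_le (hd : 1 ≤ d) (hc : 0 < c) (hε : 0 < ε) (hδ : 0 < δ) (hδ1 : δ < 1)
    (h : M.gamma ^ 2 * ε ^ 2 ≤ d) :
    (M.batchSize ε : ℝ) * M.numIter c ε δ ≤
      4 * iterConst c * (d ^ 2 / (M.gamma ^ 2 * ε ^ 2)) * M.logFactor ε δ := by
  have h1 := M.batchSize_le hε h
  have h2 := M.numIter_le hd hc hε hδ hδ1 h
  have hγ := M.gamma_pos
  calc _ ≤ 2 * (d / (M.gamma ^ 2 * ε ^ 2)) * (2 * iterConst c * (d * M.logFactor ε δ)) := by gcongr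
    _ = _ := by ring

lemma le_exp_logFactor (hγε : M.gamma * ε ≤ 1) (hε : 0 < ε) (hδ : 0 < δ) :
    (d : ℝ) / δ ≤ Real.exp (M.logFactor ε δ) := by
  have hγ := M.gamma_pos
  rw [M.exp_logFactor hε hδ]
  have : (d : ℝ) / δ ≤ d / (M.gamma * ε * δ) := by
    gcongr
    nlinarith
  linarith

lemma log_numIter_div_le (hd : 1 ≤ d) (hc : 0 < c) (hε : 0 < ε) (hδ : 0 < δ) (hδ1 : δ < 1)
    (hγε : M.gamma * ε ≤ 1) :
    Real.log (M.numIter c ε δ / δ) ≤ (4 * iterConst c + 2) * M.logFactor ε δ := by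
  have hγ := M.gamma_pos
  have hd1 : (1 : ℝ) ≤ d := by exact_mod_cast hd
  have hγε' : M.gamma ^ 2 * ε ^ 2 ≤ d := by
    rw [← mul_pow]
    have : 0 < M.gamma * ε := by positivity
    nlinarith
  have h1 := M.numIter_le hd hc hε hδ hδ1 hγε'
  have h2 := M.le_exp_logFactor hγε hε hδ
  have h3 := M.logFactor_le_exp ε δ
  have h4 := M.half_le_logFactor hε hδ
  have hT : (1 : ℝ) ≤ M.numIter c ε δ := by exact_mod_cast M.one_le_numIter hd hc hε hδ hδ1
  set L := M.logFactor ε δ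
  set K := iterConst c with hK
  have hK9 : 9 ≤ K := nine_le_iterConst c
  have h5 : M.numIter c ε δ / δ ≤ 2 * K * Real.exp (2 * L) := by
    calc M.numIter c ε δ / δ ≤ 2 * K * (d * L) / δ := by gcongr
      _ = 2 * K * (d / δ * L) := by ring
      _ ≤ 2 * K * (Real.exp L * Real.exp L) := by gcongr
      _ = _ := by rw [← Real.exp_add]; ring_nf
  have h6 := Real.log_le_log (by positivity) h5
  rw [Real.log_mul (by positivity) (Real.exp_pos _).ne', Real.log_exp] at h6
  have h7 := Real.log_le_sub_one_of_pos (show 0 < 2 * K by linarith)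
  nlinarith

/-- The bonus must not degenerate. This is clear for `T ≥ 2`. For `T = 1` and `δ` near `1` the
logarithm could be tiny, but then the condition defining `T` forces `λ₁ ≥ 2`, whereas `λ₁ ≤ c log (1
/ δ)` as soon as `ε ≤ B`. -/
lemma log_numIter_div_ge (hd : 1 ≤ d) (hc : 0 < c) (hε : 0 < ε) (hδ : 0 < δ) (hδ1 : δ < 1)
    (hεB : ε ≤ M.B) :
    min (1 / 2) (2 / c) ≤ Real.log (M.numIter c ε δ / δ) := by
  have hγ := M.gamma_pos
  have hB := M.B_pos
  have hd1 : (1 : ℝ) ≤ d := by exact_mod_cast hd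
  rcases (M.one_le_numIter hd hc hε hδ hδ1).eq_or_lt with hT | hT
  · refine (min_le_right _ _).trans ?_
    have h1 := M.mul_log_le_numIter hd hc hε hδ hδ1
    rw [← hT] at h1 ⊢
    have hm : (0 : ℝ) < M.batchSize ε := by exact_mod_cast M.batchSize_pos hd hε
    have hl := log_div_pos (n := 1) le_rfl hδ hδ1
    set l := Real.log ((1 : ℕ) / δ) with hl'
    have hlam0 := M.regParam_pos (n := 1) hd hc hε hδ hδ1 le_rfl
    set lam := M.regParam c ε δ 1 with hlam
    have hlam_le : lam ≤ c * l := by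
      rw [hlam, regParam]
      refine mul_le_mul_of_nonneg_left ?_ hc.le
      rw [div_le_iff₀ (by positivity), ← hl', mul_comm]
      refine mul_le_mul_of_nonneg_left ?_ hl.le
      have h2 := M.le_batchSize ε
      rw [div_le_iff₀ (by positivity)] at h2
      refine h2.trans ?_
      rw [mul_assoc]
      gcongr
    -- From `4 / (d lam) ≤ exp (1 / d) - 1 ≤ 2 / d`.
    have hlam2 : 2 ≤ lam := by
      have h2 : Real.log (1 + 4 * (1 : ℕ) / (d * lam)) ≤ 1 / d := by
        rw [le_div_iff₀ (by linarith), mul_comm]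
        exact_mod_cast h1
      rw [Real.log_le_iff_le_exp (by positivity)] at h2
      have h3 : Real.exp (1 / d) - 1 ≤ 2 * (1 / d) := by
        have hle : |(1 : ℝ) / d| ≤ 1 := by
          rw [abs_of_nonneg (by positivity)]
          exact (div_le_one (by linarith)).2 hd1
        have := Real.abs_exp_sub_one_le hle
        rw [abs_of_nonneg (show (0 : ℝ) ≤ 1 / d by positivity)] at this
        exact (le_abs_self _).trans this
      have h4 : 4 / (d * lam) ≤ 2 * (1 / d) := by push_cast at h2; linarith
      rw [mul_one_div, div_le_div_iff₀ (by positivity) (by linarith)] at h4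
      nlinarith
    rw [div_le_iff₀ hc]
    linarith
  · exact (min_le_left _ _).trans (half_le_log_div hT hδ hδ1)

/-- The constant in the confidence radius of the maximum likelihood estimate. -/
def _root_.netConst (c : ℝ) : ℝ := 8 + (4 * iterConst c + 2) + 8 * √(2 + 16 * iterConst c)

lemma _root_.eight_le_netConst (c : ℝ) : 8 ≤ netConst c := by
  have := nine_le_iterConst c
  have := Real.sqrt_nonneg (2 + 16 * iterConst c)
  rw [netConst]
  linarith

/-- The confidence level `y² d L` also sets the radius of the net, so the bound for the
log-cardinality contains a term linear in `y`; the square has to dominate it. -/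
lemma _root_.add_le_sq_netConst (c : ℝ) :
    8 + 8 * (netConst c * √(2 + 16 * iterConst c)) + (4 * iterConst c + 2) ≤ netConst c ^ 2 := by
  have hK := nine_le_iterConst c
  have h8 := eight_le_netConst c
  have e : netConst c ^ 2 = netConst c * (8 + (4 * iterConst c + 2)) +
      8 * (netConst c * √(2 + 16 * iterConst c)) := by
    nth_rw 1 [sq, netConst]
    rw [netConst]
    ring
  have h := le_mul_of_one_le_left (show 0 ≤ 8 + (4 * iterConst c + 2) by linarith)
    (show 1 ≤ netConst c by linarith)
  linarith

/-- The parameters of the net in the confidence bound. -/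
lemma exists_net_parameters (hd : 1 ≤ d) (hc : 0 < c) (hε : 0 < ε) (hδ : 0 < δ) (hδ1 : δ < 1)
    (hγε : M.gamma * ε ≤ 1) :
    ∃ (s : ℝ) (k : ℕ), 0 < s ∧
      (∀ t ≤ M.numIter c ε δ, (2 + 4 * ((t : ℝ) * M.batchSize ε)) * (√d * s) ^ 2 ≤ 1 / 4) ∧
      √(netConst c ^ 2 * (d * M.logFactor ε δ)) ≤ k * s ∧
      (2 * k + 1 : ℝ) ^ d * Real.exp (-(netConst c ^ 2 * (d * M.logFactor ε δ))) ≤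
        Real.exp (-Real.log (M.numIter c ε δ / δ)) := by
  have hγ := M.gamma_pos
  have hd1 : (1 : ℝ) ≤ d := by exact_mod_cast hd
  have hγε' : M.gamma ^ 2 * ε ^ 2 ≤ d := by
    rw [← mul_pow]
    have : 0 < M.gamma * ε := by positivity
    nlinarith
  have hT := M.numIter_le hd hc hε hδ hδ1 hγε'
  have hm := M.batchSize_le hε hγε'
  have hl := M.log_numIter_div_le hd hc hε hδ hδ1 hγε
  have hdE : (d : ℝ) ≤ Real.exp (M.logFactor ε δ) := by
    refine le_trans ?_ (M.le_exp_logFactor hγε hε hδ)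
    rw [le_div_iff₀ hδ]
    nlinarith
  have hiE := M.inv_le_exp_logFactor hd hε hδ hδ1
  have hLE := M.logFactor_le_exp ε δ
  have hL := M.half_le_logFactor hε hδ
  have hK := nine_le_iterConst c
  have hy8 := eight_le_netConst c
  set L := M.logFactor ε δ
  set E := Real.exp L with hE
  set T := M.numIter c ε δ
  set m := M.batchSize ε
  set y := netConst c with hy
  set a := 2 + 16 * iterConst c with ha
  have hE1 : 1 ≤ E := Real.one_le_exp (by linarith)
  -- The number of samples is polynomial in `exp L`; hence so is the number of grid points per
  -- coordinate, and its logarithm is of order `L`.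
  have hTm : 2 + 4 * ((T : ℝ) * m) ≤ a * E ^ 5 := by
    have h1 : (T : ℝ) * m ≤ 4 * iterConst c * E ^ 5 := by
      calc (T : ℝ) * m ≤ (2 * iterConst c * (d * L)) * (2 * (d / (M.gamma ^ 2 * ε ^ 2))) := by
            gcongr
        _ = 4 * iterConst c * (d * L * d * (1 / (M.gamma * ε)) ^ 2) := by field_simp; ring
        _ ≤ 4 * iterConst c * (E * E * E * E ^ 2) := by gcongr
        _ = _ := by ring
    have h2 : 1 ≤ E ^ 5 := one_le_pow₀ hE1
    rw [ha]
    nlinarith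
  have hTm0 : 0 < 2 + 4 * ((T : ℝ) * m) := by positivity
  set r := √(d * (2 + 4 * ((T : ℝ) * m))) with hr
  have hr0 : 0 < r := Real.sqrt_pos.2 (by positivity)
  have hrsq : r ^ 2 = d * (2 + 4 * ((T : ℝ) * m)) := Real.sq_sqrt (by positivity)
  set q := √(y ^ 2 * (d * L)) with hq
  have hq0 : 0 ≤ q := Real.sqrt_nonneg _
  -- The mesh is chosen to give `(2 + 4 T m) d s² = 1/4`, and the grid then needs `q / s` steps to
  -- reach the radius `q`.
  refine ⟨1 / (2 * r), ⌈q * (2 * r)⌉₊, by positivity, fun t ht => ?_, ?_, ?_⟩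
  · rw [mul_pow, Real.sq_sqrt (by positivity), div_pow, mul_pow, hrsq]
    have ht' : (t : ℝ) ≤ T := by exact_mod_cast ht
    calc (2 + 4 * ((t : ℝ) * m)) * (d * (1 ^ 2 / (2 ^ 2 * (d * (2 + 4 * (T * m))))))
        ≤ (2 + 4 * ((T : ℝ) * m)) * (d * (1 ^ 2 / (2 ^ 2 * (d * (2 + 4 * (T * m)))))) := by gcongr
      _ = 1 / 4 := by field_simp; norm_num
  · rw [mul_one_div, le_div_iff₀ (by positivity)]
    exact Nat.le_ceil _
  · set k := ⌈q * (2 * r)⌉₊ with hk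
    have hk1 : (k : ℝ) ≤ q * (2 * r) + 1 := (Nat.ceil_lt_add_one (by positivity)).le
    have hqr : q * r ≤ y * √a * E ^ 4 := by
      rw [hq, hr, ← Real.sqrt_mul (by positivity)]
      rw [Real.sqrt_le_left (by positivity), mul_pow, mul_pow, Real.sq_sqrt (by positivity)]
      calc y ^ 2 * (d * L) * (d * (2 + 4 * ((T : ℝ) * m))) ≤
            y ^ 2 * (E * E) * (E * (a * E ^ 5)) := by gcongr
        _ = y ^ 2 * a * (E ^ 4) ^ 2 := by ring
    have hk2 : 2 * (k : ℝ) + 1 ≤ (4 * (y * √a) + 3) * E ^ 4 := by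
      have : 1 ≤ E ^ 4 := one_le_pow₀ hE1
      nlinarith
    have hya : 0 ≤ y * √a := by positivity
    have hlog : Real.log (2 * k + 1) ≤ 4 * L + (4 * (y * √a) + 2) := by
      refine (Real.log_le_log (by positivity) hk2).trans ?_
      rw [Real.log_mul (by positivity) (by positivity), hE, ← Real.exp_nat_mul, Real.log_exp]
      have := Real.log_le_sub_one_of_pos (show 0 < 4 * (y * √a) + 3 by positivity)
      push_cast
      linarith
    have e : (2 * (k : ℝ) + 1) ^ d = Real.exp (d * Real.log (2 * k + 1)) := by
      rw [Real.exp_nat_mul, Real.exp_log (by positivity)]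
    rw [e, ← Real.exp_add]
    refine Real.exp_le_exp.2 ?_
    have h1 : Real.log (2 * k + 1) + (4 * iterConst c + 2) * L ≤ y ^ 2 * L := by
      have h2 : y * √a ≤ 2 * (y * √a) * L := by
        have := mul_le_mul_of_nonneg_left hL (show 0 ≤ 2 * (y * √a) by positivity)
        linarith
      have h3 := mul_le_mul_of_nonneg_right (add_le_sq_netConst c) (show 0 ≤ L by linarith)
      rw [← hy, ← ha] at h3
      linarith
    have h4 : d * (Real.log (2 * k + 1) + (4 * iterConst c + 2) * L) ≤ d * (y ^ 2 * L) := by gcongr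
    have h5 : (4 * iterConst c + 2) * L ≤ d * ((4 * iterConst c + 2) * L) :=
      le_mul_of_one_le_left (by positivity) hd1
    linarith

end KLBandit

/-! ### The gap of the best iterate -/

namespace KLBandit

variable {X A : Type*} [MeasurableSpace X] [MeasurableSpace A] {d : ℕ} (M : KLBandit X A d)

/-- In some iteration the new comparisons have bounded uncertainty on average. -/
lemma exists_sum_sampleNorm_le (hd : 1 ≤ d) {nOff m T : ℕ} (hm : 1 ≤ m) (hT : 1 ≤ T) {lam : ℝ}
    (hlam : 0 < lam) (hTd : d * Real.log (1 + 4 * T / (d * lam)) ≤ T)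
    (h : History X A nOff m T) :
    ∃ t : Fin T, ∑ j, M.sampleNorm lam (h.before t) (h.2 t j) ≤ 2 * m := by
  have hm0 : (0 : ℝ) < m := by exact_mod_cast hm
  -- Extension by zero beyond `T` gives the infinite sequence of batches expected by
  -- `sum_log_one_add_le`.
  obtain ⟨z, hz⟩ : ∃ z : ℕ → Fin m → EuclideanSpace ℝ (Fin d), ∀ i j, z i j =
      if hi : i < T then M.featureDiff (h.2 ⟨i, hi⟩ j) else 0 := ⟨_, fun _ _ => rfl⟩
  have hz2 : ∀ i j, ‖z i j‖ ≤ 2 := fun i j => by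
    rw [hz]
    split_ifs
    · exact M.norm_featureDiff_le _
    · simp
  have hzt : ∀ (t : Fin T) j, z t j = M.featureDiff (h.2 t j) := fun t j => by
    rw [hz, dif_pos t.2]
  obtain ⟨S, hS⟩ : ∃ S : ℕ → Matrix (Fin d) (Fin d) ℝ, ∀ t, S t =
      gramMatrix lam (1 / (m : ℝ)) fun p : Fin t × Fin m => z p.1 p.2 := ⟨_, fun _ => rfl⟩
  have hSt : ∀ t : Fin T, S t = M.covMatrix lam (h.before t) := fun t => by
    rw [hS, covMatrix_eq_gramMatrix]
    congr 1
    funext p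
    exact hzt (Fin.castLE t.2.le p.1) p.2
  have hsum := (sum_log_one_add_le hd hm hlam z hz2 S hS T).trans hTd
  rw [Finset.sum_range] at hsum
  have : Nonempty (Fin T) := ⟨⟨0, hT⟩⟩
  -- Pigeonhole: `T` logarithms with sum at most `T`, so one of them is at most `1`, and the mean
  -- square in it is at most `e - 1 < 2`.
  obtain ⟨t, -, ht⟩ := Finset.exists_le_of_sum_le (s := Finset.univ) (g := fun _ : Fin T => (1 : ℝ))
    Finset.univ_nonempty (hsum.trans (by simp))
  refine ⟨t, ?_⟩
  have hW : 1 / (m : ℝ) * ∑ j, M.sampleNorm lam (h.before t) (h.2 t j) ^ 2 ≤ 2 := by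
    have h0 : 0 ≤ 1 / (m : ℝ) * ∑ j, M.sampleNorm lam (h.before t) (h.2 t j) ^ 2 := by positivity
    simp only [hSt, hzt] at ht
    change Real.log (1 + 1 / (m : ℝ) * ∑ j, M.sampleNorm lam (h.before t) (h.2 t j) ^ 2) ≤ 1 at ht
    rw [Real.log_le_iff_le_exp (by linarith)] at ht
    linarith [Real.exp_one_lt_d9]
  rw [one_div_mul_eq_div, div_le_iff₀ hm0] at hW
  have hcs := sq_sum_le_card_mul_sum_sq (s := Finset.univ)
    (f := fun j => M.sampleNorm lam (h.before t) (h.2 t j))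
  rw [Finset.card_univ, Fintype.card_fin] at hcs
  refine le_of_sq_le_sq (hcs.trans ?_) (by positivity)
  nlinarith

lemma integrable_promptNorm {nOff m t : ℕ} {lam : ℝ} (hlam : 0 < lam) (h : History X A nOff m t)
    (θ' θ₁ : EuclideanSpace ℝ (Fin d)) : Integrable (M.promptNorm lam h θ' θ₁) M.d0 := by
  have := M.d0_prob
  have hmeas : Measurable fun x => M.promptNorm lam h θ' θ₁ x :=
    M.measurable_promptNorm lam measurable_const measurable_const measurable_const measurable_id
  refine Integrable.of_bound hmeas.aestronglyMeasurable (2 / √lam) (ae_of_all _ fun x => ?_)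
  rw [promptNorm, Real.norm_of_nonneg (inducedNorm_nonneg _ _)]
  exact M.inducedNorm_covMatrix_inv_le hlam h (M.norm_meanFeature_sub_le θ' θ₁ x)

lemma integral_inner_le {nOff m t : ℕ} {lam : ℝ} (hlam : 0 < lam) (h : History X A nOff m t)
    (u θ' θ₁ : EuclideanSpace ℝ (Fin d)) :
    ∫ x, inner ℝ u (M.meanFeature x (M.gibbs θ') - M.meanFeature x (M.gibbs θ₁)) ∂M.d0 ≤
      inducedNorm (M.covMatrix lam h) u * ∫ x, M.promptNorm lam h θ' θ₁ x ∂M.d0 := by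
  rw [← integral_const_mul]
  refine integral_mono ?_ ((M.integrable_promptNorm hlam h θ' θ₁).const_mul _) fun x =>
    inner_le_inducedNorm_mul (M.covMatrix_posDef hlam h) _ _
  simp only [inner_sub_right]
  exact (M.integrable_inner_meanFeature u θ').sub (M.integrable_inner_meanFeature u θ₁)

/-- The bound that needs no data, for the case in which `ε √L` is not small compared with `B`. -/
lemma integral_inner_le_four_mul {u : EuclideanSpace ℝ (Fin d)} (hu : ‖u‖ ≤ 2 * M.B)
    (θ' θ₁ : EuclideanSpace ℝ (Fin d)) :
    ∫ x, inner ℝ u (M.meanFeature x (M.gibbs θ') - M.meanFeature x (M.gibbs θ₁)) ∂M.d0 ≤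
      4 * M.B := by
  have := M.d0_prob
  have hB := M.B_pos
  have h := norm_integral_le_of_norm_le_const (μ := M.d0) (C := 4 * M.B)
    (f := fun x => inner ℝ u (M.meanFeature x (M.gibbs θ') - M.meanFeature x (M.gibbs θ₁)))
    (ae_of_all _ fun x => ?_)
  · rw [probReal_univ, mul_one] at h
    exact (le_abs_self _).trans h
  · refine (norm_inner_le_norm _ _).trans ?_
    calc _ ≤ (2 * M.B) * 2 := mul_le_mul hu (M.norm_meanFeature_sub_le θ' θ₁ x) (norm_nonneg _)
          (by positivity)
      _ = _ := by ring

/-- The offline part of `sumSq` is nonnegative and absent from the covariance matrix, so it is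
dropped. -/
lemma sq_inducedNorm_covMatrix_le {nOff m t : ℕ} {lam : ℝ} (hlam : 0 < lam)
    (h : History X A nOff m t) {u : EuclideanSpace ℝ (Fin d)} (hu : ‖u‖ ≤ 2 * M.B) :
    inducedNorm (M.covMatrix lam h) u ^ 2 ≤ 4 * M.B ^ 2 * lam + M.sumSq h u / m := by
  rw [covMatrix_eq_gramMatrix, sq_inducedNorm_gramMatrix hlam (by positivity), sumSq]
  have h1 : ‖u‖ ^ 2 ≤ (2 * M.B) ^ 2 := by gcongr
  have h2 : 0 ≤ (∑ i, inner ℝ (M.featureDiff (h.1 i)) u ^ 2) / (m : ℝ) := by positivity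
  rw [add_div, one_div_mul_eq_div]
  nlinarith

lemma sumSq_neg {nOff m t : ℕ} (h : History X A nOff m t) (u : EuclideanSpace ℝ (Fin d)) :
    M.sumSq h (-u) = M.sumSq h u := by
  simp [sumSq]

/-- The bound for one iteration, on the event that the concentration bounds hold. -/
lemma gap_le_of_concentration {nOff m t : ℕ} (hm : 1 ≤ m) {R : GSHFRules X A d nOff m}
    {lam β : ℝ} (hR : R.IsOptionII M lam β) (hlam : 0 < lam) (hβ : 0 < β)
    (h : History X A nOff m t) (b : Fin m → Sample X A) {θ' : EuclideanSpace ℝ (Fin d)}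
    (hopt : M.IsOptimal (M.gibbs θ')) {r κ l : ℝ} (hr : 0 ≤ r) (hκ : 0 ≤ κ)
    (hsq : 4 * M.B ^ 2 * lam + M.sumSq h (R.mle t h - M.θstar) / m ≤ r ^ 2)
    (hrβ : 4 * r ≤ β * m) (hl : 2 / √lam * l ≤ κ * m)
    (hprompt : m * ∫ x, M.promptNorm lam h θ' (R.mainParam t h) x ∂M.d0 ≤
      2 * ∑ j, M.promptNorm lam h θ' (R.mainParam t h) (b j).1 + 2 * (2 / √lam) * l)
    (hsample : ∑ j, M.promptNorm lam h (R.enhParam t h fun j => (b j).1) (R.mainParam t h) (b j).1 ≤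
      2 * ∑ j, M.sampleNorm lam h (b j) + 2 * (2 / √lam) * l)
    (hsum : ∑ j, M.sampleNorm lam h (b j) ≤ 2 * m) :
    M.J (M.gibbs θ') - M.J (R.mainPolicy M h) ≤
      r * (8 + 6 * κ) - M.η * M.expectedKL (M.gibbs θ') (R.mainPolicy M h) := by
  have hm0 : (0 : ℝ) < m := by exact_mod_cast hm
  have hid := M.J_sub_J_add_expectedKL θ' (hR.mle_mem t h) (hR.main_max t h)
  change M.J (M.gibbs θ') - M.J (R.mainPolicy M h) +
    M.η * M.expectedKL (M.gibbs θ') (R.mainPolicy M h) = _ at hid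
  have hu : ‖M.θstar - R.mle t h‖ ≤ 2 * M.B := by
    have := norm_sub_le M.θstar (R.mle t h)
    linarith [M.θstar_norm_le, hR.mle_mem t h]
  have hU := M.integral_inner_le hlam h (M.θstar - R.mle t h) θ' (R.mainParam t h)
  have hI0 : 0 ≤ ∫ x, M.promptNorm lam h θ' (R.mainParam t h) x ∂M.d0 :=
    integral_nonneg fun x => inducedNorm_nonneg _ _
  have hnorm : inducedNorm (M.covMatrix lam h) (M.θstar - R.mle t h) ≤ r := by
    refine le_of_sq_le_sq ((M.sq_inducedNorm_covMatrix_le hlam h hu).trans ?_) hr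
    rwa [← neg_sub (R.mle t h), sumSq_neg]
  rw [← hid] at hU
  have hJ : M.J (R.mainPolicy M h) ≤ M.J (M.gibbs θ') := hopt.2 (hR.main_mem t h)
  have hmax := hR.enh_max t h fun j => (b j).1
  have hunc : ∀ θ, M.uncertainty lam β h (fun j => (b j).1) (R.mainPolicy M h) (M.gibbs θ) =
    β * ∑ j, M.promptNorm lam h θ (R.mainParam t h) (b j).1 := fun θ => rfl
  set P := ∑ j, M.promptNorm lam h θ' (R.mainParam t h) (b j).1
  set I := ∫ x, M.promptNorm lam h θ' (R.mainParam t h) x ∂M.d0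
  set D := M.η * M.expectedKL (M.gibbs θ') (R.mainPolicy M h) with hD
  set U := M.J (M.gibbs θ') - M.J (R.mainPolicy M h) + D with hUdef
  have hUI : U * m ≤ r * (2 * P + 2 * (κ * m)) := by
    calc U * m ≤ (r * I) * m := by
          gcongr
          exact hU.trans (by gcongr)
      _ = r * (m * I) := by ring
      _ ≤ _ := by
          gcongr
          linarith
  suffices U ≤ r * (8 + 6 * κ) by linarith
  -- If `π*` is admissible for the enhancer, its uncertainty on the batch is at most that of the
  -- enhancer.
  by_cases hmem : M.gibbs θ' ∈ M.enhancerSet lam β h (fun j => (b j).1) (R.mainPolicy M h)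
  · have hPQ := hmax hmem
    have hPQ' : P ≤ ∑ j, M.promptNorm lam h (R.enhParam t h fun j => (b j).1) (R.mainParam t h)
        (b j).1 := le_of_mul_le_mul_left hPQ hβ
    have hP : P ≤ 4 * m + 2 * (κ * m) := by linarith
    refine le_of_mul_le_mul_right (hUI.trans ?_) hm0
    calc r * (2 * P + 2 * (κ * m)) ≤ r * (2 * (4 * m + 2 * (κ * m)) + 2 * (κ * m)) := by gcongr
      _ = _ := by ring
  -- Otherwise `D` alone exceeds `β * P`, and `U ≥ D` by optimality of `π*`. As `4 * r ≤ β * m`, the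
  -- term `2 * r * P` in the bound for `U * m` is at most half of `U * m` and is absorbed.
  · have hlt : β * P < D := by
      by_contra hcon
      exact hmem ⟨hopt.1, by rw [hunc]; exact not_lt.1 hcon⟩
    have hP0 : 0 ≤ P := Finset.sum_nonneg fun j _ => inducedNorm_nonneg _ _
    have h1 : r * P * 4 ≤ β * m * P := by nlinarith
    have h2 : β * P * m ≤ U * m := by
      gcongr
      linarith
    refine le_of_mul_le_mul_right ?_ hm0
    have h3 : 0 ≤ r * (κ * m) := by positivity
    have h4 : 0 ≤ r * m := by positivity
    nlinarith

/-- The numerical constraints between the parameters of the algorithm. -/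
lemma radius_bounds (hd : 1 ≤ d) {cβ c ε δ : ℝ} (hcβ : 0 < cβ) (hc : 0 < c) (hε : 0 < ε)
    (hδ : 0 < δ) (hδ1 : δ < 1) {C₁ K : ℝ}
    (hεB : ε ≤ M.B) (hLB : ε ^ 2 * M.logFactor ε δ ≤ M.B ^ 2)
    (hK : Real.log (M.numIter c ε δ / δ) ≤ K * M.logFactor ε δ)
    (hsmall : 16 * C₁ ^ 2 * (ε ^ 2 * M.logFactor ε δ) ≤
      cβ ^ 2 * min (1 / 2) (2 / c) * M.B ^ 2) :
    4 * M.B ^ 2 * M.regParam c ε δ (M.numIter c ε δ) ≤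
        4 * c * K * (ε ^ 2 * M.logFactor ε δ) ∧
      4 * (C₁ * ε * √(M.logFactor ε δ)) ≤
        M.bonusParam cβ ε δ (M.numIter c ε δ) * M.batchSize ε ∧
      2 / √(M.regParam c ε δ (M.numIter c ε δ)) * Real.log (M.numIter c ε δ / δ) ≤
        √(4 * K / c) * M.batchSize ε := by
  have hγ := M.gamma_pos
  have hB := M.B_pos
  have hγB := M.gamma_mul_B_le_one
  have hd1 : (1 : ℝ) ≤ d := by exact_mod_cast hd
  have hL := M.half_le_logFactor hε hδ
  have hm := M.le_batchSize ε
  have hm0 : (0 : ℝ) < M.batchSize ε := by exact_mod_cast M.batchSize_pos hd hε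
  have hl0 := log_div_pos (M.one_le_numIter hd hc hε hδ hδ1) hδ hδ1
  have hl1 := M.log_numIter_div_ge hd hc hε hδ hδ1 hεB
  have hlam := M.regParam_pos hd hc hε hδ hδ1 (M.one_le_numIter hd hc hε hδ hδ1)
  have hc0 : 0 < min (1 / 2) (2 / c) := by positivity
  set c₀ := min (1 / 2) (2 / c)
  simp only [bonusParam]
  set lam := M.regParam c ε δ (M.numIter c ε δ) with hlamdef
  rw [regParam] at hlamdef
  set l := Real.log (M.numIter c ε δ / δ)
  have hm1 : (1 : ℝ) ≤ M.batchSize ε := by exact_mod_cast M.batchSize_pos hd hε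
  set m : ℝ := (M.batchSize ε : ℝ)
  set L := M.logFactor ε δ
  have hK0 : 0 < K := pos_of_mul_pos_left (hl0.trans_le hK) (by linarith)
  have hd0 : (0 : ℝ) < d := by linarith
  have hdm : (d : ℝ) ≤ m * (M.gamma ^ 2 * ε ^ 2) := (div_le_iff₀ (by positivity)).1 hm
  have hgB2 : M.gamma ^ 2 * M.B ^ 2 ≤ 1 := by
    rw [← mul_pow]
    exact pow_le_one₀ (by positivity) hγB
  refine ⟨?_, ?_, ?_⟩
  · calc 4 * M.B ^ 2 * lam = 4 * c * (d / (m * M.gamma ^ 2)) * l := by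
          rw [hlamdef]; field_simp
      _ ≤ 4 * c * ε ^ 2 * (K * L) := by
          gcongr
          rw [div_le_iff₀ (by positivity)]
          linarith
      _ = _ := by ring
  -- The uncertainty is a sum over the batch, so `β * m` is what matters. Its square contains `m /
  -- γ² ≥ B²`, and the hypothesis `hsmall` is calibrated to this.
  · refine le_of_sq_le_sq ?_ (by positivity)
    rw [mul_pow, mul_pow (C₁ * ε), mul_pow C₁, Real.sq_sqrt (by linarith), mul_pow, mul_pow,
      Real.sq_sqrt (by positivity)]
    calc 4 ^ 2 * (C₁ ^ 2 * ε ^ 2 * L) = 16 * C₁ ^ 2 * (ε ^ 2 * L) := by ring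
      _ ≤ cβ ^ 2 * c₀ * M.B ^ 2 := hsmall
      _ ≤ cβ ^ 2 * l * (m / M.gamma ^ 2) := by
          gcongr
          rw [le_div_iff₀ (by positivity), mul_comm]
          linarith
      _ ≤ cβ ^ 2 * l * (d * (m / M.gamma ^ 2)) := by
          gcongr
          exact le_mul_of_one_le_left (by positivity) hd1
      _ = _ := by field_simp
  -- The point is `L / d ≤ m`: indeed `γ² ε² L ≤ γ² B² ≤ 1 ≤ d ≤ m γ² ε²`.
  · refine le_of_sq_le_sq ?_ (by positivity)
    rw [mul_pow, div_pow, mul_pow, Real.sq_sqrt hlam.le, Real.sq_sqrt (by positivity)]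
    calc 2 ^ 2 / lam * l ^ 2 = 4 / c * l * m / d * (M.gamma ^ 2 * M.B ^ 2) := by
          rw [hlamdef]; field_simp; norm_num
      _ ≤ 4 / c * (K * L) * m / d * 1 := by gcongr
      _ = 4 * K / c * (m * (L / d)) := by field_simp
      _ ≤ 4 * K / c * (m * m) := by
          gcongr
          rw [div_le_iff₀ hd0]
          refine le_trans ?_ (le_mul_of_one_le_right hm0.le hd1)
          refine le_of_mul_le_mul_right (a := M.gamma ^ 2 * ε ^ 2) ?_ (by positivity)
          calc L * (M.gamma ^ 2 * ε ^ 2) = M.gamma ^ 2 * (ε ^ 2 * L) := by ring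
            _ ≤ M.gamma ^ 2 * M.B ^ 2 := by gcongr
            _ ≤ m * (M.gamma ^ 2 * ε ^ 2) := by linarith
      _ = _ := by ring

end KLBandit

/-! ### Union bounds and assembly of the two regimes -/

lemma measure_setOf_exists_le {Ω : Type*} [MeasurableSpace Ω] {μ : Measure Ω} {T : ℕ} (hT : 1 ≤ T)
    {δ : ℝ} (hδ : 0 < δ) {p : Fin T → Ω → Prop}
    (hp : ∀ t, μ {ω | p t ω} ≤ ENNReal.ofReal (Real.exp (-Real.log (T / δ)))) :
    μ {ω | ∃ t, p t ω} ≤ ENNReal.ofReal δ := by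
  have hT0 : (0 : ℝ) < T := by exact_mod_cast hT
  have e : {ω | ∃ t, p t ω} = ⋃ t, {ω | p t ω} := by ext; simp
  calc μ {ω | ∃ t, p t ω} ≤ ∑ t, μ {ω | p t ω} := by
        rw [e]
        exact measure_iUnion_fintype_le _ _
    _ ≤ ∑ _t : Fin T, ENNReal.ofReal (δ / T) := by
        refine Finset.sum_le_sum fun t _ => (hp t).trans_eq ?_
        rw [Real.exp_neg, Real.exp_log (by positivity), inv_div]
    _ = ENNReal.ofReal δ := by
        rw [Finset.sum_const, Finset.card_univ, Fintype.card_fin, nsmul_eq_mul,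
          ← ENNReal.ofReal_natCast, ← ENNReal.ofReal_mul hT0.le, mul_div_cancel₀ _ hT0.ne']

/-- The whole space is covered by `G` and the three bad events, so subadditivity suffices and `G`
need not be measurable. -/
lemma one_sub_three_mul_le_measureReal {Ω : Type*} [MeasurableSpace Ω] {μ : Measure Ω}
    [IsProbabilityMeasure μ] {δ : ℝ} (hδ : 0 ≤ δ) {E₀ E₁ E₂ G : Set Ω}
    (h₀ : μ E₀ ≤ ENNReal.ofReal δ) (h₁ : μ E₁ ≤ ENNReal.ofReal δ) (h₂ : μ E₂ ≤ ENNReal.ofReal δ)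
    (hG : ∀ ω, ω ∉ E₀ → ω ∉ E₁ → ω ∉ E₂ → ω ∈ G) : 1 - 3 * δ ≤ μ.real G := by
  have hreal : ∀ {E : Set Ω}, μ E ≤ ENNReal.ofReal δ → μ.real E ≤ δ := fun hE =>
    ENNReal.toReal_le_of_le_ofReal hδ hE
  have hcover : Set.univ ⊆ G ∪ (E₀ ∪ (E₁ ∪ E₂)) := fun ω _ => by
    have := hG ω
    simp only [Set.mem_union]
    tauto
  have h := measureReal_mono (μ := μ) hcover
  rw [probReal_univ] at h
  linarith [hreal h₀, hreal h₁, hreal h₂, measureReal_union_le (μ := μ) G (E₀ ∪ (E₁ ∪ E₂)),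
    measureReal_union_le (μ := μ) E₀ (E₁ ∪ E₂), measureReal_union_le (μ := μ) E₁ E₂]

lemma GSHFRules.runLaw_before_sumSq_gt_le {X A : Type*} [MeasurableSpace X] [MeasurableSpace A]
    {d nOff m : ℕ} (R : GSHFRules X A d nOff m) (M : KLBandit X A d)
    (ρ : Measure (Fin nOff → X × A × A)) {T : ℕ} (t : Fin T) (v : ℝ) :
    R.runLaw M ρ T {h | v < M.sumSq (h.before t) (R.mle t (h.before t) - M.θstar)} =
      R.runLaw M ρ t {h | v < M.sumSq h (R.mle t h - M.θstar)} := by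
  rw [← R.runLaw_map_take M ρ t.2.le, Measure.map_apply (History.measurable_take _)
    (measurableSet_lt measurable_const (R.measurable_sumSq M t))]
  rfl

/-- The constant in the confidence radius. -/
def radiusConst (c : ℝ) : ℝ := √(500000 * netConst c ^ 2 + 4 * c * (4 * iterConst c + 2))

lemma radiusConst_pos {c : ℝ} (hc : 0 < c) : 0 < radiusConst c := by
  have := nine_le_iterConst c
  have := eight_le_netConst c
  exact Real.sqrt_pos.2 (by positivity)

/-- The largest ratio `ε √L / B` for which the concentration argument is used. -/
def ratioConst (cβ c : ℝ) : ℝ := min (1 / 2) (cβ * √(min (1 / 2) (2 / c)) / (4 * radiusConst c))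

lemma ratioConst_pos {cβ c : ℝ} (hcβ : 0 < cβ) (hc : 0 < c) : 0 < ratioConst cβ c := by
  have := radiusConst_pos hc
  have : 0 < min (1 / 2) (2 / c) := by positivity
  rw [ratioConst]
  positivity

namespace GSHFRules

variable {X A : Type*} [MeasurableSpace X] [MeasurableSpace A] {d nOff : ℕ} {M : KLBandit X A d}
  {cβ c ε δ : ℝ}

/-- The bound for the best iterate in the case of a small `ε`. -/
lemma IsOptionII.runLaw_gap_ge {R : GSHFRules X A d nOff (M.batchSize ε)}
    (hR : R.IsOptionII M (M.regParam c ε δ (M.numIter c ε δ))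
      (M.bonusParam cβ ε δ (M.numIter c ε δ)))
    (hd : 1 ≤ d) (hcβ : 0 < cβ) (hc : 0 < c) (hε : 0 < ε) (hδ : 0 < δ) (hδ1 : δ < 1)
    (ρ : Measure (Fin nOff → X × A × A)) [IsProbabilityMeasure ρ]
    {πstar : X → Measure A} (hπ : M.IsOptimal πstar)
    (hsmall : ε * √(M.logFactor ε δ) ≤ ratioConst cβ c * M.B) :
    1 - 3 * δ ≤ (R.runLaw M ρ (M.numIter c ε δ)).real
      {h | ∃ t₀ : Fin (M.numIter c ε δ), M.J πstar - M.J (R.mainPolicy M (h.before t₀)) ≤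
        radiusConst c * ε * √(M.logFactor ε δ) * (8 + 6 * √(4 * (4 * iterConst c + 2) / c)) -
          M.η * M.expectedKL πstar (R.mainPolicy M (h.before t₀))} := by
  obtain ⟨⟨θ', hθ', rfl⟩, hopt⟩ := hπ
  have hγ := M.gamma_pos
  have hB := M.B_pos
  have hd1 : (1 : ℝ) ≤ d := by exact_mod_cast hd
  have hL := M.half_le_logFactor hε hδ
  have hT := M.one_le_numIter hd hc hε hδ hδ1
  have hlam := M.regParam_pos hd hc hε hδ hδ1 hT
  have hmpos := M.batchSize_pos hd hε
  have hm0 : (0 : ℝ) < M.batchSize ε := by exact_mod_cast hmpos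
  have hC₁ := radiusConst_pos hc
  have hc0 : 0 < min (1 / 2) (2 / c) := by positivity
  have hy8 := eight_le_netConst c
  have hK := nine_le_iterConst c
  have hratio := ratioConst_pos hcβ hc
  have hratio1 : ratioConst cβ c ≤ 1 / 2 := min_le_left _ _
  have hratio2 : ratioConst cβ c * (4 * radiusConst c) ≤ cβ * √(min (1 / 2) (2 / c)) :=
    (le_div_iff₀ (by positivity)).1 (min_le_right _ _)
  have hsq : ε ^ 2 * M.logFactor ε δ ≤ ratioConst cβ c ^ 2 * M.B ^ 2 := by
    have := pow_le_pow_left₀ (by positivity) hsmall 2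
    rwa [mul_pow, mul_pow, Real.sq_sqrt (by linarith)] at this
  have hLB : ε ^ 2 * M.logFactor ε δ ≤ (1 / 2) ^ 2 * M.B ^ 2 := hsq.trans (by gcongr)
  have hεB : ε ≤ M.B := by
    refine le_of_sq_le_sq ?_ hB.le
    have := mul_le_mul_of_nonneg_left hL (sq_nonneg ε)
    linarith [sq_nonneg M.B]
  -- Smallness of `ε` relative to `B` thus yields the regime `γ² ε² ≤ d`, in which `T` is
  -- controlled, although it is not assumed here.
  have hγε : M.gamma * ε ≤ 1 := le_trans (by gcongr) M.gamma_mul_B_le_one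
  have hlle := M.log_numIter_div_le hd hc hε hδ hδ1 hγε
  have hsm : 16 * radiusConst c ^ 2 * (ε ^ 2 * M.logFactor ε δ) ≤
      cβ ^ 2 * min (1 / 2) (2 / c) * M.B ^ 2 := by
    have h1 := pow_le_pow_left₀ (by positivity) hratio2 2
    rw [mul_pow, mul_pow cβ, Real.sq_sqrt hc0.le] at h1
    calc _ ≤ 16 * radiusConst c ^ 2 * (ratioConst cβ c ^ 2 * M.B ^ 2) := by gcongr
      _ = ratioConst cβ c ^ 2 * (4 * radiusConst c) ^ 2 * M.B ^ 2 := by ring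
      _ ≤ _ := by gcongr
  obtain ⟨hb1, hb2, hb3⟩ := M.radius_bounds hd hcβ hc hε hδ hδ1 hεB
    (hLB.trans (by linarith [sq_nonneg M.B])) hlle hsm
  obtain ⟨s, k, hs, hst, hks, hkd⟩ := M.exists_net_parameters hd hc hε hδ hδ1 hγε
  have hβ : 0 < M.bonusParam cβ ε δ (M.numIter c ε δ) := by
    have : 0 < radiusConst c * ε * √(M.logFactor ε δ) := by positivity
    exact pos_of_mul_pos_left (by linarith) hm0.le
  have hTd := M.mul_log_le_numIter hd hc hε hδ hδ1
  set lam := M.regParam c ε δ (M.numIter c ε δ)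
  set T := M.numIter c ε δ
  set L := M.logFactor ε δ
  set l := Real.log (T / δ) with hl
  have hℓ : 1 ≤ netConst c ^ 2 * (d * L) := by
    have h1 : (8 : ℝ) ^ 2 ≤ netConst c ^ 2 := by gcongr
    have h2 : (1 : ℝ) * (1 / 2) ≤ d * L := by gcongr
    calc (1 : ℝ) ≤ 8 ^ 2 * (1 * (1 / 2)) := by norm_num
      _ ≤ _ := by gcongr
  -- The batch size is made for `d / (γ² m) ≤ ε²`.
  have hV : 500000 * (netConst c ^ 2 * (d * L)) / M.gamma ^ 2 / M.batchSize ε ≤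
      500000 * netConst c ^ 2 * (ε ^ 2 * L) := by
    have hdm : (d : ℝ) ≤ M.batchSize ε * (M.gamma ^ 2 * ε ^ 2) :=
      (div_le_iff₀ (by positivity)).1 (M.le_batchSize ε)
    rw [div_div, div_le_iff₀ (by positivity)]
    calc 500000 * (netConst c ^ 2 * (d * L)) ≤ 500000 * (netConst c ^ 2 *
          (M.batchSize ε * (M.gamma ^ 2 * ε ^ 2) * L)) := by gcongr
      _ = _ := by ring
  have hE0 := measure_setOf_exists_le hT hδ fun t : Fin T =>
    ((R.runLaw_before_sumSq_gt_le M ρ t _).trans_le (R.runLaw_sumSq_gt_le M ρ t (hR.mle_mem t)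
      (hR.mle_max t) hℓ hs (hst t t.2.le) hks)).trans (ENNReal.ofReal_le_ofReal hkd)
  have hE1 := measure_setOf_exists_le hT hδ fun t => R.runLaw_promptNorm_le M ρ t hlam θ' l
  have hE2 := measure_setOf_exists_le hT hδ fun t => R.runLaw_sampleNorm_le M ρ t hlam l
  refine one_sub_three_mul_le_measureReal hδ.le hE0 hE1 hE2 fun h hh0 hh1 hh2 => ?_
  simp only [Set.mem_ofPred_eq, not_exists, not_lt, not_le] at hh0 hh1 hh2
  -- The good iteration depends on the realized data, which is why the bad events were excluded for
  -- all iterations simultaneously.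
  obtain ⟨t, ht⟩ := M.exists_sum_sampleNorm_le hd hmpos hT hlam hTd h
  refine ⟨t, M.gap_le_of_concentration hmpos hR hlam hβ (h.before t) (h.2 t)
    ⟨⟨θ', hθ', rfl⟩, hopt⟩ (by positivity) (Real.sqrt_nonneg _) ?_ hb2 hb3 (hh1 t).le
    (hh2 t).le ht⟩
  rw [mul_pow, mul_pow, Real.sq_sqrt (by linarith), radiusConst, Real.sq_sqrt (by positivity)]
  calc _ ≤ 4 * c * (4 * iterConst c + 2) * (ε ^ 2 * L) +
        500000 * (netConst c ^ 2 * (d * L)) / M.gamma ^ 2 / M.batchSize ε := by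
        gcongr
        exact hh0 t
    _ ≤ _ := by linarith

/-- The trivial bound, which suffices if `ε` is large. -/
lemma IsOptionII.gap_le {m : ℕ} {lam β : ℝ} {R : GSHFRules X A d nOff m}
    (hR : R.IsOptionII M lam β) {πstar : X → Measure A} (hπ : M.IsOptimal πstar) {t : ℕ}
    (h : History X A nOff m t) :
    M.J πstar - M.J (R.mainPolicy M h) ≤
      4 * M.B - M.η * M.expectedKL πstar (R.mainPolicy M h) := by
  obtain ⟨⟨θ', hθ', rfl⟩, hopt⟩ := hπ
  have hid := M.J_sub_J_add_expectedKL θ' (hR.mle_mem t h) (hR.main_max t h)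
  have hu : ‖M.θstar - R.mle t h‖ ≤ 2 * M.B := by
    have := norm_sub_le M.θstar (R.mle t h)
    linarith [M.θstar_norm_le, hR.mle_mem t h]
  have hU := M.integral_inner_le_four_mul hu θ' (R.mainParam t h)
  rw [← hid] at hU
  change M.J (M.gibbs θ') - M.J (R.mainPolicy M h) +
    M.η * M.expectedKL (M.gibbs θ') (R.mainPolicy M h) ≤ _ at hU
  linarith

end GSHFRules

end

theorem mainTheorem2 (cβ cLam : ℝ) (hcβ : 0 < cβ) (hcLam : 0 < cLam) :
    ∃ C : ℝ, 0 < C ∧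
      ∀ (X A : Type*) [MeasurableSpace X] [MeasurableSpace A] (d : ℕ) (M : KLBandit X A d)
        (ε δ : ℝ), 1 ≤ d → 0 < ε → 0 < δ → δ < 1 →
        -- the gap of the best iterate, for every run of the algorithm
        (∀ (nOff : ℕ) (ρ : MeasureTheory.Measure (Fin nOff → X × A × A))
            [MeasureTheory.IsProbabilityMeasure ρ]
            (R : GSHFRules X A d nOff (M.batchSize ε)),
            R.IsOptionII M (M.regParam cLam ε δ (M.numIter cLam ε δ))
              (M.bonusParam cβ ε δ (M.numIter cLam ε δ)) →
            ∀ πstar : X → MeasureTheory.Measure A, M.IsOptimal πstar →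
              1 - 3 * δ ≤ (R.runLaw M ρ (M.numIter cLam ε δ)).real
                {h | ∃ t₀ : Fin (M.numIter cLam ε δ),
                  M.J πstar - M.J (R.mainPolicy M (h.before t₀)) ≤
                    C * ε * √(M.logFactor ε δ)
                      - M.η * M.expectedKL πstar (R.mainPolicy M (h.before t₀))}) ∧
        -- the number of collected samples
        (M.gamma ^ 2 * ε ^ 2 ≤ d →
          (M.batchSize ε : ℝ) * M.numIter cLam ε δ ≤
            C * (d ^ 2 / (M.gamma ^ 2 * ε ^ 2)) * M.logFactor ε δ) := by
  have hK := nine_le_iterConst cLam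
  have hC₁ := radiusConst_pos hcLam
  have hratio := ratioConst_pos hcβ hcLam
  have hc₁ : 0 < 4 / ratioConst cβ cLam := by positivity
  have hc₂ : 0 < radiusConst cLam * (8 + 6 * √(4 * (4 * iterConst cLam + 2) / cLam)) := by
    positivity
  -- One summand each for large `ε √L`, for small `ε √L` and for the number of samples.
  refine ⟨4 / ratioConst cβ cLam +
    radiusConst cLam * (8 + 6 * √(4 * (4 * iterConst cLam + 2) / cLam)) + 4 * iterConst cLam,
    by positivity, ?_⟩
  intro X A _ _ d M ε δ hd hε hδ hδ1
  have hγ := M.gamma_pos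
  have hL := M.half_le_logFactor hε hδ
  refine ⟨fun nOff ρ _ R hR πstar hπ => ?_, fun hγε => ?_⟩
  · have hx : 0 < ε * √(M.logFactor ε δ) := by positivity
    rcases le_total (ε * √(M.logFactor ε δ)) (ratioConst cβ cLam * M.B) with h | h
    · refine (hR.runLaw_gap_ge hd hcβ hcLam hε hδ hδ1 ρ hπ h).trans
        (measureReal_mono fun g ⟨t, ht⟩ => ⟨t, ht.trans (sub_le_sub_right ?_ _)⟩)
      nlinarith
    -- Here `4 B` is already below the target, on every history, and the first iterate will do.
    · have huniv : {h : History X A nOff (M.batchSize ε) (M.numIter cLam ε δ) |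
          ∃ t₀ : Fin (M.numIter cLam ε δ), M.J πstar - M.J (R.mainPolicy M (h.before t₀)) ≤
            (4 / ratioConst cβ cLam + radiusConst cLam *
              (8 + 6 * √(4 * (4 * iterConst cLam + 2) / cLam)) + 4 * iterConst cLam) * ε *
              √(M.logFactor ε δ) -
              M.η * M.expectedKL πstar (R.mainPolicy M (h.before t₀))} = Set.univ := by
        refine Set.eq_univ_of_forall fun g => ⟨⟨0, M.one_le_numIter hd hcLam hε hδ hδ1⟩,
          (hR.gap_le hπ _).trans (sub_le_sub_right ?_ _)⟩
        have h1 : 4 * M.B ≤ 4 / ratioConst cβ cLam * (ε * √(M.logFactor ε δ)) := by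
          rw [div_mul_eq_mul_div, le_div_iff₀ hratio]
          linarith
        nlinarith
      rw [huniv, probReal_univ]
      linarith
  · refine (M.batchSize_mul_numIter_le hd hcLam hε hδ hδ1 hγε).trans ?_
    gcongr
    linarith
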